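/- **Setting.** Let $B\subset\mathbb R^3$ be a bounded open region with smooth ($C^\infty$) boundary surface $\partial B$, outward unit normal $n_i$; let $I=[0,\infty)$. Latin indices range over $1,2,3$, repeated indices are summed, $f_{,i}$ is a spatial partial derivative and a dot is the time derivative. $C^{M,N}(\bar B\times I)$ denotes the functions whose derivatives of order $m\le M$ in space and $n\le N$ in time with $m+n\le\max\{M,N\}$ exist and are continuous on $\bar B\times I$. Fix constants $\rho>0$, $T_0>0$, $\beta\ne0$, $c\neq 0$, $\gamma$ with $\gamma/\beta\ge 0$, put $\beta'=\beta+\gamma/(c\beta)$, and constant coefficients with $$a^{(11)}_{ijkl}=a^{(11)}_{jikl}=a^{(11)}_{klij},\quad a^{(14)}_{ij}=a^{(14)}_{ji},\quad a^{(22)}_{ijklhm}=a^{(22)}_{jiklhm}=a^{(22)}_{lhmijk},\quad a^{(23)}_{ijkl}=a^{(23)}_{jikl},\quad a^{(33)}_{ij}=a^{(33)}_{ji},$$ $$k_{ij}=k_{ji},\quad a^{(17)}_{ijkl}=a^{(17)}_{jikl},\quad a^{(77)}_{ijkl}=a^{(77)}_{jikl}=a^{(77)}_{klij},\quad a^{(47)}_{ij}=a^{(47)}_{ji},\qquad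 k_{ij}\eta_i\eta_j\ge0\ \ \forall \eta .$$ **Problem $\Pi$.** An admissible process is an array $\pi=(u_i,\theta,\varphi,e_{ij},\kappa_{ijk},\beta_i,E_i,V_{ij},\tau_{ij},\mu_{ijk},\sigma_i,Q_{ij},\eta,q_i)$ with $u_i\in C^{4,2}$, $\varphi\in C^{4,0}$, $\theta\in C^{2,2}$, $e_{ij},V_{ij}\in C^{2,1}$, $\eta\in C^{0,1}$, $\kappa_{ijk},E_i,\mu_{ijk},Q_{ij}\in C^{2,0}$, $\beta_i,\tau_{ij},\sigma_i,q_i\in C^{1,0}$ on $\bar B\times I$ and $e_{ij}=e_{ji}$, $\kappa_{ijk}=\kappa_{jik}$, $V_{ij}=V_{ji}$, $\tau_{ij}=\tau_{ji}$, $\mu_{kji}=\mu_{jki}$, $Q_{ij}=Q_{ji}$. The field equations, on $B\times I$, are $$\tau_{ji,j}-\mu_{kji,kj}+\rho f_i=\rho\ddot u_i,\qquad \sigma_{i,i}-Q_{ji,ji}=g,\qquad \rho T_0\dot\eta+q_{j,j}-\rho h=0,$$ $$e_{ij}=\tfrac12(u_{i,j}+u_{j,i}),\quad \kappa_{ijk}=u_{k,ij},\quad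 \beta_i=\theta_{,i},\quad E_i=-\varphi_{,i},\quad V_{ij}=-\varphi_{,ij},$$ $$\tau_{ij}=a^{(11)}_{ijkl}e_{kl}+a^{(17)}_{ijkl}V_{kl}+a^{(14)}_{ij}(\theta+\beta\dot\theta),\qquad \mu_{ijk}=a^{(22)}_{ijklhm}\kappa_{lhm}+a^{(23)}_{ijkl}E_l,$$ $$-\sigma_i=a^{(23)}_{jkli}\kappa_{jkl}+a^{(33)}_{ij}E_j,\qquad -Q_{ij}=a^{(17)}_{klij}e_{kl}+a^{(77)}_{ijkl}V_{kl}+a^{(47)}_{ij}(\theta+\beta\dot\theta),$$ $$-\rho\eta=a^{(14)}_{ij}e_{ij}+a^{(47)}_{ij}V_{ij}+c(\theta+\beta'\dot\theta),\qquad -q_i/T_0=k_{ij}\beta_j .$$ With $\mathcal D f=n_if_{,i}$ and $\mathcal D_if=(\delta_{ij}-n_in_j)f_{,j}$ put on $\partial B$ $$P_i=(\tau_{ji}-\mu_{kji,k})n_j-\mathcal D_j(\mu_{kji}n_k)+(\mathcal D_ln_l)\mu_{kji}n_kn_j,\qquad R_i=\mu_{kji}n_kn_j,$$ $$\Lambda=(\sigma_j-Q_{kj,k})n_j-\mathcal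 D_j(Q_{kj}n_k)+(\mathcal D_ln_l)Q_{kj}n_kn_j,\qquad H=Q_{kj}n_kn_j,\qquad q=q_in_i .$$ For given subsets $S_i,\Sigma_i$ of $\partial B$ with $\bar S_i\cup\Sigma_i=\partial B$, $S_i\cap\Sigma_i=\varnothing$ $(i=1,\dots,5)$ and continuous data $f_i,g,h,u^0_i,v^0_i,\theta^0,\eta^0,\hat u_i,\hat d_i,\hat\theta,\hat\varphi,\hat\omega,\hat P_i,\hat R_i,\hat q,\hat\Lambda,\hat H$, a solution of $\Pi$ is an admissible process satisfying the field equations, the initial conditions $u_i(0)=u_i^0$, $\dot u_i(0)=v_i^0$, $\theta(0)=\theta^0$, $\eta(0)=\eta^0$ on $\bar B$, and, at all times, the boundary conditions $u_i=\hat u_i$ on $S_1$, $\mathcal Du_i=\hat d_i$ on $S_2$, $\theta=\hat\theta$ on $S_3$, $\varphi=\hat\varphi$ on $S_4$, $\mathcal D\varphi=\hat\omega$ on $S_5$, $P_i=\hat P_i$ on $\Sigma_1$, $R_i=\hat R_i$ on $\Sigma_2$, $q=\hat q$ on $\Sigma_3$, $\Lambda=\hat\Lambda$ on $\Sigma_4$,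 $H=\hat H$ on $\Sigma_5$. **Reciprocity theorem.** Let $[f_1*f_2](t)=\int_0^tf_1(\tau)f_2(t-\tau)\,d\tau$, $l(t)=1$, $\xi(t)=t$, and $A=I+\beta\,\partial/\partial t$ with $I$ here the identity. Let $\pi^{(1)},\pi^{(2)}$ be solutions of $\Pi$ (same body, material and sets $S_i,\Sigma_i$) for two systems of data, marked by $(1)$ and $(2)$, and for $\alpha=1,2$ set $$\mathcal F^{(\alpha)}_i=\rho\,\xi*f^{(\alpha)}_i+\rho v^{0(\alpha)}_it+\rho u^{0(\alpha)}_i,\qquad \mathcal H^{(\alpha)}=\rho T_0\eta^{0(\alpha)}+l*\rho h^{(\alpha)},$$ $$\mathcal L^{(\alpha)}=-\tfrac1\beta\gamma\,\theta^{0(\alpha)}\xi,\qquad \mathcal L^{(\alpha)}_j=\beta\,\xi*k_{ij}\theta^{0(\alpha)}_{,i}l .$$ For $t\in I$ and $\alpha,\beta\in\{1,2\}$ (as sub- and superscripts these are labels) define $$\begin{aligned}I_{\alpha\beta}(t)={}&\int_B\Bigl[\mathcal F^{(\alpha)}_i*u^{(\beta)}_i(t)-\xi*g^{(\alpha)}*\varphi^{(\beta)}(t)\Bigr]dv\\&+\xi*\int_{\partial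 B}\Bigl[P^{(\alpha)}_i*u^{(\beta)}_i(t)+R^{(\alpha)}_i*\mathcal Du^{(\beta)}_i(t)+\Lambda^{(\alpha)}*\varphi^{(\beta)}(t)+H^{(\alpha)}*\mathcal D\varphi^{(\beta)}(t)+\tfrac1{T_0}\,l*q^{(\alpha)}*A\theta^{(\beta)}(t)\Bigr]da\\&+\int_B\Bigl[-\mathcal L^{(\alpha)}*\theta^{(\beta)}(t)-\tfrac1{T_0}\,\xi*\mathcal H^{(\alpha)}*A\theta^{(\beta)}(t)+\mathcal L^{(\alpha)}_j*\theta^{(\beta)}_{,j}(t)\Bigr]dv .\end{aligned}$$ Then $I_{\alpha\beta}(t)=I_{\beta\alpha}(t)$ for all $t\in I$ and all $\alpha,\beta\in\{1,2\}$. -/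

import Mathlib

open scoped MeasureTheory ContDiff

namespace ThermoPiezo

noncomputable section

/-- Euclidean three-dimensional space with its Cartesian coordinates. -/
abbrev E3 : Type := EuclideanSpace ℝ (Fin 3)

/-- A scalar field depending on the place and on the time. Only its values on `closure B × [0, ∞)`
matter below. -/
abbrev Field : Type := E3 → ℝ → ℝ

/-! ### The body -/

/-- A bounded region with smooth boundary, given by a smooth defining function: the region is
`{ψ < 0}`, and the gradient of `ψ` does not vanish where `ψ` vanishes. Every bounded open set that
lies locally on one side of a smooth boundary surface has such a function (glue local defining
functions with a partition of unity). -/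
structure Body where
  ψ : E3 → ℝ
  smooth : ContDiff ℝ ∞ ψ
  regular : ∀ x, ψ x = 0 → gradient ψ x ≠ 0
  bounded : Bornology.IsBounded {x | ψ x < 0}

/-- The (open) region `B` occupied by the body. -/
def Body.region (Ω : Body) : Set E3 := {x | Ω.ψ x < 0}

/-- The closed region. -/
def Body.closed (Ω : Body) : Set E3 := closure Ω.region

/-- The boundary surface `∂B`. -/
def Body.bdry (Ω : Body) : Set E3 := frontier Ω.region

/-- The components of the outward unit normal `∇ψ / |∇ψ|`. The formula defines it, smoothly, in a
neighbourhood of the boundary surface. -/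
def Body.normal (Ω : Body) (i : Fin 3) (x : E3) : ℝ :=
  (‖gradient Ω.ψ x‖⁻¹ • gradient Ω.ψ x) i

/-! ### Derivatives and function classes -/

/-- The partial derivative `f_{,i}` on the closed region (at boundary points it is the one
determined by the values of `f` on the closed region). -/
def pd (Ω : Body) (i : Fin 3) (f : Field) : Field := fun x t =>
  fderivWithin ℝ (fun y => f y t) Ω.closed x (EuclideanSpace.single i (1 : ℝ))

/-- The time derivative on `[0, ∞)` (one-sided at `0`). -/
def dt (f : Field) : Field := fun x t => derivWithin (f x) (Set.Ici 0) t

/-- The iterated spatial derivative along a list of coordinate directions. -/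
def pdIter (Ω : Body) (l : List (Fin 3)) (f : Field) : Field := l.foldr (pd Ω) f

/-- The class `C^{M,N}(closure B × [0, ∞))`: the derivatives of order `m ≤ M` in space and
`n ≤ N` in time with `m + n ≤ max M N` exist and are continuous on `closure B × [0, ∞)`. -/
structure IsOfClass (Ω : Body) (M N : ℕ) (f : Field) : Prop where
  time_differentiable : ∀ n < N, ∀ x ∈ Ω.closed,
    DifferentiableOn ℝ (dt^[n] f x) (Set.Ici 0)
  space_differentiable : ∀ n ≤ N, ∀ l : List (Fin 3), l.length < M →
    l.length + n < max M N → ∀ t, 0 ≤ t →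
      DifferentiableOn ℝ (fun y => pdIter Ω l (dt^[n] f) y t) Ω.closed
  continuous : ∀ n ≤ N, ∀ l : List (Fin 3), l.length ≤ M →
    l.length + n ≤ max M N →
      ContinuousOn (fun p : E3 × ℝ => pdIter Ω l (dt^[n] f) p.1 p.2) (Ω.closed ×ˢ Set.Ici 0)

/-- The normal derivative `𝒟 f = n_i f_{,i}`. -/
def normalDeriv (Ω : Body) (f : Field) : Field := fun x t =>
  ∑ i, Ω.normal i x * pd Ω i f x t

/-- The surface gradient `𝒟_i f = (δ_{ij} - n_i n_j) f_{,j}`. -/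
def surfDeriv (Ω : Body) (i : Fin 3) (f : Field) : Field := fun x t =>
  ∑ j, ((if i = j then 1 else 0) - Ω.normal i x * Ω.normal j x) * pd Ω j f x t

/-- `𝒟_l n_l`. -/
def divNormal (Ω : Body) (x : E3) : ℝ :=
  ∑ l, surfDeriv Ω l (fun y _ => Ω.normal l y) x 0

/-! ### The material -/

/-- A homogeneous, centre-symmetric material: constants and constitutive coefficients, with their
symmetries and the restriction imposed by the dissipation inequality. -/
structure Material where
  ρ : ℝ
  T₀ : ℝ
  β : ℝ
  γ : ℝ
  c : ℝ
  a11 : Fin 3 → Fin 3 → Fin 3 → Fin 3 → ℝ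
  a17 : Fin 3 → Fin 3 → Fin 3 → Fin 3 → ℝ
  a14 : Fin 3 → Fin 3 → ℝ
  a22 : Fin 3 → Fin 3 → Fin 3 → Fin 3 → Fin 3 → Fin 3 → ℝ
  a23 : Fin 3 → Fin 3 → Fin 3 → Fin 3 → ℝ
  a33 : Fin 3 → Fin 3 → ℝ
  a77 : Fin 3 → Fin 3 → Fin 3 → Fin 3 → ℝ
  a47 : Fin 3 → Fin 3 → ℝ
  k : Fin 3 → Fin 3 → ℝ
  ρ_pos : 0 < ρ
  T₀_pos : 0 < T₀
  β_ne : β ≠ 0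
  c_ne : c ≠ 0
  a11_symm : ∀ i j p q, a11 i j p q = a11 j i p q ∧ a11 i j p q = a11 p q i j
  a14_symm : ∀ i j, a14 i j = a14 j i
  a22_symm : ∀ i j p l h m, a22 i j p l h m = a22 j i p l h m ∧ a22 i j p l h m = a22 l h m i j p
  a23_symm : ∀ i j p l, a23 i j p l = a23 j i p l
  a33_symm : ∀ i j, a33 i j = a33 j i
  k_symm : ∀ i j, k i j = k j i
  a17_symm : ∀ i j p l, a17 i j p l = a17 j i p l
  a77_symm : ∀ i j p q, a77 i j p q = a77 j i p q ∧ a77 i j p q = a77 p q i j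
  a47_symm : ∀ i j, a47 i j = a47 j i
  γ_div_β_nonneg : 0 ≤ γ / β
  k_nonneg : ∀ η : Fin 3 → ℝ, 0 ≤ ∑ i, ∑ j, k i j * η i * η j

/-- `β' = β + γ / (c β)`. -/
def Material.β' (M : Material) : ℝ := M.β + M.γ / (M.c * M.β)

/-- The operator `A = I + β ∂/∂t`. -/
def Material.A (M : Material) (f : Field) : Field := fun x t => f x t + M.β * dt f x t

/-! ### Processes -/

/-- An ordered array `(u, θ, φ, e, κ, β, E, V, τ, μ, σ, Q, η, q)` of fields; the temperature
gradient `β_i` is called `ϑ`. -/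
structure ProcessFields where
  u : Fin 3 → Field
  θ : Field
  φ : Field
  e : Fin 3 → Fin 3 → Field
  κ : Fin 3 → Fin 3 → Fin 3 → Field
  ϑ : Fin 3 → Field
  E : Fin 3 → Field
  V : Fin 3 → Fin 3 → Field
  τ : Fin 3 → Fin 3 → Field
  μ : Fin 3 → Fin 3 → Fin 3 → Field
  σ : Fin 3 → Field
  Q : Fin 3 → Fin 3 → Field
  η : Field
  q : Fin 3 → Field

/-- Admissible processes. -/
structure ProcessFields.IsAdmissible (Ω : Body) (π : ProcessFields) : Prop where
  u_class : ∀ i, IsOfClass Ω 4 2 (π.u i)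
  φ_class : IsOfClass Ω 4 0 π.φ
  θ_class : IsOfClass Ω 2 2 π.θ
  e_class : ∀ i j, IsOfClass Ω 2 1 (π.e i j)
  V_class : ∀ i j, IsOfClass Ω 2 1 (π.V i j)
  η_class : IsOfClass Ω 0 1 π.η
  κ_class : ∀ i j k, IsOfClass Ω 2 0 (π.κ i j k)
  E_class : ∀ i, IsOfClass Ω 2 0 (π.E i)
  μ_class : ∀ i j k, IsOfClass Ω 2 0 (π.μ i j k)
  Q_class : ∀ i j, IsOfClass Ω 2 0 (π.Q i j)
  ϑ_class : ∀ i, IsOfClass Ω 1 0 (π.ϑ i)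
  τ_class : ∀ i j, IsOfClass Ω 1 0 (π.τ i j)
  q_class : ∀ i, IsOfClass Ω 1 0 (π.q i)
  σ_class : ∀ i, IsOfClass Ω 1 0 (π.σ i)
  e_symm : ∀ i j, ∀ x ∈ Ω.closed, ∀ t, 0 ≤ t → π.e i j x t = π.e j i x t
  κ_symm : ∀ i j k, ∀ x ∈ Ω.closed, ∀ t, 0 ≤ t → π.κ i j k x t = π.κ j i k x t
  V_symm : ∀ i j, ∀ x ∈ Ω.closed, ∀ t, 0 ≤ t → π.V i j x t = π.V j i x t
  τ_symm : ∀ i j, ∀ x ∈ Ω.closed, ∀ t, 0 ≤ t → π.τ j i x t = π.τ i j x t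
  μ_symm : ∀ i j k, ∀ x ∈ Ω.closed, ∀ t, 0 ≤ t → π.μ k j i x t = π.μ j k i x t
  Q_symm : ∀ i j, ∀ x ∈ Ω.closed, ∀ t, 0 ≤ t → π.Q j i x t = π.Q i j x t

/-- The balance, geometrical and constitutive equations on `B × [0, ∞)` with supply terms
`f`, `g`, `h`. -/
structure ProcessFields.SatisfiesFieldEquations (M : Material) (Ω : Body)
    (f : Fin 3 → Field) (g h : Field) (π : ProcessFields) : Prop where
  motion : ∀ i, ∀ x ∈ Ω.region, ∀ t, 0 ≤ t →
    (∑ j, pd Ω j (π.τ j i) x t) - (∑ k, ∑ j, pd Ω j (pd Ω k (π.μ k j i)) x t) + M.ρ * f i x t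
      = M.ρ * dt (dt (π.u i)) x t
  electric : ∀ x ∈ Ω.region, ∀ t, 0 ≤ t →
    (∑ i, pd Ω i (π.σ i) x t) - (∑ j, ∑ i, pd Ω i (pd Ω j (π.Q j i)) x t) = g x t
  energy : ∀ x ∈ Ω.region, ∀ t, 0 ≤ t →
    M.ρ * M.T₀ * dt π.η x t + (∑ j, pd Ω j (π.q j) x t) - M.ρ * h x t = 0
  e_eq : ∀ i j, ∀ x ∈ Ω.region, ∀ t, 0 ≤ t →
    π.e i j x t = (1 / 2) * (pd Ω j (π.u i) x t + pd Ω i (π.u j) x t)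
  κ_eq : ∀ i j k, ∀ x ∈ Ω.region, ∀ t, 0 ≤ t →
    π.κ i j k x t = pd Ω j (pd Ω i (π.u k)) x t
  ϑ_eq : ∀ i, ∀ x ∈ Ω.region, ∀ t, 0 ≤ t → π.ϑ i x t = pd Ω i π.θ x t
  E_eq : ∀ i, ∀ x ∈ Ω.region, ∀ t, 0 ≤ t → π.E i x t = -pd Ω i π.φ x t
  V_eq : ∀ i j, ∀ x ∈ Ω.region, ∀ t, 0 ≤ t → π.V i j x t = -pd Ω j (pd Ω i π.φ) x t
  τ_eq : ∀ i j, ∀ x ∈ Ω.region, ∀ t, 0 ≤ t →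
    π.τ i j x t = (∑ k, ∑ l, M.a11 i j k l * π.e k l x t) + (∑ k, ∑ l, M.a17 i j k l * π.V k l x t)
      + M.a14 i j * (π.θ x t + M.β * dt π.θ x t)
  μ_eq : ∀ i j k, ∀ x ∈ Ω.region, ∀ t, 0 ≤ t →
    π.μ i j k x t = (∑ l, ∑ h, ∑ m, M.a22 i j k l h m * π.κ l h m x t)
      + ∑ l, M.a23 i j k l * π.E l x t
  σ_eq : ∀ i, ∀ x ∈ Ω.region, ∀ t, 0 ≤ t →
    -π.σ i x t = (∑ j, ∑ k, ∑ l, M.a23 j k l i * π.κ j k l x t) + ∑ j, M.a33 i j * π.E j x t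
  Q_eq : ∀ i j, ∀ x ∈ Ω.region, ∀ t, 0 ≤ t →
    -π.Q i j x t = (∑ k, ∑ l, M.a17 k l i j * π.e k l x t) + (∑ k, ∑ l, M.a77 i j k l * π.V k l x t)
      + M.a47 i j * (π.θ x t + M.β * dt π.θ x t)
  η_eq : ∀ x ∈ Ω.region, ∀ t, 0 ≤ t →
    -(M.ρ * π.η x t) = (∑ i, ∑ j, M.a14 i j * π.e i j x t) + (∑ i, ∑ j, M.a47 i j * π.V i j x t)
      + M.c * (π.θ x t + M.β' * dt π.θ x t)
  q_eq : ∀ i, ∀ x ∈ Ω.region, ∀ t, 0 ≤ t →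
    -(π.q i x t / M.T₀) = ∑ j, M.k i j * π.ϑ j x t

/-! ### Boundary quantities -/

/-- The traction
`P_i = (τ_{ji} - μ_{kji,k}) n_j - 𝒟_j (μ_{kji} n_k) + (𝒟_l n_l) μ_{kji} n_k n_j`. -/
def ProcessFields.P (Ω : Body) (π : ProcessFields) (i : Fin 3) : Field := fun x t =>
  (∑ j, (π.τ j i x t - ∑ k, pd Ω k (π.μ k j i) x t) * Ω.normal j x)
    - (∑ j, ∑ k, surfDeriv Ω j (fun y s => π.μ k j i y s * Ω.normal k y) x t)
    + divNormal Ω x * ∑ k, ∑ j, π.μ k j i x t * Ω.normal k x * Ω.normal j x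

/-- The hypertraction `R_i = μ_{kji} n_k n_j`. -/
def ProcessFields.R (Ω : Body) (π : ProcessFields) (i : Fin 3) : Field := fun x t =>
  ∑ k, ∑ j, π.μ k j i x t * Ω.normal k x * Ω.normal j x

/-- `Λ = (σ_j - Q_{kj,k}) n_j - 𝒟_j (Q_{kj} n_k) + (𝒟_l n_l) Q_{kj} n_k n_j`. -/
def ProcessFields.Lam (Ω : Body) (π : ProcessFields) : Field := fun x t =>
  (∑ j, (π.σ j x t - ∑ k, pd Ω k (π.Q k j) x t) * Ω.normal j x)
    - (∑ j, ∑ k, surfDeriv Ω j (fun y s => π.Q k j y s * Ω.normal k y) x t)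
    + divNormal Ω x * ∑ k, ∑ j, π.Q k j x t * Ω.normal k x * Ω.normal j x

/-- `H = Q_{kj} n_k n_j`. -/
def ProcessFields.H (Ω : Body) (π : ProcessFields) : Field := fun x t =>
  ∑ k, ∑ j, π.Q k j x t * Ω.normal k x * Ω.normal j x

/-- The heat flux `q = q_i n_i` through the boundary surface. -/
def ProcessFields.flux (Ω : Body) (π : ProcessFields) : Field := fun x t =>
  ∑ i, π.q i x t * Ω.normal i x

/-! ### The mixed initial-boundary value problem -/

/-- The five pairs `(S_i, Σ_i)` of parts of the boundary surface (index `0` to `4` for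
`i = 1, …, 5`). -/
structure BoundaryPartition (Ω : Body) where
  S : Fin 5 → Set E3
  Sg : Fin 5 → Set E3
  S_subset : ∀ i, S i ⊆ Ω.bdry
  Sg_subset : ∀ i, Sg i ⊆ Ω.bdry
  cover : ∀ i, closure (S i) ∪ Sg i = Ω.bdry
  disjoint : ∀ i, S i ∩ Sg i = ∅

/-- The given data. The suffix `0` marks initial data, the suffix `H` (for a hat) boundary data. -/
structure Data where
  f : Fin 3 → Field
  g : Field
  h : Field
  u0 : Fin 3 → E3 → ℝ
  v0 : Fin 3 → E3 → ℝ
  θ0 : E3 → ℝ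
  η0 : E3 → ℝ
  uH : Fin 3 → Field
  dH : Fin 3 → Field
  θH : Field
  φH : Field
  ωH : Field
  PH : Fin 3 → Field
  RH : Fin 3 → Field
  qH : Field
  ΛH : Field
  HH : Field

/-- Continuity of a time-dependent field on `X × [0, ∞)`. -/
def ContOn (X : Set E3) (f : Field) : Prop :=
  ContinuousOn (fun p : E3 × ℝ => f p.1 p.2) (X ×ˢ Set.Ici 0)

/-- The given data are continuous on their domains. -/
structure Data.IsContinuous (Ω : Body) (bp : BoundaryPartition Ω) (d : Data) : Prop where
  f : ∀ i, ContOn Ω.region (d.f i)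
  g : ContOn Ω.region d.g
  h : ContOn Ω.region d.h
  u0 : ∀ i, ContinuousOn (d.u0 i) Ω.closed
  v0 : ∀ i, ContinuousOn (d.v0 i) Ω.closed
  θ0 : ContinuousOn d.θ0 Ω.closed
  η0 : ContinuousOn d.η0 Ω.closed
  uH : ∀ i, ContOn (bp.S 0) (d.uH i)
  dH : ∀ i, ContOn (bp.S 1) (d.dH i)
  θH : ContOn (bp.S 2) d.θH
  φH : ContOn (bp.S 3) d.φH
  ωH : ContOn (bp.S 4) d.ωH
  PH : ∀ i, ContOn (bp.Sg 0) (d.PH i)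
  RH : ∀ i, ContOn (bp.Sg 1) (d.RH i)
  qH : ContOn (bp.Sg 2) d.qH
  ΛH : ContOn (bp.Sg 3) d.ΛH
  HH : ContOn (bp.Sg 4) d.HH

/-- The initial conditions on the closed region. -/
structure ProcessFields.SatisfiesInitialConditions (Ω : Body) (d : Data) (π : ProcessFields) : Prop where
  u : ∀ i, ∀ x ∈ Ω.closed, π.u i x 0 = d.u0 i x
  v : ∀ i, ∀ x ∈ Ω.closed, dt (π.u i) x 0 = d.v0 i x
  θ : ∀ x ∈ Ω.closed, π.θ x 0 = d.θ0 x
  η : ∀ x ∈ Ω.closed, π.η x 0 = d.η0 x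

/-- The boundary conditions. -/
structure ProcessFields.SatisfiesBoundaryConditions (Ω : Body) (bp : BoundaryPartition Ω) (d : Data)
    (π : ProcessFields) : Prop where
  u : ∀ i, ∀ x ∈ bp.S 0, ∀ t, 0 ≤ t → π.u i x t = d.uH i x t
  du : ∀ i, ∀ x ∈ bp.S 1, ∀ t, 0 ≤ t → normalDeriv Ω (π.u i) x t = d.dH i x t
  θ : ∀ x ∈ bp.S 2, ∀ t, 0 ≤ t → π.θ x t = d.θH x t
  φ : ∀ x ∈ bp.S 3, ∀ t, 0 ≤ t → π.φ x t = d.φH x t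
  dφ : ∀ x ∈ bp.S 4, ∀ t, 0 ≤ t → normalDeriv Ω π.φ x t = d.ωH x t
  P : ∀ i, ∀ x ∈ bp.Sg 0, ∀ t, 0 ≤ t → π.P Ω i x t = d.PH i x t
  R : ∀ i, ∀ x ∈ bp.Sg 1, ∀ t, 0 ≤ t → π.R Ω i x t = d.RH i x t
  q : ∀ x ∈ bp.Sg 2, ∀ t, 0 ≤ t → π.flux Ω x t = d.qH x t
  Λ : ∀ x ∈ bp.Sg 3, ∀ t, 0 ≤ t → π.Lam Ω x t = d.ΛH x t
  H : ∀ x ∈ bp.Sg 4, ∀ t, 0 ≤ t → π.H Ω x t = d.HH x t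

/-- `π` is a solution of the mixed initial-boundary value problem with given data `d`. -/
structure IsSolution (M : Material) (Ω : Body) (bp : BoundaryPartition Ω) (d : Data)
    (π : ProcessFields) : Prop where
  data_continuous : d.IsContinuous Ω bp
  admissible : π.IsAdmissible Ω
  field : π.SatisfiesFieldEquations M Ω d.f d.g d.h
  initial : π.SatisfiesInitialConditions Ω d
  boundary : π.SatisfiesBoundaryConditions Ω bp d

/-! ### Convolution and the reciprocity functional -/

/-- The convolution `(f * g)(t) = ∫₀ᵗ f(τ) g(t - τ) dτ`. -/
def conv (f g : ℝ → ℝ) : ℝ → ℝ := fun t => ∫ τ in (0 : ℝ)..t, f τ * g (t - τ)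

/-- `l(t) = 1`. -/
def lOne : ℝ → ℝ := fun _ => 1

/-- `ξ(t) = (l * l)(t) = t`. -/
def xi : ℝ → ℝ := fun t => t

/-- `ℱ_i = ρ ξ * f_i + ρ v_i⁰ t + ρ u_i⁰`. -/
def calF (M : Material) (d : Data) (i : Fin 3) : Field := fun x t =>
  M.ρ * conv xi (d.f i x) t + M.ρ * d.v0 i x * t + M.ρ * d.u0 i x

/-- `ℋ = ρ T₀ η⁰ + l * ρ h`. -/
def calH (M : Material) (d : Data) : Field := fun x t =>
  M.ρ * M.T₀ * d.η0 x + conv lOne (fun s => M.ρ * d.h x s) t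

/-- `ℒ = - (1/β) γ θ⁰ ξ`. -/
def calL (M : Material) (d : Data) : Field := fun x t =>
  -(1 / M.β * M.γ * d.θ0 x * xi t)

/-- `ℒ_j = β ξ * (k_{ij} θ⁰_{,i} l)`. -/
def calLvec (M : Material) (Ω : Body) (d : Data) (j : Fin 3) : Field := fun x t =>
  M.β * conv xi (fun s => (∑ i, M.k i j * pd Ω i (fun y _ => d.θ0 y) x 0) * lOne s) t

/-- The functional `I_{αβ}(t)`, built from the data `d₁` and the boundary quantities of the process
`π₁` with index `α` and from the fields of the process `π₂` with index `β`. The surface integral is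
taken with respect to the area, i.e. the normalized two-dimensional Hausdorff measure. -/
def recipI (M : Material) (Ω : Body) (d₁ : Data) (π₁ π₂ : ProcessFields) (t : ℝ) : ℝ :=
  (∫ x in Ω.region,
    ((∑ i, conv (calF M d₁ i x) (π₂.u i x) t) - conv (conv xi (d₁.g x)) (π₂.φ x) t))
  + conv xi (fun s => ∫ x in Ω.bdry,
      ((∑ i, (conv (π₁.P Ω i x) (π₂.u i x) s
          + conv (π₁.R Ω i x) (normalDeriv Ω (π₂.u i) x) s))
        + conv (π₁.Lam Ω x) (π₂.φ x) s
        + conv (π₁.H Ω x) (normalDeriv Ω π₂.φ x) s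
        + 1 / M.T₀ * conv (conv lOne (π₁.flux Ω x)) (M.A π₂.θ x) s) ∂μHE[2]) t
  + ∫ x in Ω.region,
      (-conv (calL M d₁ x) (π₂.θ x) t
        - 1 / M.T₀ * conv (conv xi (calH M d₁ x)) (M.A π₂.θ x) t
        + ∑ j, conv (calLvec M Ω d₁ j x) (pd Ω j π₂.θ x) t)

end

end ThermoPiezo

namespace ThermoPiezo

noncomputable section

open Set Filter Topology MeasureTheory
open scoped NNReal ENNReal

/-! ### Geometry of the body -/

/-! The functional turns out to be the space integral of a density that is symmetric at each point
of the region, so no further cancellation between different points is needed.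

Two mechanisms produce this density. Convolving the balance laws with `l` replaces the data by the
fields: the equation of motion, integrated twice in time, gives `ℱ = ρ u - ξ * (internal force)`,
and the energy equation gives `ℋ = ρ T₀ η + l * q_{j,j}` (`calF_eqOn`, `calH_eqOn`). Integration by
parts turns the surface integral into a volume integral of stress against strain plus internal force
against displacement (`integral_conv_tract`, `integral_conv_flux`). The internal forces, the charge
and the divergence of the heat flux then cancel, leaving only products of constitutive quantities
(`rep_recipDensity`).

These products are symmetric by the Betti argument, since the coefficients are
(`stress_reciprocity`, `doubleStress_reciprocity`), except for two thermal terms. The entropy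
contains `θ + β' θ̇` whereas it is paired with `θ + β θ̇`; the antisymmetric part is `γ/β` times
`θ̇₁ * θ₂ - θ₁ * θ̇₂`, and one convolution with `l` reduces it to initial temperatures, which `ℒ`
compensates. The heat flux is paired with the gradient of `θ + β θ̇`; again `l * θ̇_{,i} = θ_{,i} -
θ_{,i}(0) l`, and `ℒ_j` compensates the initial gradient (`flux_reciprocity`). All of this is
algebra in a commutative ring: continuous functions on `[0, ∞)` under convolution, with a unit
adjoined so that real constants become ring elements.

The geometric input is the divergence theorem for a smooth bounded region with Hausdorff area on its
boundary. It rests on local graphs from the implicit function theorem, the area formula for graphs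
and a partition of unity (`Body.greenIdentity`). The surface divergence theorem follows from it: the
skew tensor `n_k F_j - n_j F_k`, with `n` extended smoothly, has vanishing double divergence, and
the flux of its row divergence is the required surface expression (`integral_surface_div`). This is
what moves tangential derivatives off the test function and produces the exact form of the traction
(`integral_second_order`). -/

theorem Body.region_isOpen (Ω : Body) : IsOpen Ω.region :=
  isOpen_lt Ω.smooth.continuous continuous_const

theorem Body.hasFDerivAt (Ω : Body) (x : E3) :
    HasFDerivAt Ω.ψ (innerSL ℝ (gradient Ω.ψ x)) x :=
  ((Ω.smooth.differentiable (by simp)) x).hasGradientAt.hasFDerivAt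

/-- The slope of `ψ` along the ray tends to `∇ψ · v < 0`, so `ψ` is negative just after leaving the
boundary. This supplies both the approximation of boundary points from inside and the inward tangent
directions. -/
theorem Body.smul_mem_region (Ω : Body) {x v : E3} (hx : Ω.ψ x = 0)
    (hv : inner ℝ (gradient Ω.ψ x) v < 0) : ∀ᶠ t : ℝ in 𝓝[>] 0, x + t • v ∈ Ω.region := by
  have h1 : HasDerivAt (fun t : ℝ => x + t • v) v 0 := by
    simpa using ((hasDerivAt_id (0 : ℝ)).smul_const v).const_add x
  have h2 : HasDerivAt (fun t : ℝ => Ω.ψ (x + t • v)) (inner ℝ (gradient Ω.ψ x) v) 0 := by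
    have h0 := Ω.hasFDerivAt (x + (0 : ℝ) • v)
    have := h0.comp_hasDerivAt (0 : ℝ) h1
    rw [zero_smul, add_zero] at this
    exact this
  have h3 := (hasDerivWithinAt_iff_tendsto_slope' (s := Ioi (0 : ℝ)) (by simp)).1
    h2.hasDerivWithinAt
  filter_upwards [h3.eventually (gt_mem_nhds hv), self_mem_nhdsWithin] with t ht ht0
  simp only [slope, vsub_eq_sub, sub_zero, zero_smul, add_zero, hx, smul_eq_mul] at ht
  have : (0 : ℝ) < t := ht0
  change Ω.ψ _ < 0
  by_contra hcon
  have := mul_nonneg (inv_nonneg.2 this.le) (not_lt.1 hcon)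
  linarith

theorem Body.closed_eq (Ω : Body) : Ω.closed = {x | Ω.ψ x ≤ 0} := by
  apply Subset.antisymm
  · exact closure_minimal (fun x (hx : Ω.ψ x < 0) => le_of_lt hx) (isClosed_le Ω.smooth.continuous continuous_const)
  · intro x hx
    rcases lt_or_eq_of_le (show Ω.ψ x ≤ 0 from hx) with h | h
    · exact subset_closure h
    · have hg := Ω.regular x h
      have h1 := Ω.smul_mem_region (v := -gradient Ω.ψ x) h (by
        rw [inner_neg_right, neg_lt_zero]
        exact real_inner_self_pos.2 hg)
      refine mem_closure_of_tendsto (f := fun t : ℝ => x + t • (-gradient Ω.ψ x))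
        (b := 𝓝[>] (0 : ℝ)) ?_ h1
      have : Tendsto (fun t : ℝ => x + t • (-gradient Ω.ψ x)) (𝓝 0)
          (𝓝 (x + (0 : ℝ) • (-gradient Ω.ψ x))) := by
        apply Continuous.tendsto; fun_prop
      simp only [zero_smul, add_zero] at this
      exact this.mono_left nhdsWithin_le_nhds

theorem Body.bdry_eq (Ω : Body) : Ω.bdry = {x | Ω.ψ x = 0} := by
  unfold Body.bdry
  rw [Ω.region_isOpen.frontier_eq]
  change Ω.closed \ _ = _
  rw [Ω.closed_eq]
  ext x
  change Ω.ψ x ≤ 0 ∧ ¬ Ω.ψ x < 0 ↔ Ω.ψ x = 0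
  rw [not_lt]
  exact ⟨fun h => le_antisymm h.1 h.2, fun h => ⟨h.le, h.ge⟩⟩

theorem Body.region_subset_closed (Ω : Body) : Ω.region ⊆ Ω.closed := subset_closure

theorem Body.bdry_subset_closed (Ω : Body) : Ω.bdry ⊆ Ω.closed := frontier_subset_closure

theorem Body.isCompact_closed (Ω : Body) : IsCompact Ω.closed :=
  Ω.bounded.isCompact_closure

theorem Body.isCompact_bdry (Ω : Body) : IsCompact Ω.bdry :=
  Ω.isCompact_closed.of_isClosed_subset isClosed_frontier Ω.bdry_subset_closed

theorem Body.closed_mem_nhds (Ω : Body) {x : E3} (hx : x ∈ Ω.region) : Ω.closed ∈ 𝓝 x :=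
  mem_of_superset (Ω.region_isOpen.mem_nhds hx) Ω.region_subset_closed

/-- At a boundary point the tangent cone contains every direction with `∇ψ · v < 0`, and this open
half-space spans the whole space. Derivatives within the closed region are therefore well determined
up to the boundary. -/
theorem Body.uniqueDiffOn_closed (Ω : Body) : UniqueDiffOn ℝ Ω.closed := by
  intro x hx
  rw [Ω.closed_eq] at hx
  rcases lt_or_eq_of_le (show Ω.ψ x ≤ 0 from hx) with h | h
  · exact uniqueDiffWithinAt_of_mem_nhds (Ω.closed_mem_nhds h)
  · have hsub : ∀ v, inner ℝ (gradient Ω.ψ x) v < 0 → v ∈ tangentConeAt ℝ Ω.closed x := by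
      intro v hv
      refine mem_tangentConeAt_of_add_smul_mem (l := 𝓝[>] (0 : ℝ)) (c := id) ?_ ?_
      · exact tendsto_id.mono_left (nhdsWithin_mono _ fun t ht => ne_of_gt ht)
      · filter_upwards [Ω.smul_mem_region h hv] with t ht
        exact Ω.region_subset_closed ht
    refine ⟨?_, subset_closure (by rw [Ω.closed_eq]; exact hx)⟩
    have hg := Ω.regular x h
    have hgg : 0 < inner ℝ (gradient Ω.ψ x) (gradient Ω.ψ x) := real_inner_self_pos.2 hg
    have htop : Submodule.span ℝ (tangentConeAt ℝ Ω.closed x) = ⊤ := by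
      rw [eq_top_iff]
      rintro v -
      set g := gradient Ω.ψ x
      -- The constant is so large that both `v - c • g` and `-(c • g)` point strictly inward; `v` is
      -- their difference.
      set c : ℝ := (|inner ℝ g v| + 1) / inner ℝ g g
      have hc : c * inner ℝ g g = |inner ℝ g v| + 1 := div_mul_cancel₀ _ hgg.ne'
      have e1 : v - c • g ∈ tangentConeAt ℝ Ω.closed x := by
        apply hsub
        rw [inner_sub_right, inner_smul_right, hc]
        have := le_abs_self (inner ℝ g v)
        linarith
      have e2 : -(c • g) ∈ tangentConeAt ℝ Ω.closed x := by
        apply hsub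
        rw [inner_neg_right, inner_smul_right, hc]
        have := abs_nonneg (inner ℝ g v)
        linarith
      have : v = (v - c • g) - (-(c • g)) := by abel
      rw [this]
      exact Submodule.sub_mem _ (Submodule.subset_span e1) (Submodule.subset_span e2)
    rw [htop]
    simp

/-! ### The unit normal -/

/-- The outward unit normal as a vector. -/
def Body.nvec (Ω : Body) (x : E3) : E3 := ‖gradient Ω.ψ x‖⁻¹ • gradient Ω.ψ x

theorem Body.gradient_ne (Ω : Body) {x : E3} (hx : x ∈ Ω.bdry) : gradient Ω.ψ x ≠ 0 :=
  Ω.regular x (by rw [Ω.bdry_eq] at hx; exact hx)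

theorem Body.contDiff_gradient (Ω : Body) : ContDiff ℝ ∞ (gradient Ω.ψ) := by
  unfold gradient
  exact (InnerProductSpace.toDual ℝ E3).symm.contDiff.comp (Ω.smooth.fderiv_right (by simp))

theorem Body.contDiffAt_nvec (Ω : Body) {x : E3} (hx : gradient Ω.ψ x ≠ 0) :
    ContDiffAt ℝ ∞ Ω.nvec x := by
  have h := Ω.contDiff_gradient.contDiffAt (x := x)
  exact ((h.norm ℝ hx).inv (by simpa using hx)).smul h

theorem Body.norm_nvec (Ω : Body) {x : E3} (hx : gradient Ω.ψ x ≠ 0) : ‖Ω.nvec x‖ = 1 := by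
  unfold Body.nvec
  rw [norm_smul, norm_inv, norm_norm]
  exact inv_mul_cancel₀ (by simpa using hx)

/-- A smooth vector field on the whole space that coincides with the unit normal near the
boundary. -/
theorem Body.exists_smooth_normal (Ω : Body) : ∃ N : Fin 3 → E3 → ℝ,
    (∀ i, ContDiff ℝ ∞ (N i)) ∧ ∀ x ∈ Ω.bdry, ∀ i, N i =ᶠ[𝓝 x] Ω.normal i := by
  -- The normal is multiplied by a cut-off that equals one near the boundary. The closure of `U` has
  -- to avoid the zeros of `∇ψ`, since the cut-off vanishes only off that closure.
  obtain ⟨U, hU, hbU, hUc⟩ := normal_exists_closure_subset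
    (isClosed_frontier : IsClosed Ω.bdry)
    (isOpen_ne_fun Ω.contDiff_gradient.continuous continuous_const)
    (fun x hx => Ω.gradient_ne hx)
  obtain ⟨χ, h1, h0, -⟩ := exists_contMDiffMap_one_nhds_of_subset_interior (n := (⊤ : ℕ∞))
    (modelWithCornersSelf ℝ E3) (s := Ω.bdry) (t := closure U) isClosed_frontier
    (hbU.trans (interior_maximal subset_closure hU))
  have hχ : ContDiff ℝ ∞ χ := χ.contMDiff.contDiff
  refine ⟨fun i x => χ x * Ω.normal i x, fun i => contDiff_iff_contDiffAt.2 fun x => ?_,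
    fun x hx i => ?_⟩
  · by_cases hx : gradient Ω.ψ x = 0
    · have : (fun y => χ y * Ω.normal i y) =ᶠ[𝓝 x] fun _ => 0 := by
        have hm : (closure U)ᶜ ∈ 𝓝 x := isClosed_closure.isOpen_compl.mem_nhds fun h => hUc h hx
        filter_upwards [hm] with y hy
        rw [h0 y hy, zero_mul]
      exact contDiffAt_const.congr_of_eventuallyEq this
    · refine hχ.contDiffAt.mul ?_
      exact (contDiffAt_piLp_apply (𝕜 := ℝ) (p := 2) (i := i)).comp x (Ω.contDiffAt_nvec hx)
  · filter_upwards [(eventually_nhdsSet_iff_forall.1 h1) x hx] with y hy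
    rw [hy, one_mul]

/-! ### The area of a graph -/

/-- The Euclidean plane. -/
abbrev E2 : Type := EuclideanSpace ℝ (Fin 2)

/-- Second countability reduces a local comparison to countably many neighbourhoods. Made disjoint,
they give the comparison with constant `K ^ n` for all measurable sets, and `K` then decreases to
one. -/
theorem measure_le_of_forall_nhds {X : Type*} [TopologicalSpace X] [SecondCountableTopology X]
    [MeasurableSpace X] [OpensMeasurableSpace X] {m₁ m₂ : Measure X} {n : ℕ}
    (h : ∀ K : ℝ≥0, 1 < K → ∀ x, ∃ U ∈ 𝓝 x, ∀ s, MeasurableSet s → s ⊆ U →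
      m₁ s ≤ (K : ℝ≥0∞) ^ n * m₂ s) : m₁ ≤ m₂ := by
  have key : ∀ K : ℝ≥0, 1 < K → ∀ s, MeasurableSet s → m₁ s ≤ (K : ℝ≥0∞) ^ n * m₂ s := by
    intro K hK s hs
    choose U hU hb using h K hK
    obtain ⟨t, htc, ht⟩ := TopologicalSpace.countable_cover_nhds
      (f := fun x => interior (U x)) (fun x => interior_mem_nhds.2 (hU x))
    rcases t.eq_empty_or_nonempty with h0 | hne
    · have : s = ∅ := by
        apply eq_empty_of_subset_empty
        rw [h0] at ht
        simp only [mem_empty_iff_false, iUnion_of_empty, iUnion_empty] at ht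
        rw [ht]
        exact subset_univ s
      simp [this]
    · obtain ⟨f, hf⟩ := htc.exists_eq_range hne
      have hcov : (⋃ k, interior (U (f k))) = univ := by
        rw [← ht, hf, biUnion_range]
      set D := disjointed fun k => interior (U (f k)) with hD
      have hDm : ∀ k, MeasurableSet (D k) :=
        fun k => MeasurableSet.disjointed (fun k => isOpen_interior.measurableSet) k
      have hDd : Pairwise (Function.onFun Disjoint fun k => s ∩ D k) := fun i j hij =>
        (disjoint_disjointed _ hij).mono inter_subset_right inter_subset_right
      have hsU : s = ⋃ k, s ∩ D k := by
        rw [← inter_iUnion, hD, iUnion_disjointed, hcov, inter_univ]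
      rw [hsU, measure_iUnion hDd (fun k => hs.inter (hDm k)),
        measure_iUnion hDd (fun k => hs.inter (hDm k)), ← ENNReal.tsum_mul_left]
      refine ENNReal.tsum_le_tsum fun k => hb (f k) _ (hs.inter (hDm k)) ?_
      exact inter_subset_right.trans ((disjointed_subset _ k).trans interior_subset)
  refine Measure.le_iff.2 fun s hs => ?_
  have hlim : Tendsto (fun K : ℝ≥0 => (K : ℝ≥0∞) ^ n * m₂ s) (𝓝[>] 1) (𝓝 (1 * m₂ s)) := by
    refine ENNReal.Tendsto.mul_const ?_ (Or.inl one_ne_zero)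
    have : Tendsto (fun K : ℝ≥0 => ((K ^ n : ℝ≥0) : ℝ≥0∞)) (𝓝 1) (𝓝 ((1 ^ n : ℝ≥0) : ℝ≥0∞)) :=
      ENNReal.tendsto_coe.2 ((continuous_pow n).tendsto 1)
    simpa using this.mono_left nhdsWithin_le_nhds
  rw [one_mul] at hlim
  refine ge_of_tendsto hlim ?_
  filter_upwards [self_mem_nhdsWithin] with K hK using key K hK s hs

/-- On `s` the map `f` factors through `g`, because points with equal `g` have equal `f`. The factor
is `K`-Lipschitz and so enlarges `d`-dimensional measure by at most `K ^ d`. This form compares a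
graph with its tangent plane through their common parameter. -/
theorem euclideanHausdorffMeasure_image_le_of_dist_le {α X Y : Type*}
    [MetricSpace X] [MeasurableSpace X] [BorelSpace X]
    [MetricSpace Y] [MeasurableSpace Y] [BorelSpace Y] {f : α → X} {g : α → Y} {s : Set α}
    {K : ℝ≥0} {d : ℕ}
    (h : ∀ x ∈ s, ∀ y ∈ s, dist (f x) (f y) ≤ K * dist (g x) (g y)) :
    (μHE[d] : Measure X) (f '' s) ≤ (K : ℝ≥0∞) ^ d * (μHE[d] : Measure Y) (g '' s) := by
  rcases s.eq_empty_or_nonempty with rfl | ⟨x₀, hx₀⟩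
  · simp
  have : Nonempty α := ⟨x₀⟩
  set F : Y → X := fun z => f (Function.invFunOn g s z)
  have hF : ∀ x ∈ s, F (g x) = f x := by
    intro x hx
    have hm : g x ∈ g '' s := mem_image_of_mem g hx
    have h1 := Function.invFunOn_mem hm
    have h2 := Function.invFunOn_eq hm
    have := h _ h1 _ hx
    rw [h2, dist_self, mul_zero] at this
    exact dist_le_zero.1 this
  have hL : LipschitzOnWith K F (g '' s) := by
    refine LipschitzOnWith.of_dist_le_mul ?_
    rintro _ ⟨x, hx, rfl⟩ _ ⟨y, hy, rfl⟩
    rw [hF x hx, hF y hy]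
    exact h x hx y hy
  have himg : F '' (g '' s) = f '' s := by
    rw [image_image]
    exact image_congr hF
  have := hL.hausdorffMeasure_image_le (d := d) (by positivity)
  rw [himg, ENNReal.rpow_natCast] at this
  simp only [Measure.euclideanHausdorffMeasure_def, Measure.smul_apply, ENNReal.smul_def, smul_eq_mul]
  calc _ ≤ _ := mul_le_mul_right this _
    _ = _ := by ring

/-- The area density of the graph of a function with gradient `a`. -/
def areaDensity (a : E2) : ℝ := √(1 + ‖a‖ ^ 2)

theorem areaDensity_pos (a : E2) : 0 < areaDensity a := Real.sqrt_pos.2 (by positivity)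

theorem areaDensity_sq (a : E2) : areaDensity a ^ 2 = 1 + ‖a‖ ^ 2 := Real.sq_sqrt (by positivity)

theorem continuous_areaDensity : Continuous areaDensity := by unfold areaDensity; fun_prop

/-- A linear self-map of the plane that stretches the plane as much as the linear graph with
gradient `a` does. -/
def stretch (a : E2) : E2 →L[ℝ] E2 :=
  ContinuousLinearMap.id ℝ E2 + (1 / (1 + areaDensity a)) • (innerSL ℝ a).smulRight a

theorem stretch_apply (a y : E2) :
    stretch a y = y + (1 / (1 + areaDensity a) * inner ℝ a y) • a := by
  simp [stretch, smul_smul]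

/-- The map is the positive square root of `I + a ⊗ a`, the first fundamental form of the linear
graph. The coefficient `k = 1 / (1 + J)` with `J ^ 2 = 1 + ‖a‖ ^ 2` is what solves `2 k + k ^ 2 ‖a‖
^ 2 = 1`. -/
theorem norm_stretch_sq (a y : E2) : ‖stretch a y‖ ^ 2 = ‖y‖ ^ 2 + inner ℝ a y ^ 2 := by
  have h := areaDensity_sq a
  have hp := areaDensity_pos a
  rw [stretch_apply, norm_add_sq_real, inner_smul_right, norm_smul, mul_pow, Real.norm_eq_abs,
    sq_abs, real_inner_comm]
  have : ‖a‖ ^ 2 = areaDensity a ^ 2 - 1 := by linarith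
  rw [this]
  field_simp
  ring

theorem det_stretch (a : E2) : (stretch a).det = areaDensity a := by
  have h := areaDensity_sq a
  have hp := areaDensity_pos a
  have e : (stretch a).det = LinearMap.det (stretch a : E2 →ₗ[ℝ] E2) := rfl
  rw [e, ← LinearMap.det_toMatrix (EuclideanSpace.basisFun (Fin 2) ℝ).toBasis, Matrix.det_fin_two]
  simp only [LinearMap.toMatrix_apply, OrthonormalBasis.coe_toBasis, EuclideanSpace.basisFun_apply,
    OrthonormalBasis.coe_toBasis_repr_apply, EuclideanSpace.basisFun_repr,
    ContinuousLinearMap.coe_coe, stretch_apply]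
  rw [EuclideanSpace.real_norm_sq_eq, Fin.sum_univ_two] at h
  simp [EuclideanSpace.inner_single_right]
  field_simp
  nlinarith

/-- The graph of `h` over the plane through `p` parametrized by `ι`, in the direction `ν`. -/
def graphMap (p : E3) (ι : E2 →ₗᵢ[ℝ] E3) (ν : E3) (h : E2 → ℝ) (y : E2) : E3 :=
  p + ι y + h y • ν

theorem norm_frame_sq {ι : E2 →ₗᵢ[ℝ] E3} {ν : E3} (hν : ‖ν‖ = 1)
    (hι : ∀ y, inner ℝ (ι y) ν = 0) (y : E2) (s : ℝ) : ‖ι y + s • ν‖ ^ 2 = ‖y‖ ^ 2 + s ^ 2 := by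
  rw [norm_add_sq_real, inner_smul_right, hι, norm_smul, hν, ι.norm_map, Real.norm_eq_abs, mul_one,
    sq_abs]
  ring

/-- The data of an orthonormal frame: an isometric copy of the plane and its unit normal. -/
structure IsFrame (ι : E2 →ₗᵢ[ℝ] E3) (ν : E3) : Prop where
  norm_eq : ‖ν‖ = 1
  orthogonal : ∀ y, inner ℝ (ι y) ν = 0

theorem IsFrame.norm_sq {ι : E2 →ₗᵢ[ℝ] E3} {ν : E3} (hf : IsFrame ι ν) (y : E2) (s : ℝ) :
    ‖ι y + s • ν‖ ^ 2 = ‖y‖ ^ 2 + s ^ 2 := norm_frame_sq hf.norm_eq hf.orthogonal y s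

theorem graphMap_sub (p : E3) (ι : E2 →ₗᵢ[ℝ] E3) (ν : E3) (h : E2 → ℝ) (y z : E2) :
    graphMap p ι ν h y - graphMap p ι ν h z = ι (y - z) + (h y - h z) • ν := by
  simp only [graphMap, map_sub, sub_smul]
  abel

theorem dist_le_dist_graphMap {p : E3} {ι : E2 →ₗᵢ[ℝ] E3} {ν : E3} (hf : IsFrame ι ν) (h : E2 → ℝ)
    (y z : E2) : dist y z ≤ dist (graphMap p ι ν h y) (graphMap p ι ν h z) := by
  rw [dist_eq_norm, dist_eq_norm, graphMap_sub]
  refine le_of_sq_le_sq ?_ (norm_nonneg _)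
  rw [hf.norm_sq]
  nlinarith [sq_nonneg (h y - h z)]

theorem norm_stretch_eq {ι : E2 →ₗᵢ[ℝ] E3} {ν : E3} (hf : IsFrame ι ν) (a y : E2) :
    ‖stretch a y‖ = ‖ι y + (inner ℝ a y : ℝ) • ν‖ := by
  rw [← sq_eq_sq₀ (norm_nonneg _) (norm_nonneg _), norm_stretch_sq, hf.norm_sq]

/-- The stretched plane is isometric to the tangent plane. The chords of the graph and of the
tangent plane differ only along the unit vector `ν`, by the linearization error of `h`. -/
theorem dist_graphMap_le {p : E3} {ι : E2 →ₗᵢ[ℝ] E3} {ν : E3} (hf : IsFrame ι ν) {h : E2 → ℝ}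
    {a y z : E2} {δ : ℝ} (hδ : |h y - h z - inner ℝ a (y - z)| ≤ δ * ‖y - z‖) :
    |dist (graphMap p ι ν h y) (graphMap p ι ν h z) - dist (stretch a y) (stretch a z)|
      ≤ δ * dist y z := by
  rw [dist_eq_norm, dist_eq_norm, graphMap_sub, ← map_sub, norm_stretch_eq hf, dist_eq_norm]
  refine (abs_norm_sub_norm_le _ _).trans ?_
  rw [add_sub_add_left_eq_sub, ← sub_smul, norm_smul, hf.norm_eq, mul_one]
  exact hδ

theorem dist_le_dist_stretch (a y z : E2) : dist y z ≤ dist (stretch a y) (stretch a z) := by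
  rw [dist_eq_norm, dist_eq_norm, ← map_sub]
  refine le_of_sq_le_sq ?_ (norm_nonneg _)
  rw [norm_stretch_sq]
  nlinarith [sq_nonneg (inner ℝ a (y - z) : ℝ)]

theorem continuous_graphMap (p : E3) (ι : E2 →ₗᵢ[ℝ] E3) (ν : E3) {h : E2 → ℝ}
    (hh : Continuous h) : Continuous (graphMap p ι ν h) := by
  unfold graphMap
  fun_prop

theorem measurableEmbedding_graphMap {p : E3} {ι : E2 →ₗᵢ[ℝ] E3} {ν : E3} (hf : IsFrame ι ν)
    {h : E2 → ℝ} (hh : Continuous h) : MeasurableEmbedding (graphMap p ι ν h) :=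
  (continuous_graphMap p ι ν hh).measurableEmbedding fun y z hyz => by
    have := dist_le_dist_graphMap (p := p) hf h y z
    rw [hyz, dist_self] at this
    exact dist_le_zero.1 this

theorem volume_stretch_image (a : E2) (s : Set E2) :
    (μHE[2] : Measure E2) (stretch a '' s) = ENNReal.ofReal (areaDensity a) * volume s := by
  rw [EuclideanSpace.euclideanHausdorffMeasure_eq_volume 2,
    Measure.addHaar_image_continuousLinearMap]
  change ENNReal.ofReal |(stretch a).det| * _ = _
  rw [det_stretch, abs_of_pos (areaDensity_pos a)]

/-- Near each point the graph and its tangent plane are almost isometric. -/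
theorem exists_nhds_graphMap {p : E3} {ι : E2 →ₗᵢ[ℝ] E3} {ν : E3} (hf : IsFrame ι ν) {h : E2 → ℝ}
    (hh : ContDiff ℝ 1 h) {K : ℝ≥0} (hK : 1 < K) (y₀ : E2) : ∃ U ∈ 𝓝 y₀,
      (∀ y ∈ U, areaDensity (gradient h y) ≤ K * areaDensity (gradient h y₀) ∧
        areaDensity (gradient h y₀) ≤ K * areaDensity (gradient h y)) ∧
      (∀ s ⊆ U, (μHE[2] : Measure E3) (graphMap p ι ν h '' s)
        ≤ (K : ℝ≥0∞) ^ 2 * (ENNReal.ofReal (areaDensity (gradient h y₀)) * volume s)) ∧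
      (∀ s ⊆ U, ENNReal.ofReal (areaDensity (gradient h y₀)) * volume s
        ≤ (K : ℝ≥0∞) ^ 2 * (μHE[2] : Measure E3) (graphMap p ι ν h '' s)) := by
  have hK' : (1 : ℝ) < K := by exact_mod_cast hK
  set a := gradient h y₀ with ha
  have hstrict : HasStrictFDerivAt h (innerSL ℝ a) y₀ := by
    have h1 := hh.contDiffAt.hasStrictFDerivAt (x := y₀) one_ne_zero
    have h2 := ((hh.differentiable one_ne_zero) y₀).hasGradientAt.hasFDerivAt
    have : fderiv ℝ h y₀ = innerSL ℝ a := h2.fderiv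
    rwa [this] at h1
  -- Strict differentiability controls the linearization error for both points variable. The
  -- tolerance `K - 1` is enough because the graph distance and the stretched distance both dominate
  -- `dist y z`, so each is at most `K` times the other.
  have hlin := hstrict.isLittleO.def (c := (K : ℝ) - 1) (by linarith)
  obtain ⟨U₁, hU₁, V₁, hV₁, hUV⟩ := mem_nhds_prod_iff.1 hlin
  have hgc : Continuous fun y => areaDensity (gradient h y) := by
    refine continuous_areaDensity.comp ?_
    exact (InnerProductSpace.toDual ℝ E2).symm.continuous.comp (hh.continuous_fderiv one_ne_zero)
  have hpos := areaDensity_pos a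
  have hlt1 : areaDensity (gradient h y₀) < K * areaDensity (gradient h y₀) := by
    rw [← ha]; nlinarith
  have hA : ∀ᶠ y in 𝓝 y₀, areaDensity (gradient h y) < K * areaDensity a :=
    hgc.continuousAt.eventually_lt continuousAt_const hlt1
  have hB : ∀ᶠ y in 𝓝 y₀, areaDensity a < K * areaDensity (gradient h y) :=
    continuousAt_const.eventually_lt (continuous_const.mul hgc).continuousAt hlt1
  refine ⟨U₁ ∩ V₁ ∩ {y | areaDensity (gradient h y) < K * areaDensity a ∧
    areaDensity a < K * areaDensity (gradient h y)}, inter_mem (inter_mem hU₁ hV₁) (hA.and hB),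
    fun y hy => ⟨hy.2.1.le, hy.2.2.le⟩, fun s hs => ?_, fun s hs => ?_⟩
  all_goals
    have hdist : ∀ y ∈ s, ∀ z ∈ s, |h y - h z - inner ℝ a (y - z)| ≤ (K - 1) * ‖y - z‖ := by
      intro y hy z hz
      have : (y, z) ∈ U₁ ×ˢ V₁ := ⟨(hs hy).1.1, (hs hz).1.2⟩
      exact hUV this
    rw [← volume_stretch_image]
    refine euclideanHausdorffMeasure_image_le_of_dist_le fun y hy z hz => ?_
    have h1 := abs_le.1 (dist_graphMap_le (p := p) hf (hdist y hy z hz))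
    have h2 := dist_le_dist_stretch a y z
    have h3 := dist_le_dist_graphMap (p := p) hf h y z
    nlinarith

/-- Locally, replacing the graph by its tangent plane costs a factor `K ^ 2` in area, and replacing
the density by its value at one point costs another `K`. This explains the exponent three in both
inequalities. -/
theorem comap_graphMap {p : E3} {ι : E2 →ₗᵢ[ℝ] E3} {ν : E3} (hf : IsFrame ι ν) {h : E2 → ℝ}
    (hh : ContDiff ℝ 1 h) : Measure.comap (graphMap p ι ν h) (μHE[2] : Measure E3)
      = volume.withDensity fun y => ENNReal.ofReal (areaDensity (gradient h y)) := by
  have hemb := measurableEmbedding_graphMap (p := p) hf hh.continuous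
  apply le_antisymm
  · refine measure_le_of_forall_nhds (n := 3) fun K hK y₀ => ?_
    obtain ⟨U, hU, hd, h1, -⟩ := exists_nhds_graphMap (p := p) hf hh hK y₀
    refine ⟨U, hU, fun s hs hsU => ?_⟩
    rw [hemb.comap_apply, withDensity_apply _ hs]
    refine (h1 s hsU).trans ?_
    rw [pow_succ _ 2, mul_assoc]
    refine mul_le_mul_right ?_ _
    rw [← setLIntegral_const, ← lintegral_const_mul' _ _ ENNReal.coe_ne_top]
    refine setLIntegral_mono' hs fun y hy => ?_
    rw [← ENNReal.ofReal_coe_nnreal, ← ENNReal.ofReal_mul K.coe_nonneg]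
    exact ENNReal.ofReal_le_ofReal (hd y (hsU hy)).2
  · refine measure_le_of_forall_nhds (n := 3) fun K hK y₀ => ?_
    obtain ⟨U, hU, hd, -, h2⟩ := exists_nhds_graphMap (p := p) hf hh hK y₀
    refine ⟨U, hU, fun s hs hsU => ?_⟩
    rw [hemb.comap_apply, withDensity_apply _ hs]
    calc _ ≤ ∫⁻ y in s, (K : ℝ≥0∞) * ENNReal.ofReal (areaDensity (gradient h y₀)) := by
          refine setLIntegral_mono' hs fun y hy => ?_
          rw [← ENNReal.ofReal_coe_nnreal, ← ENNReal.ofReal_mul K.coe_nonneg]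
          exact ENNReal.ofReal_le_ofReal (hd y (hsU hy)).1
      _ = K * (ENNReal.ofReal (areaDensity (gradient h y₀)) * volume s) := by
          rw [setLIntegral_const, mul_assoc]
      _ ≤ K * ((K : ℝ≥0∞) ^ 2 * (μHE[2] : Measure E3) (graphMap p ι ν h '' s)) := by
          exact mul_le_mul_right (h2 s hsU) _
      _ = _ := by ring

/-- **Area formula for graphs**. -/
theorem setIntegral_graphMap {p : E3} {ι : E2 →ₗᵢ[ℝ] E3} {ν : E3} (hf : IsFrame ι ν) {h : E2 → ℝ}
    (hh : ContDiff ℝ 1 h) (F : E3 → ℝ) (s : Set E2) (hs : MeasurableSet s) :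
    ∫ x in graphMap p ι ν h '' s, F x ∂μHE[2]
      = ∫ y in s, areaDensity (gradient h y) * F (graphMap p ι ν h y) := by
  have hemb := measurableEmbedding_graphMap (p := p) hf hh.continuous
  have hgc : Continuous fun y => areaDensity (gradient h y) := by
    refine continuous_areaDensity.comp ?_
    exact (InnerProductSpace.toDual ℝ E2).symm.continuous.comp (hh.continuous_fderiv one_ne_zero)
  have hr : (μHE[2] : Measure E3).restrict (graphMap p ι ν h '' s)
      = ((Measure.comap (graphMap p ι ν h) (μHE[2] : Measure E3)).restrict s).map
        (graphMap p ι ν h) := by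
    rw [hemb.restrict_comap, hemb.map_comap, Measure.restrict_restrict hemb.measurableSet_range,
      inter_eq_self_of_subset_right (image_subset_range _ _)]
  rw [hr, hemb.integral_map, comap_graphMap hf hh]
  rw [restrict_withDensity hs]
  rw [integral_withDensity_eq_integral_toReal_smul]
  · refine integral_congr_ae (Eventually.of_forall fun y => ?_)
    simp only [smul_eq_mul]
    rw [ENNReal.toReal_ofReal (areaDensity_pos _).le]
  · exact hgc.measurable.ennreal_ofReal
  · exact Eventually.of_forall fun y => ENNReal.ofReal_lt_top

theorem measure_graphMap_lt_top {p : E3} {ι : E2 →ₗᵢ[ℝ] E3} {ν : E3} (hf : IsFrame ι ν)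
    {h : E2 → ℝ} (hh : ContDiff ℝ 1 h) {s : Set E2} (hs : IsCompact s) :
    (μHE[2] : Measure E3) (graphMap p ι ν h '' s) < ⊤ := by
  have hgc : Continuous fun y => areaDensity (gradient h y) := by
    refine continuous_areaDensity.comp ?_
    exact (InnerProductSpace.toDual ℝ E2).symm.continuous.comp (hh.continuous_fderiv one_ne_zero)
  rw [← (measurableEmbedding_graphMap hf hh.continuous).comap_apply, comap_graphMap hf hh,
    withDensity_apply _ hs.measurableSet]
  obtain ⟨C, hC⟩ := hs.bddAbove_image hgc.continuousOn
  refine (setLIntegral_mono' (g := fun _ => ENNReal.ofReal C) hs.measurableSet fun y hy =>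
    ENNReal.ofReal_le_ofReal (hC (mem_image_of_mem _ hy))).trans_lt ?_
  rw [setLIntegral_const]
  exact ENNReal.mul_lt_top ENNReal.ofReal_lt_top hs.measure_lt_top

/-! ### Frames and local graphs -/

theorem exists_frame {ν : E3} (hν : ‖ν‖ = 1) : ∃ ι : E2 →ₗᵢ[ℝ] E3, IsFrame ι ν := by
  have : Fact (Module.finrank ℝ E3 = 2 + 1) := ⟨by simp⟩
  have h0 : ν ≠ 0 := fun h => by simp [h] at hν
  let b := OrthonormalBasis.fromOrthogonalSpanSingleton (𝕜 := ℝ) 2 h0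
  refine ⟨(Submodule.subtypeₗᵢ _).comp b.repr.symm.toLinearIsometry, hν, fun y => ?_⟩
  exact Submodule.mem_orthogonal_singleton_iff_inner_left.1 (b.repr.symm y).2

/-- The affine chart of space given by a point and a frame. -/
def frameMap (p : E3) (ι : E2 →ₗᵢ[ℝ] E3) (ν : E3) (z : E2 × ℝ) : E3 := p + ι z.1 + z.2 • ν

/-- The isometry of space given by a frame. -/
def IsFrame.equiv {ι : E2 →ₗᵢ[ℝ] E3} {ν : E3} (hf : IsFrame ι ν) :
    WithLp 2 (E2 × ℝ) ≃ₗᵢ[ℝ] E3 :=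
  LinearIsometry.toLinearIsometryEquiv
    { toFun := fun z => ι z.fst + z.snd • ν
      map_add' := fun x y => by simp only [WithLp.add_fst, WithLp.add_snd, map_add, add_smul]; abel
      map_smul' := fun c x => by simp [smul_smul]
      norm_map' := fun x => by
        rw [← sq_eq_sq₀ (norm_nonneg _) (norm_nonneg _), WithLp.prod_norm_sq_eq_of_L2]
        simp only [LinearMap.coe_mk, AddHom.coe_mk]
        rw [hf.norm_sq, Real.norm_eq_abs, sq_abs] }
    (by
      rw [(WithLp.linearEquiv 2 ℝ (E2 × ℝ)).finrank_eq, Module.finrank_prod]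
      simp)

theorem IsFrame.equiv_apply {ι : E2 →ₗᵢ[ℝ] E3} {ν : E3} (hf : IsFrame ι ν)
    (z : WithLp 2 (E2 × ℝ)) : hf.equiv z = ι z.fst + z.snd • ν := rfl

theorem IsFrame.exists_eq {ι : E2 →ₗᵢ[ℝ] E3} {ν : E3} (hf : IsFrame ι ν) (v : E3) :
    ∃ w : E2, ∃ c : ℝ, v = ι w + c • ν := by
  refine ⟨(hf.equiv.symm v).fst, (hf.equiv.symm v).snd, ?_⟩
  rw [← hf.equiv_apply, LinearIsometryEquiv.apply_symm_apply]

theorem continuous_frameMap (p : E3) (ι : E2 →ₗᵢ[ℝ] E3) (ν : E3) :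
    Continuous (frameMap p ι ν) := by
  unfold frameMap
  fun_prop

theorem IsFrame.isOpenMap_frameMap {ι : E2 →ₗᵢ[ℝ] E3} {ν : E3} (hf : IsFrame ι ν) (p : E3) :
    IsOpenMap (frameMap p ι ν) := by
  have e : frameMap p ι ν = (fun x => p + x) ∘ hf.equiv ∘ WithLp.toLp 2 := by
    ext z : 1
    simp [frameMap, hf.equiv_apply, add_assoc]
  rw [e]
  exact (isOpenMap_add_left p).comp
    (hf.equiv.toHomeomorph.isOpenMap.comp (WithLp.homeomorphProd 2 E2 ℝ).symm.isOpenMap)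

theorem IsFrame.measurePreserving_frameMap {ι : E2 →ₗᵢ[ℝ] E3} {ν : E3} (hf : IsFrame ι ν)
    (p : E3) : MeasurePreserving (frameMap p ι ν) := by
  have e : frameMap p ι ν = (fun x => p + x) ∘ hf.equiv ∘ WithLp.toLp 2 := by
    ext z : 1
    simp [frameMap, hf.equiv_apply, add_assoc]
  rw [e]
  exact (measurePreserving_add_left volume p).comp
    (hf.equiv.measurePreserving.comp (WithLp.volume_preserving_toLp E2 ℝ))

theorem IsFrame.norm_frameMap_sub_sq {ι : E2 →ₗᵢ[ℝ] E3} {ν : E3} (hf : IsFrame ι ν) (p : E3)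
    (y : E2) (s : ℝ) : ‖frameMap p ι ν (y, s) - p‖ ^ 2 = ‖y‖ ^ 2 + s ^ 2 := by
  rw [← hf.norm_sq]
  congr 2
  simp only [frameMap]
  abel

/-- A bump function supported where `h` is `C¹` extends the germ. The implicit function is regular
only near one point, while the area formula for graphs asks for a globally `C¹` function. -/
theorem exists_contDiff_eqOn_ball {h : E2 → ℝ} (hh : ContDiffAt ℝ 1 h 0) :
    ∃ g : E2 → ℝ, ContDiff ℝ 1 g ∧ g =ᶠ[𝓝 0] h := by
  obtain ⟨R, hR, hball⟩ := Metric.eventually_nhds_iff_ball.1 (hh.eventually (by simp))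
  obtain ⟨χ, hχ⟩ : ∃ χ : ContDiffBump (0 : E2), χ.rOut < R :=
    ⟨⟨R / 4, R / 2, by linarith, by linarith⟩, by change R / 2 < R; linarith⟩
  refine ⟨fun y => χ y * h y, contDiff_iff_contDiffAt.2 fun y => ?_, ?_⟩
  · by_cases hy : y ∈ Metric.ball (0 : E2) R
    · exact χ.contDiff.contDiffAt.mul (hball y hy)
    · have hy' : y ∉ tsupport χ := by
        rw [χ.tsupport_eq, Metric.mem_closedBall]
        rw [Metric.mem_ball, not_lt] at hy
        linarith [hχ]
      have : (fun y => χ y * h y) =ᶠ[𝓝 y] fun _ => 0 := by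
        filter_upwards [notMem_tsupport_iff_eventuallyEq.1 hy'] with z hz
        rw [hz, Pi.zero_apply, zero_mul]
      exact contDiffAt_const.congr_of_eventuallyEq this
  · filter_upwards [χ.eventuallyEq_one] with y hy
    rw [hy, Pi.one_apply, one_mul]

/-- Along the normal at `p` the derivative of `ψ` is positive near `p`. The implicit function
theorem gives the height of the zero, and strict monotonicity of `ψ` along each vertical segment of
the box makes it the only zero there, with the region below it. -/
theorem Body.exists_local_graph (Ω : Body) {p : E3} (hp : p ∈ Ω.bdry) (ι : E2 →ₗᵢ[ℝ] E3) :
    ∃ h : E2 → ℝ, ContDiff ℝ 1 h ∧ ∃ r > 0, ∃ a > 0,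
      (∀ y ∈ Metric.ball (0 : E2) r, |h y| < a) ∧
      ∀ y ∈ Metric.ball (0 : E2) r, ∀ s, |s| < a →
        0 < inner ℝ (gradient Ω.ψ (frameMap p ι (Ω.nvec p) (y, s))) (Ω.nvec p) ∧
        (frameMap p ι (Ω.nvec p) (y, s) ∈ Ω.region ↔ s < h y) ∧
        (frameMap p ι (Ω.nvec p) (y, s) ∈ Ω.bdry ↔ s = h y) := by
  set ν := Ω.nvec p with hν
  have hψp : Ω.ψ p = 0 := by rw [Ω.bdry_eq] at hp; exact hp
  have hgp := Ω.gradient_ne hp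
  have hp0 : frameMap p ι ν (0, 0) = p := by simp [frameMap]
  set F : E2 × ℝ → ℝ := fun z => Ω.ψ (frameMap p ι ν z) with hF
  have hfr : ∀ z w : E2 × ℝ, HasFDerivAt (frameMap p ι ν)
      (ι.toContinuousLinearMap.comp (ContinuousLinearMap.fst ℝ E2 ℝ)
        + (ContinuousLinearMap.snd ℝ E2 ℝ).smulRight ν) z := by
    intro z w
    have h1 : HasFDerivAt (fun z : E2 × ℝ => p + ι z.1)
        (ι.toContinuousLinearMap.comp (ContinuousLinearMap.fst ℝ E2 ℝ)) z :=
      ((ι.toContinuousLinearMap.comp (ContinuousLinearMap.fst ℝ E2 ℝ)).hasFDerivAt).const_add p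
    exact h1.add ((ContinuousLinearMap.snd ℝ E2 ℝ).smulRight ν).hasFDerivAt
  have hfc : ContDiff ℝ ∞ (frameMap p ι ν) := by
    unfold frameMap
    have := ι.contDiff (n := ∞)
    fun_prop
  have hFc : ContDiff ℝ ∞ F := Ω.smooth.comp hfc
  have hFd : ∀ z s, fderiv ℝ F z (0, s) = s * inner ℝ (gradient Ω.ψ (frameMap p ι ν z)) ν := by
    intro z s
    have := ((Ω.hasFDerivAt (frameMap p ι ν z)).comp z (hfr z z)).fderiv
    change fderiv ℝ F z = _ at this
    rw [this]
    simp
  have hα : 0 < inner ℝ (gradient Ω.ψ p) ν := by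
    rw [hν, Body.nvec, inner_smul_right]
    exact mul_pos (inv_pos.2 (norm_pos_iff.2 hgp)) (real_inner_self_pos.2 hgp)
  have hcd : ContDiffAt ℝ 1 F (0, 0) := (hFc.of_le (by simp)).contDiffAt
  -- The partial derivative in the vertical variable is multiplication by `∇ψ(p) · ν`, which is
  -- positive.
  have hinv : (fderiv ℝ F (0, 0) ∘L .inr ℝ E2 ℝ).IsInvertible := by
    refine ⟨ContinuousLinearEquiv.unitsEquivAut ℝ (Units.mk0 _ hα.ne'), ?_⟩
    ext
    simp [hFd, hp0]
  obtain ⟨h, hh, he⟩ := exists_contDiff_eqOn_ball (hcd.contDiffAt_implicitFunction one_ne_zero hinv)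
  have h00 : h 0 = 0 := by
    rw [he.self_of_nhds]
    exact hcd.implicitFunction_apply_self one_ne_zero hinv
  have hzero : ∀ᶠ y in 𝓝 (0 : E2), F (y, h y) = 0 := by
    filter_upwards [he, hcd.eventually_apply_implicitFunction one_ne_zero hinv] with y h1 h2
    rw [h1, h2]
    simp [hF, hp0, hψp]
  have hpos : ∀ᶠ z in 𝓝 ((0 : E2), (0 : ℝ)), 0 < inner ℝ (gradient Ω.ψ (frameMap p ι ν z)) ν := by
    have : Continuous fun z => (inner ℝ (gradient Ω.ψ (frameMap p ι ν z)) ν : ℝ) :=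
      (Ω.contDiff_gradient.continuous.comp (continuous_frameMap p ι ν)).inner continuous_const
    refine this.continuousAt.eventually (lt_mem_nhds ?_)
    beta_reduce
    rw [hp0]; exact hα
  obtain ⟨r₁, hr₁, hbox⟩ := Metric.eventually_nhds_iff_ball.1 hpos
  have hhc : ∀ᶠ y in 𝓝 (0 : E2), |h y| < r₁ := by
    refine (hh.continuous.abs.continuousAt).eventually (gt_mem_nhds ?_)
    beta_reduce
    rw [h00, abs_zero]; exact hr₁
  obtain ⟨r₂, hr₂, hev⟩ := Metric.eventually_nhds_iff_ball.1 (hzero.and hhc)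
  refine ⟨h, hh, min r₁ r₂, lt_min hr₁ hr₂, r₁, hr₁, fun y hy => ?_, fun y hy s hs => ?_⟩
  · exact (hev y (Metric.ball_subset_ball (min_le_right _ _) hy)).2
  · obtain ⟨hy0, hya⟩ := hev y (Metric.ball_subset_ball (min_le_right _ _) hy)
    have hy1 : dist y 0 < r₁ := lt_of_lt_of_le hy (min_le_left _ _)
    have hmem : ∀ s : ℝ, |s| < r₁ → 0 < inner ℝ (gradient Ω.ψ (frameMap p ι ν (y, s))) ν := by
      intro s hs
      apply hbox
      rw [← ball_prod_same]
      exact ⟨hy1, by simpa [Real.dist_eq] using hs⟩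
    have hmono : StrictMonoOn (fun s => F (y, s)) (Ioo (-r₁) r₁) := by
      refine strictMonoOn_of_deriv_pos (convex_Ioo _ _) ?_ ?_
      · exact (hFc.continuous.comp (by fun_prop)).continuousOn
      · rw [interior_Ioo]
        intro s hs
        have h1 : HasDerivAt (fun s : ℝ => (y, s)) ((0 : E2), (1 : ℝ)) s :=
          (hasDerivAt_const s y).prodMk (hasDerivAt_id s)
        have h2 := ((hFc.differentiable (by simp)) (y, s)).hasFDerivAt.comp_hasDerivAt s h1
        have h3 := h2.deriv
        change deriv (fun s => F (y, s)) s = _ at h3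
        rw [h3, hFd, one_mul]
        exact hmem s (abs_lt.2 hs)
    have hs' : s ∈ Ioo (-r₁) r₁ := abs_lt.1 hs
    have hy' : h y ∈ Ioo (-r₁) r₁ := abs_lt.1 hya
    refine ⟨hmem s hs, ?_, ?_⟩
    · change F (y, s) < 0 ↔ _
      rw [← hy0]
      exact hmono.lt_iff_lt hs' hy'
    · rw [Ω.bdry_eq]
      change F (y, s) = 0 ↔ _
      rw [← hy0]
      exact hmono.eq_iff_eq hs' hy'

/-- Differentiating `ψ = 0` along the graph forces `∇ψ = α (ν - ι ∇h)` with `α = ∇ψ · ν`, whose norm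
is `α` times the area density. Hence density times unit normal is `ν - ι ∇h`: the square root in the
area formula cancels against the normalization of the normal. -/
theorem Body.areaDensity_mul_inner_nvec (Ω : Body) {p : E3} {ι : E2 →ₗᵢ[ℝ] E3} {ν : E3}
    (hf : IsFrame ι ν) {h : E2 → ℝ} {y : E2} (hh : DifferentiableAt ℝ h y)
    (h0 : ∀ᶠ z in 𝓝 y, Ω.ψ (graphMap p ι ν h z) = 0)
    (hα : 0 < inner ℝ (gradient Ω.ψ (graphMap p ι ν h y)) ν) (w : E2) (c : ℝ) :
    areaDensity (gradient h y) * inner ℝ (Ω.nvec (graphMap p ι ν h y)) (ι w + c • ν)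
      = c - inner ℝ (gradient h y) w := by
  set g := gradient Ω.ψ (graphMap p ι ν h y) with hg
  set a := gradient h y with ha
  set α : ℝ := inner ℝ g ν with hαdef
  have hhd : HasFDerivAt h (innerSL ℝ a) y := hh.hasGradientAt.hasFDerivAt
  have hΓ : HasFDerivAt (graphMap p ι ν h)
      (ι.toContinuousLinearMap + (innerSL ℝ a).smulRight ν) y := by
    have h1 : HasFDerivAt (fun z : E2 => p + ι z) ι.toContinuousLinearMap y :=
      ι.toContinuousLinearMap.hasFDerivAt.const_add p
    exact h1.add (hhd.smul_const ν)
  have hcomp := (Ω.hasFDerivAt (graphMap p ι ν h y)).comp y hΓ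
  have hz : HasFDerivAt (Ω.ψ ∘ graphMap p ι ν h) (0 : E2 →L[ℝ] ℝ) y :=
    (hasFDerivAt_const (0 : ℝ) y).congr_of_eventuallyEq h0
  have hker : ∀ w : E2, inner ℝ g (ι w) = -(α * inner ℝ a w) := by
    intro w
    have := congrArg (fun L : E2 →L[ℝ] ℝ => L w) (hcomp.unique hz)
    change inner ℝ g (ι w + (inner ℝ a w : ℝ) • ν) = 0 at this
    rw [inner_add_right, inner_smul_right, ← hαdef] at this
    linarith
  obtain ⟨w₀, c₀, hw₀⟩ := hf.exists_eq g
  have hc₀ : c₀ = α := by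
    rw [hαdef, hw₀, inner_add_left, hf.orthogonal, inner_smul_left, real_inner_self_eq_norm_sq,
      hf.norm_eq]
    simp
  have hw₀' : w₀ = -(α • a) := by
    refine ext_inner_right ℝ fun w => ?_
    have := hker w
    rw [hw₀, inner_add_left, ι.inner_map_map, inner_smul_left, real_inner_comm _ ν,
      hf.orthogonal, mul_zero, add_zero] at this
    rw [inner_neg_left, inner_smul_left, this]
    rfl
  have hnorm : ‖g‖ = α * areaDensity a := by
    rw [← sq_eq_sq₀ (norm_nonneg _) (mul_pos hα (areaDensity_pos a)).le, mul_pow, areaDensity_sq,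
      hw₀, hf.norm_sq, hw₀', hc₀, norm_neg, norm_smul, mul_pow, Real.norm_eq_abs, sq_abs]
    ring
  rw [Body.nvec, ← hg, inner_smul_left, inner_add_right, hker, inner_smul_right, ← hαdef, hnorm]
  have hJ := areaDensity_pos a
  have hα' := hα.ne'
  simp
  field_simp
  ring

/-! ### Flattening the boundary, and the divergence theorem below a graph. -/

/-- The functions to which the divergence theorem on the body applies. -/
structure Body.IsGreen (Ω : Body) (f : E3 → ℝ) : Prop where
  continuousOn : ContinuousOn f Ω.closed
  contDiffOn : ContDiffOn ℝ 1 f Ω.region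
  bdd : ∃ C, ∀ x ∈ Ω.region, ‖fderiv ℝ f x‖ ≤ C

theorem Body.volume_region_lt_top (Ω : Body) : volume Ω.region < ⊤ :=
  (measure_mono Ω.region_subset_closed).trans_lt Ω.isCompact_closed.measure_lt_top

theorem Body.IsGreen.integrableOn {Ω : Body} {f : E3 → ℝ} (hf : Ω.IsGreen f) (v : E3) :
    IntegrableOn (fun x => fderiv ℝ f x v) Ω.region := by
  obtain ⟨C, hC⟩ := hf.bdd
  refine IntegrableOn.of_bound Ω.volume_region_lt_top ?_ (C * ‖v‖) ?_
  · refine ContinuousOn.aestronglyMeasurable ?_ Ω.region_isOpen.measurableSet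
    exact (hf.contDiffOn.continuousOn_fderiv_of_isOpen Ω.region_isOpen le_rfl).clm_apply
      continuousOn_const
  · refine (ae_restrict_iff' Ω.region_isOpen.measurableSet).2 (Eventually.of_forall fun x hx => ?_)
    exact ((fderiv ℝ f x).le_opNorm v).trans (by gcongr; exact hC x hx)

/-- Stability under smooth factors is what allows localization by a partition of unity. -/
theorem Body.IsGreen.mul {Ω : Body} {f χ : E3 → ℝ} (hf : Ω.IsGreen f) (hχ : ContDiff ℝ 1 χ) :
    Ω.IsGreen fun x => χ x * f x := by
  refine ⟨hχ.continuous.continuousOn.mul hf.continuousOn, hχ.contDiffOn.mul hf.contDiffOn, ?_⟩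
  obtain ⟨C, hC⟩ := hf.bdd
  obtain ⟨C₁, hC₁⟩ := Ω.isCompact_closed.exists_bound_of_continuousOn hχ.continuous.continuousOn
  obtain ⟨C₂, hC₂⟩ := Ω.isCompact_closed.exists_bound_of_continuousOn hf.continuousOn
  obtain ⟨C₃, hC₃⟩ := Ω.isCompact_closed.exists_bound_of_continuousOn
    (hχ.continuous_fderiv one_ne_zero).continuousOn
  refine ⟨C₁ * C + C₂ * C₃, fun x hx => ?_⟩
  have hx' := Ω.region_subset_closed hx
  have hd : DifferentiableAt ℝ f x :=
    (hf.contDiffOn.differentiableOn one_ne_zero).differentiableAt (Ω.region_isOpen.mem_nhds hx)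
  rw [fderiv_fun_mul ((hχ.differentiable one_ne_zero) x) hd]
  refine (norm_add_le _ _).trans ?_
  rw [norm_smul, norm_smul]
  have := (norm_nonneg _).trans (hC₁ x hx')
  have := (norm_nonneg _).trans (hC₂ x hx')
  gcongr
  · exact hC₁ x hx'
  · exact hC x hx
  · exact hC₂ x hx'
  · exact hC₃ x hx'

/-- The chart of space in which the graph of `h` is flat. -/
def flatMap (p : E3) (ι : E2 →ₗᵢ[ℝ] E3) (ν : E3) (h : E2 → ℝ) (z : E2 × ℝ) : E3 :=
  frameMap p ι ν (z.1, h z.1 + z.2)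

theorem flatMap_zero (p : E3) (ι : E2 →ₗᵢ[ℝ] E3) (ν : E3) (h : E2 → ℝ) (y : E2) :
    flatMap p ι ν h (y, 0) = graphMap p ι ν h y := by
  simp [flatMap, frameMap, graphMap]

/-- The chart is a vertical shear followed by a rigid map, so the change of variables has no
Jacobian factor, and continuity of `h` suffices. -/
theorem IsFrame.measurePreserving_flatMap {ι : E2 →ₗᵢ[ℝ] E3} {ν : E3} (hf : IsFrame ι ν)
    (p : E3) {h : E2 → ℝ} (hh : Continuous h) : MeasurePreserving (flatMap p ι ν h) := by
  have h1 : MeasurePreserving (fun z : E2 × ℝ => (z.1, h z.1 + z.2))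
      (volume.prod volume) (volume.prod volume) :=
    (MeasurePreserving.id (volume : Measure E2)).skew_product
      (g := fun y s => h y + s) (by fun_prop)
      (Eventually.of_forall fun y => (measurePreserving_add_left volume (h y)).map_eq)
  exact (hf.measurePreserving_frameMap p).comp h1

theorem contDiff_flatMap (p : E3) (ι : E2 →ₗᵢ[ℝ] E3) (ν : E3) {h : E2 → ℝ}
    (hh : ContDiff ℝ 1 h) : ContDiff ℝ 1 (flatMap p ι ν h) := by
  unfold flatMap frameMap
  have := ι.contDiff (n := 1)
  fun_prop

theorem hasFDerivAt_flatMap_left (p : E3) (ι : E2 →ₗᵢ[ℝ] E3) (ν : E3) {h : E2 → ℝ}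
    (hh : ContDiff ℝ 1 h) (y : E2) (σ : ℝ) :
    HasFDerivAt (fun y => flatMap p ι ν h (y, σ))
      (ι.toContinuousLinearMap + (innerSL ℝ (gradient h y)).smulRight ν) y := by
  have hhd : HasFDerivAt h (innerSL ℝ (gradient h y)) y :=
    ((hh.differentiable one_ne_zero) y).hasGradientAt.hasFDerivAt
  have h1 : HasFDerivAt (fun z : E2 => p + ι z) ι.toContinuousLinearMap y :=
    ι.toContinuousLinearMap.hasFDerivAt.const_add p
  exact h1.add ((hhd.add_const σ).smul_const ν)

theorem hasDerivAt_flatMap_right (p : E3) (ι : E2 →ₗᵢ[ℝ] E3) (ν : E3) (h : E2 → ℝ)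
    (y : E2) (σ : ℝ) : HasDerivAt (fun σ => flatMap p ι ν h (y, σ)) ν σ := by
  have h1 : HasDerivAt (fun σ : ℝ => h y + σ) 1 σ := by
    simpa using (hasDerivAt_id σ).const_add (h y)
  simpa [flatMap, frameMap] using (h1.smul_const ν).const_add (p + ι y)

/-- Divergence theorem below a graph, for functions that vanish outside a compact set. -/
theorem integral_fderiv_flatMap {p : E3} {ι : E2 →ₗᵢ[ℝ] E3} {ν : E3} (hfr : IsFrame ι ν)
    {h : E2 → ℝ} (hh : ContDiff ℝ 1 h) {f : E3 → ℝ} {K : Set E3} (hK : IsCompact K)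
    (hfK : ∀ x ∉ K, f x = 0)
    (hd : ∀ y, ∀ σ < 0, ContDiffAt ℝ 1 f (flatMap p ι ν h (y, σ)))
    (hc : ∀ y, ContinuousWithinAt (fun σ => f (flatMap p ι ν h (y, σ))) (Iic 0) 0)
    (hint : ∀ v, Integrable (fun z : E2 × ℝ =>
      (Iio (0 : ℝ)).indicator (fun σ => fderiv ℝ f (flatMap p ι ν h (z.1, σ)) v) z.2))
    (w : E2) (c : ℝ) :
    ∫ z : E2 × ℝ, (Iio (0 : ℝ)).indicator
        (fun σ => fderiv ℝ f (flatMap p ι ν h (z.1, σ)) (ι w + c • ν)) z.2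
      = ∫ y, (c - inner ℝ (gradient h y) w) * f (graphMap p ι ν h y) := by
  set Φ := flatMap p ι ν h with hΦ
  obtain ⟨R, hR⟩ := hK.isBounded.exists_norm_le
  have hΦK : ∀ y σ, Φ (y, σ) ∈ K → ‖y‖ ≤ R + ‖p‖ ∧ |h y + σ| ≤ R + ‖p‖ := by
    intro y σ hm
    have h1 := hfr.norm_frameMap_sub_sq p y (h y + σ)
    have h2 : ‖frameMap p ι ν (y, h y + σ) - p‖ ≤ R + ‖p‖ :=
      (norm_sub_le _ _).trans (by gcongr; exact hR _ hm)
    have h3 : 0 ≤ R + ‖p‖ := (norm_nonneg _).trans h2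
    have h4 : ‖frameMap p ι ν (y, h y + σ) - p‖ ^ 2 ≤ (R + ‖p‖) ^ 2 := by gcongr
    constructor
    · exact le_of_sq_le_sq (by nlinarith [sq_nonneg (h y + σ)]) h3
    · refine abs_le_of_sq_le_sq (by nlinarith [sq_nonneg ‖y‖]) h3
  set D : E3 → E2 × ℝ → ℝ := fun v z =>
    (Iio (0 : ℝ)).indicator (fun σ => fderiv ℝ f (Φ (z.1, σ)) v) z.2 with hD
  -- The direction `ι w + c • ν` is split into a part tangent to the vertically translated graphs
  -- and a multiple of `ν`. The tangential part is the derivative of `f ∘ Φ` in direction `w` at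
  -- fixed `σ`, so its integral over each slice vanishes; the vertical part is left to the
  -- fundamental theorem of calculus on `(-∞, 0]`.
  set T : E2 × ℝ → ℝ := fun z => D (ι w + (inner ℝ (gradient h z.1) w : ℝ) • ν) z with hT
  have hDT : ∀ z, D (ι w + c • ν) z = T z + (c - inner ℝ (gradient h z.1) w) * D ν z := by
    intro z
    simp only [hT, hD, indicator]
    split_ifs
    · simp only [map_add, map_smul, smul_eq_mul]; ring
    · simp
  have hD0 : ∀ v z, R + ‖p‖ < ‖z.1‖ → D v z = 0 := by
    intro v z hz
    have hm : Φ z ∉ K := fun hm => absurd (hΦK _ _ hm).1 (not_le.2 hz)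
    have h0 : f =ᶠ[𝓝 (Φ z)] fun _ => 0 := by
      filter_upwards [hK.isClosed.isOpen_compl.mem_nhds hm] with x hx using hfK x hx
    have h1 : fderiv ℝ f (Φ (z.1, z.2)) = 0 := by
      rw [Prod.mk.eta, h0.fderiv_eq]
      simp
    simp only [hD, indicator]
    split_ifs
    · rw [h1]; simp
    · rfl
  have hgc : Continuous fun y => (inner ℝ (gradient h y) w : ℝ) := by
    refine Continuous.inner ?_ continuous_const
    exact (InnerProductSpace.toDual ℝ E2).symm.continuous.comp (hh.continuous_fderiv one_ne_zero)
  have hTint : Integrable T := by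
    -- The slope of `h` need not be bounded on the plane, but it matters only over this ball,
    -- outside which the derivatives of `f` vanish.
    obtain ⟨C, hC⟩ := (isCompact_closedBall (0 : E2) (R + ‖p‖)).exists_bound_of_continuousOn
      hgc.continuousOn
    have hk : Integrable fun z : E2 × ℝ => (inner ℝ (gradient h z.1) w : ℝ) * D ν z := by
      refine ((hint ν).norm.const_mul C).mono'
        ((hgc.comp continuous_fst).aestronglyMeasurable.mul (hint ν).aestronglyMeasurable) ?_
      refine Eventually.of_forall fun z => ?_
      rw [norm_mul]
      by_cases hz : R + ‖p‖ < ‖z.1‖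
      · rw [hD0 ν z hz, norm_zero, mul_zero]
        have : (Iio (0 : ℝ)).indicator (fun σ => fderiv ℝ f (Φ (z.1, σ)) ν) z.2 = 0 := hD0 ν z hz
        rw [this, norm_zero, mul_zero]
      · exact mul_le_mul_of_nonneg_right
          (hC z.1 (mem_closedBall_zero_iff.2 (not_lt.1 hz))) (norm_nonneg _)
    refine ((hint (ι w)).add hk).congr (Eventually.of_forall fun z => ?_)
    simp only [hT, hD, indicator, Pi.add_apply]
    split_ifs
    · simp only [map_add, map_smul, smul_eq_mul]
    · simp
  have hT0 : ∫ z, T z = 0 := by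
    rw [Measure.volume_eq_prod, integral_prod_symm _ hTint]
    refine integral_eq_zero_of_ae (Eventually.of_forall fun σ => ?_)
    by_cases hσ : σ < 0
    · set g : E2 → ℝ := fun y => f (Φ (y, σ)) with hg
      have hg1 : ContDiff ℝ 1 g := contDiff_iff_contDiffAt.2 fun y => by
        have h1 : ContDiffAt ℝ 1 (fun y : E2 => Φ (y, σ)) y :=
          ((contDiff_flatMap p ι ν hh).comp (contDiff_id.prodMk contDiff_const)).contDiffAt
        exact (hd y σ hσ).comp y h1
      have hgs : HasCompactSupport g := HasCompactSupport.intro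
        (isCompact_closedBall (0 : E2) (R + ‖p‖)) fun y hy => by
          refine hfK _ fun hm => hy ?_
          exact mem_closedBall_zero_iff.2 (hΦK _ _ hm).1
      have hgT : ∀ y, T (y, σ) = fderiv ℝ g y w := by
        intro y
        have h1 := ((hd y σ hσ).differentiableAt one_ne_zero).hasFDerivAt.comp y
          (hasFDerivAt_flatMap_left p ι ν hh y σ)
        have h2 : fderiv ℝ g y = _ := h1.fderiv
        simp only [hT, hD]
        rw [indicator_of_mem (mem_Iio.2 hσ), h2]
        rfl
      simp only [hgT, Pi.zero_apply]
      have hi : Integrable fun y => fderiv ℝ g y w := by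
        refine Continuous.integrable_of_hasCompactSupport
          ((hg1.continuous_fderiv one_ne_zero).clm_apply continuous_const) ?_
        exact hgs.fderiv_apply (𝕜 := ℝ) w
      have := integral_mul_fderiv_eq_neg_fderiv_mul_of_integrable (μ := (volume : Measure E2))
        (f := fun _ => (1 : ℝ)) (g := g) (v := w) (by simp) (by simpa using hi)
        (by simpa using hg1.continuous.integrable_of_hasCompactSupport hgs)
        (fun x _ => differentiableAt_const _) (fun x _ => hg1.differentiable one_ne_zero x)
      simpa using this
    · simp only [hT, hD, Pi.zero_apply]
      simp [indicator, hσ]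
  have hDint : Integrable fun z : E2 × ℝ => (c - inner ℝ (gradient h z.1) w) * D ν z := by
    have := (hint (ι w + c • ν)).sub hTint
    refine this.congr (Eventually.of_forall fun z => ?_)
    simp only [Pi.sub_apply]
    exact sub_eq_of_eq_add' (hDT z)
  calc _ = ∫ z, (T z + (c - inner ℝ (gradient h z.1) w) * D ν z) := integral_congr_ae
        (Eventually.of_forall hDT)
    _ = ∫ z : E2 × ℝ, (c - inner ℝ (gradient h z.1) w) * D ν z := by
        rw [integral_add hTint hDint, hT0, zero_add]
    _ = ∫ y, ∫ σ, (c - inner ℝ (gradient h y) w) * D ν (y, σ) := by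
        rw [Measure.volume_eq_prod, integral_prod _ hDint]
    _ = _ := by
        have hae := (hint ν).prod_right_ae
        refine integral_congr_ae ?_
        filter_upwards [hae] with y hy
        rw [integral_const_mul]
        congr 1
        simp only [hD] at hy ⊢
        rw [integral_indicator measurableSet_Iio, ← integral_Iic_eq_integral_Iio]
        rw [integrable_indicator_iff measurableSet_Iio, ← integrableOn_Iic_iff_integrableOn_Iio] at hy
        have hder : ∀ σ ∈ Iio (0 : ℝ),
            HasDerivAt (fun σ => f (Φ (y, σ))) (fderiv ℝ f (Φ (y, σ)) ν) σ := fun σ hσ =>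
          ((hd y σ hσ).differentiableAt one_ne_zero).hasFDerivAt.comp_hasDerivAt σ
            (hasDerivAt_flatMap_right p ι ν h y σ)
        have hlim : Tendsto (fun σ => f (Φ (y, σ))) atBot (𝓝 0) := by
          refine tendsto_const_nhds.congr' ?_
          filter_upwards [eventually_lt_atBot (-(R + ‖p‖) - h y)] with σ hσ
          refine (hfK _ fun hm => ?_).symm
          have := neg_abs_le (h y + σ)
          have := (hΦK _ _ hm).2
          linarith
        rw [integral_Iic_of_hasDerivAt_of_tendsto (hc y) hder hy hlim, hΦ, flatMap_zero, sub_zero]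

/-! ### The divergence theorem on the body -/

theorem IsFrame.frameMap_injective {ι : E2 →ₗᵢ[ℝ] E3} {ν : E3} (hf : IsFrame ι ν) (p : E3) :
    Function.Injective (frameMap p ι ν) := by
  rintro ⟨y, s⟩ ⟨y', s'⟩ h
  have h1 := hf.norm_sq (y - y') (s - s')
  have h2 : ι (y - y') + (s - s') • ν = 0 := by
    simp only [frameMap] at h
    rw [map_sub, sub_smul]
    have h3 : ι y + s • ν = ι y' + s' • ν := by
      rw [add_assoc, add_assoc] at h
      exact add_left_cancel h
    rw [← sub_eq_zero] at h3
    rw [← h3]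
    abel
  rw [h2, norm_zero] at h1
  have h3 : ‖y - y'‖ = 0 := by nlinarith [sq_nonneg ‖y - y'‖, sq_nonneg (s - s')]
  have h4 : s - s' = 0 := by nlinarith [sq_nonneg ‖y - y'‖, sq_nonneg (s - s')]
  rw [norm_eq_zero, sub_eq_zero] at h3
  rw [sub_eq_zero] at h4
  rw [h3, h4]

/-- The divergence theorem for a scalar function. -/
def Body.GreenIdentity (Ω : Body) (f : E3 → ℝ) : Prop :=
  ∀ v, ∫ x in Ω.region, fderiv ℝ f x v = ∫ x in Ω.bdry, f x * inner ℝ (Ω.nvec x) v ∂μHE[2]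

/-- In the flattening chart the region near `p` is the half-space `σ < 0`, so the divergence theorem
below a graph applies and the area formula identifies the boundary term. Finite area of the boundary
patch is recorded too, since it comes from the same chart. -/
theorem Body.exists_nhds_greenIdentity_bdry (Ω : Body) {p : E3} (hp : p ∈ Ω.bdry) :
    ∃ U, IsOpen U ∧ p ∈ U ∧ (μHE[2] : Measure E3) (Ω.bdry ∩ U) < ⊤ ∧
      ∀ f, Ω.IsGreen f → ∀ K, IsCompact K → K ⊆ U → (∀ x ∉ K, f x = 0) → Ω.GreenIdentity f := by
  obtain ⟨ι, hfr⟩ := exists_frame (Ω.norm_nvec (Ω.gradient_ne hp))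
  obtain ⟨h, hh, r, hr, a, ha, hha, hbox⟩ := Ω.exists_local_graph hp ι
  set ν := Ω.nvec p with hν
  set U : Set E3 := frameMap p ι ν '' (Metric.ball (0 : E2) r ×ˢ Ioo (-a) a) with hU
  have hUo : IsOpen U := hfr.isOpenMap_frameMap p _ (Metric.isOpen_ball.prod isOpen_Ioo)
  have hpU : p ∈ U := ⟨(0, 0), ⟨Metric.mem_ball_self hr, by simp [ha]⟩, by simp [frameMap]⟩
  have hUmem : ∀ y s, frameMap p ι ν (y, s) ∈ U → y ∈ Metric.ball (0 : E2) r ∧ |s| < a := by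
    rintro y s ⟨⟨y', s'⟩, hz, he⟩
    obtain ⟨rfl, rfl⟩ := Prod.mk.inj (hfr.frameMap_injective p he)
    exact ⟨hz.1, abs_lt.2 hz.2⟩
  have hgraph : Ω.bdry ∩ U = graphMap p ι ν h '' Metric.ball (0 : E2) r := by
    ext x
    constructor
    · rintro ⟨hx, ⟨⟨y, s⟩, ⟨hy, hs⟩, rfl⟩⟩
      refine ⟨y, hy, ?_⟩
      rw [((hbox y hy s (abs_lt.2 hs)).2.2).1 hx]
      rfl
    · rintro ⟨y, hy, rfl⟩
      exact ⟨((hbox y hy _ (hha y hy)).2.2).2 rfl, ⟨(y, h y), ⟨hy, abs_lt.1 (hha y hy)⟩, rfl⟩⟩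
  refine ⟨U, hUo, hpU, ?_, ?_⟩
  · rw [hgraph]
    exact (measure_mono (image_mono Metric.ball_subset_closedBall)).trans_lt
      (measure_graphMap_lt_top hfr hh (isCompact_closedBall _ _))
  · intro f hf K hK hKU hfK v
    set Φ := flatMap p ι ν h with hΦ
    have hΦc : Continuous Φ := (contDiff_flatMap p ι ν hh).continuous
    have hΦU : ∀ y σ, Φ (y, σ) ∈ U → y ∈ Metric.ball (0 : E2) r ∧
        (Φ (y, σ) ∈ Ω.region ↔ σ < 0) ∧ (Φ (y, σ) ∈ Ω.bdry ↔ σ = 0) := by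
      intro y σ hm
      obtain ⟨hy, hs⟩ := hUmem _ _ hm
      refine ⟨hy, ?_, ?_⟩
      · exact (hbox y hy _ hs).2.1.trans (by constructor <;> intro h <;> linarith)
      · exact (hbox y hy _ hs).2.2.trans (by constructor <;> intro h <;> linarith)
    have hf0 : ∀ x ∉ U, f =ᶠ[𝓝 x] fun _ => 0 := fun x hx => by
      filter_upwards [hK.isClosed.isOpen_compl.mem_nhds fun h => hx (hKU h)] with z hz
        using hfK z hz
    have hd : ∀ y, ∀ σ < 0, ContDiffAt ℝ 1 f (Φ (y, σ)) := by
      intro y σ hσ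
      by_cases hm : Φ (y, σ) ∈ U
      · exact hf.contDiffOn.contDiffAt
          (Ω.region_isOpen.mem_nhds ((hΦU y σ hm).2.1.2 hσ))
      · exact contDiffAt_const.congr_of_eventuallyEq (hf0 _ hm)
    have hc : ∀ y, ContinuousWithinAt (fun σ => f (Φ (y, σ))) (Iic 0) 0 := by
      intro y
      have hyc : Continuous fun σ : ℝ => Φ (y, σ) := hΦc.comp (by fun_prop)
      by_cases hm : Φ (y, 0) ∈ U
      · have h1 := hf.continuousOn _ (Ω.bdry_subset_closed ((hΦU y 0 hm).2.2.2 rfl))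
        have h2 : Tendsto (fun σ : ℝ => Φ (y, σ)) (𝓝[Iic 0] 0) (𝓝[Ω.closed] (Φ (y, 0))) := by
          refine tendsto_nhdsWithin_iff.2 ⟨hyc.continuousWithinAt, ?_⟩
          filter_upwards [self_mem_nhdsWithin,
            nhdsWithin_le_nhds (hyc.continuousAt.eventually (hUo.mem_nhds hm))] with σ h1 h2
          rcases lt_or_eq_of_le (show σ ≤ 0 from h1) with h3 | h3
          · exact Ω.region_subset_closed ((hΦU y σ h2).2.1.2 h3)
          · exact Ω.bdry_subset_closed ((hΦU y σ h2).2.2.2 h3)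
        exact h1.tendsto.comp h2
      · have h1 : ContinuousAt f (Φ (y, 0)) := continuousAt_const.congr (hf0 _ hm).symm
        exact (ContinuousAt.comp (f := fun σ : ℝ => Φ (y, σ)) h1
          hyc.continuousAt).continuousWithinAt
    have hpres := hfr.measurePreserving_flatMap p hh.continuous
    -- The chart describes the region only inside `U`. Elsewhere both sides vanish because `f` is
    -- locally zero, so the identity can be stated on the whole chart.
    have hind : ∀ v z, Ω.region.indicator (fun x => fderiv ℝ f x v) (Φ z)
        = (Iio (0 : ℝ)).indicator (fun σ => fderiv ℝ f (Φ (z.1, σ)) v) z.2 := by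
      rintro v ⟨y, σ⟩
      by_cases hm : Φ (y, σ) ∈ U
      · have := (hΦU y σ hm).2.1
        simp only [indicator, mem_Iio, this]
      · have h1 : fderiv ℝ f (Φ (y, σ)) = 0 := by rw [(hf0 _ hm).fderiv_eq]; simp
        simp [indicator, h1]
    have hGint : ∀ v, Integrable (Ω.region.indicator fun x => fderiv ℝ f x v) := fun v =>
      (integrable_indicator_iff Ω.region_isOpen.measurableSet).2 (hf.integrableOn v)
    have hint : ∀ v, Integrable (fun z : E2 × ℝ =>
        (Iio (0 : ℝ)).indicator (fun σ => fderiv ℝ f (Φ (z.1, σ)) v) z.2) := by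
      intro v
      refine (hpres.integrable_comp_of_integrable (hGint v)).congr (Eventually.of_forall fun z => ?_)
      exact hind v z
    obtain ⟨w, c, rfl⟩ := hfr.exists_eq v
    rw [← integral_indicator Ω.region_isOpen.measurableSet]
    have e1 : ∫ x, Ω.region.indicator (fun x => fderiv ℝ f x (ι w + c • ν)) x
        = ∫ z : E2 × ℝ, Ω.region.indicator (fun x => fderiv ℝ f x (ι w + c • ν)) (Φ z) := by
      conv_lhs => rw [← hpres.map_eq]
      refine integral_map hpres.aemeasurable ?_
      rw [hpres.map_eq]
      exact (hGint _).aestronglyMeasurable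
    rw [e1]
    simp only [hind]
    rw [integral_fderiv_flatMap hfr hh hK hfK hd hc hint w c]
    have e2 : ∫ x in Ω.bdry, f x * inner ℝ (Ω.nvec x) (ι w + c • ν) ∂μHE[2]
        = ∫ x in Ω.bdry ∩ U, f x * inner ℝ (Ω.nvec x) (ι w + c • ν) ∂μHE[2] := by
      refine setIntegral_eq_of_subset_of_forall_sdiff_eq_zero Ω.isCompact_bdry.measurableSet
        inter_subset_left fun x hx => ?_
      rw [hfK x fun hxK => hx.2 ⟨hx.1, hKU hxK⟩, zero_mul]
    rw [e2, hgraph, setIntegral_graphMap hfr hh _ _ measurableSet_ball]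
    rw [← setIntegral_eq_integral_of_forall_compl_eq_zero (s := Metric.ball (0 : E2) r)]
    · refine setIntegral_congr_fun measurableSet_ball fun y hy => ?_
      have hy0 : ∀ᶠ z in 𝓝 y, Ω.ψ (graphMap p ι ν h z) = 0 := by
        filter_upwards [Metric.isOpen_ball.mem_nhds hy] with z hz
        have : graphMap p ι ν h z ∈ Ω.bdry := ((hbox z hz _ (hha z hz)).2.2).2 rfl
        rw [Ω.bdry_eq] at this
        exact this
      have := Ω.areaDensity_mul_inner_nvec hfr ((hh.differentiable one_ne_zero) y) hy0
        (hbox y hy _ (hha y hy)).1 w c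
      beta_reduce
      rw [← this]
      ring
    · intro y hy
      rw [hfK (graphMap p ι ν h y) fun hm => hy (hUmem y (h y) (hKU hm)).1, mul_zero]

/-- Such an `f` is `C¹` with compact support on the whole space: its derivative integrates to zero,
and the boundary term is zero because `K` does not meet the boundary. -/
theorem Body.greenIdentity_of_compact (Ω : Body) {f : E3 → ℝ} (hf : Ω.IsGreen f) {K : Set E3}
    (hK : IsCompact K) (hKU : K ⊆ Ω.region) (hfK : ∀ x ∉ K, f x = 0) : Ω.GreenIdentity f := by
  intro v
  have hf0 : ∀ x ∉ K, f =ᶠ[𝓝 x] fun _ => 0 := fun x hx => by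
    filter_upwards [hK.isClosed.isOpen_compl.mem_nhds hx] with z hz using hfK z hz
  have hc : ContDiff ℝ 1 f := contDiff_iff_contDiffAt.2 fun x => by
    by_cases hx : x ∈ K
    · exact hf.contDiffOn.contDiffAt (Ω.region_isOpen.mem_nhds (hKU hx))
    · exact contDiffAt_const.congr_of_eventuallyEq (hf0 _ hx)
  have hs : HasCompactSupport f := HasCompactSupport.intro hK fun x hx => hfK x hx
  have hi : Integrable fun y => fderiv ℝ f y v := by
    refine Continuous.integrable_of_hasCompactSupport
      ((hc.continuous_fderiv one_ne_zero).clm_apply continuous_const) ?_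
    exact hs.fderiv_apply (𝕜 := ℝ) v
  have h0 := integral_mul_fderiv_eq_neg_fderiv_mul_of_integrable (μ := (volume : Measure E3))
    (f := fun _ => (1 : ℝ)) (g := f) (v := v) (by simp) (by simpa using hi)
    (by simpa using hc.continuous.integrable_of_hasCompactSupport hs)
    (fun _ _ => differentiableAt_const _) (fun x _ => hc.differentiable one_ne_zero x)
  rw [setIntegral_eq_integral_of_forall_compl_eq_zero]
  · rw [setIntegral_eq_zero_of_forall_eq_zero]
    · simpa using h0
    · intro x hx
      rw [hfK x fun h => ?_, zero_mul]
      have h1 : Ω.ψ x < 0 := hKU h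
      rw [Ω.bdry_eq] at hx
      exact h1.ne hx
  · intro x hx
    rw [(hf0 x fun h => hx (hKU h)).fderiv_eq]
    simp

theorem Body.exists_nhds_greenIdentity (Ω : Body) {p : E3} (hp : p ∈ Ω.closed) :
    ∃ U, IsOpen U ∧ p ∈ U ∧
      ∀ f, Ω.IsGreen f → ∀ K, IsCompact K → K ⊆ U → (∀ x ∉ K, f x = 0) → Ω.GreenIdentity f := by
  rw [Ω.closed_eq] at hp
  rcases lt_or_eq_of_le (show Ω.ψ p ≤ 0 from hp) with h | h
  · exact ⟨Ω.region, Ω.region_isOpen, h, fun f hf K hK hKU hfK =>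
      Ω.greenIdentity_of_compact hf hK hKU hfK⟩
  · obtain ⟨U, h1, h2, -, h3⟩ := Ω.exists_nhds_greenIdentity_bdry (p := p)
      (by rw [Ω.bdry_eq]; exact h)
    exact ⟨U, h1, h2, h3⟩

/-- The boundary surface has finite area. -/
theorem Body.area_lt_top (Ω : Body) : (μHE[2] : Measure E3) Ω.bdry < ⊤ := by
  refine Ω.isCompact_bdry.measure_lt_top_of_nhdsWithin fun p hp => ?_
  obtain ⟨U, h1, h2, h3, -⟩ := Ω.exists_nhds_greenIdentity_bdry hp
  exact ⟨Ω.bdry ∩ U, inter_mem_nhdsWithin _ (h1.mem_nhds h2), h3⟩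

instance Body.isFiniteMeasure_area (Ω : Body) :
    IsFiniteMeasure ((μHE[2] : Measure E3).restrict Ω.bdry) :=
  ⟨by rw [Measure.restrict_apply_univ]; exact Ω.area_lt_top⟩

instance Body.isFiniteMeasure_volume (Ω : Body) :
    IsFiniteMeasure ((volume : Measure E3).restrict Ω.region) :=
  ⟨by rw [Measure.restrict_apply_univ]; exact Ω.volume_region_lt_top⟩

theorem Body.integrableOn_bdry (Ω : Body) {f : E3 → ℝ} (hf : ContinuousOn f Ω.bdry) :
    IntegrableOn f Ω.bdry μHE[2] := by
  obtain ⟨C, hC⟩ := Ω.isCompact_bdry.exists_bound_of_continuousOn hf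
  refine IntegrableOn.of_bound Ω.area_lt_top
    (hf.aestronglyMeasurable Ω.isCompact_bdry.measurableSet) C ?_
  exact (ae_restrict_iff' Ω.isCompact_bdry.measurableSet).2 (Eventually.of_forall hC)

theorem Body.continuousOn_nvec (Ω : Body) : ContinuousOn Ω.nvec Ω.bdry := fun x hx =>
  (Ω.contDiffAt_nvec (Ω.gradient_ne hx)).continuousAt.continuousWithinAt

/-- **Divergence theorem** on the body. -/
theorem Body.greenIdentity (Ω : Body) {f : E3 → ℝ} (hf : Ω.IsGreen f) : Ω.GreenIdentity f := by
  choose U hUo hUp hU using fun p : Ω.closed => Ω.exists_nhds_greenIdentity p.2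
  obtain ⟨χ, hχ⟩ := SmoothPartitionOfUnity.exists_isSubordinate (modelWithCornersSelf ℝ E3)
    -- Intersecting with unit balls makes the supports bounded, hence compact, as the local
    -- statements require.
    (isClosed_closure : IsClosed Ω.closed) (fun p => U p ∩ Metric.ball (p : E3) 1)
    (fun p => (hUo p).inter Metric.isOpen_ball)
    (fun _ hx => mem_iUnion.2 ⟨⟨_, hx⟩, hUp _, Metric.mem_ball_self one_pos⟩)
  have hfin := χ.locallyFinite.finite_nonempty_inter_compact Ω.isCompact_closed
  set T := hfin.toFinset with hT
  have hχc : ∀ i, ContDiff ℝ 1 (χ i) := fun i => ((χ i).contMDiff.contDiff).of_le (by simp)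
  have hsum : ∀ x ∈ Ω.closed, ∑ i ∈ T, χ i x = 1 := by
    intro x hx
    rw [← χ.sum_eq_one hx]
    refine (finsum_eq_sum_of_support_subset _ fun i hi => ?_).symm
    rw [hT, Finite.coe_toFinset]
    exact ⟨x, hi, hx⟩
  have hg : ∀ i, Ω.IsGreen fun x => χ i x * f x := fun i => hf.mul (hχc i)
  have hgi : ∀ i, Ω.GreenIdentity fun x => χ i x * f x := by
    intro i
    refine hU i _ (hg i) (tsupport (χ i)) ?_ ?_ ?_
    · refine Metric.isCompact_of_isClosed_isBounded (isClosed_tsupport _) ?_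
      exact Metric.isBounded_ball.subset ((hχ i).trans inter_subset_right)
    · exact (hχ i).trans inter_subset_left
    · intro x hx
      rw [image_eq_zero_of_notMem_tsupport hx, zero_mul]
  intro v
  have e1 : ∫ x in Ω.region, fderiv ℝ f x v
      = ∑ i ∈ T, ∫ x in Ω.region, fderiv ℝ (fun x => χ i x * f x) x v := by
    rw [← integral_finsetSum _ fun i _ => (hg i).integrableOn v]
    refine setIntegral_congr_fun Ω.region_isOpen.measurableSet fun x hx => ?_
    have he : f =ᶠ[𝓝 x] fun x => ∑ i ∈ T, χ i x * f x := by
      filter_upwards [Ω.closed_mem_nhds hx] with z hz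
      rw [← Finset.sum_mul, hsum z hz, one_mul]
    beta_reduce
    rw [he.fderiv_eq, fderiv_fun_sum]
    · simp
    · intro i _
      exact ((hg i).contDiffOn.differentiableOn one_ne_zero).differentiableAt
        (Ω.region_isOpen.mem_nhds hx)
  have e2 : ∫ x in Ω.bdry, f x * inner ℝ (Ω.nvec x) v ∂μHE[2]
      = ∑ i ∈ T, ∫ x in Ω.bdry, χ i x * f x * inner ℝ (Ω.nvec x) v ∂μHE[2] := by
    rw [← integral_finsetSum]
    · refine setIntegral_congr_fun Ω.isCompact_bdry.measurableSet fun x hx => ?_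
      beta_reduce
      rw [← Finset.sum_mul, ← Finset.sum_mul, hsum x (Ω.bdry_subset_closed hx), one_mul]
    · intro i _
      refine Ω.integrableOn_bdry (ContinuousOn.mul ?_ ?_)
      · exact (hg i).continuousOn.mono Ω.bdry_subset_closed
      · exact Ω.continuousOn_nvec.inner continuousOn_const
  rw [e1, e2]
  exact Finset.sum_congr rfl fun i _ => hgi i v

/-! ### Green identities of first and second order for functions of the place -/

/-- The spatial partial derivative on the closed region, for functions of the place. -/
def sp (Ω : Body) (i : Fin 3) (f : E3 → ℝ) : E3 → ℝ := fun x =>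
  fderivWithin ℝ f Ω.closed x (EuclideanSpace.single i (1 : ℝ))

/-- Functions with continuous partial derivatives up to order `n` on the closed region. -/
abbrev Body.IsC (Ω : Body) (n : ℕ) (f : E3 → ℝ) : Prop := ContDiffOn ℝ n f Ω.closed

section

variable {Ω : Body}

theorem Body.IsC.differentiableWithinAt {n : ℕ} {f : E3 → ℝ} (hf : Ω.IsC (n + 1) f) {x : E3}
    (hx : x ∈ Ω.closed) : DifferentiableWithinAt ℝ f Ω.closed x :=
  (hf.differentiableOn (by simp)) x hx

theorem Body.IsC.of_le {m n : ℕ} {f : E3 → ℝ} (hf : Ω.IsC n f) (h : m ≤ n) : Ω.IsC m f :=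
  ContDiffOn.of_le hf (by exact_mod_cast h)

theorem Body.IsC.sp {n : ℕ} {f : E3 → ℝ} (hf : Ω.IsC (n + 1) f) (i : Fin 3) :
    Ω.IsC n (sp Ω i f) :=
  ((contDiffOn_succ_iff_fderivWithin (n := (n : WithTop ℕ∞)) Ω.uniqueDiffOn_closed).1
    (by exact_mod_cast hf)).2.2.clm_apply contDiffOn_const

/-- The derivative in any direction is a fixed linear combination of the three partials. This is the
bridge from a class defined by iterated partial derivatives to `ContDiffOn`. -/
theorem Body.IsC.of_sp {n : ℕ} {f : E3 → ℝ} (hd : DifferentiableOn ℝ f Ω.closed)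
    (hs : ∀ i, Ω.IsC n (ThermoPiezo.sp Ω i f)) : Ω.IsC (n + 1) f := by
  have : ContDiffOn ℝ ((n : WithTop ℕ∞) + 1) f Ω.closed := by
    refine contDiffOn_succ_of_fderiv_apply hd (by simp) fun y => ?_
    have hy : (fun x => fderivWithin ℝ f Ω.closed x y)
        = fun x => ∑ i, y i * ThermoPiezo.sp Ω i f x := by
      funext x
      have h1 : y = ∑ i, y i • EuclideanSpace.single i (1 : ℝ) := by
        ext j
        simp [Finset.sum_apply, Pi.single_apply]
      conv_lhs => rw [h1]
      simp [ThermoPiezo.sp]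
    rw [hy]
    exact ContDiffOn.sum fun i _ => contDiffOn_const.mul (hs i)
  exact_mod_cast this

theorem sp_mul {f g : E3 → ℝ} {x : E3} (hx : x ∈ Ω.closed)
    (hf : DifferentiableWithinAt ℝ f Ω.closed x) (hg : DifferentiableWithinAt ℝ g Ω.closed x)
    (i : Fin 3) : sp Ω i (fun y => f y * g y) x = sp Ω i f x * g x + f x * sp Ω i g x := by
  simp only [sp]
  rw [fderivWithin_fun_mul (Ω.uniqueDiffOn_closed x hx) hf hg]
  change f x * fderivWithin ℝ g Ω.closed x _ + g x * fderivWithin ℝ f Ω.closed x _ = _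
  ring

theorem sp_add {f g : E3 → ℝ} {x : E3} (hx : x ∈ Ω.closed)
    (hf : DifferentiableWithinAt ℝ f Ω.closed x) (hg : DifferentiableWithinAt ℝ g Ω.closed x)
    (i : Fin 3) : sp Ω i (fun y => f y + g y) x = sp Ω i f x + sp Ω i g x := by
  simp only [sp]
  rw [fderivWithin_fun_add (Ω.uniqueDiffOn_closed x hx) hf hg]
  rfl

theorem sp_sub {f g : E3 → ℝ} {x : E3} (hx : x ∈ Ω.closed)
    (hf : DifferentiableWithinAt ℝ f Ω.closed x) (hg : DifferentiableWithinAt ℝ g Ω.closed x)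
    (i : Fin 3) : sp Ω i (fun y => f y - g y) x = sp Ω i f x - sp Ω i g x := by
  simp only [sp]
  rw [fderivWithin_fun_sub (Ω.uniqueDiffOn_closed x hx) hf hg]
  rfl

theorem sp_neg {f : E3 → ℝ} {x : E3} (hx : x ∈ Ω.closed) (i : Fin 3) :
    sp Ω i (fun y => -f y) x = -sp Ω i f x := by
  simp only [sp]
  rw [fderivWithin_fun_neg (Ω.uniqueDiffOn_closed x hx)]
  rfl

theorem sp_const (c : ℝ) (x : E3) (i : Fin 3) : sp Ω i (fun _ => c) x = 0 := by
  simp [sp]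

theorem sp_sum {ι : Type*} {s : Finset ι} {f : ι → E3 → ℝ} {x : E3} (hx : x ∈ Ω.closed)
    (hf : ∀ j ∈ s, DifferentiableWithinAt ℝ (f j) Ω.closed x) (i : Fin 3) :
    sp Ω i (fun y => ∑ j ∈ s, f j y) x = ∑ j ∈ s, sp Ω i (f j) x := by
  simp only [sp]
  rw [fderivWithin_fun_sum (Ω.uniqueDiffOn_closed x hx) hf]
  simp

theorem sp_congr {f g : E3 → ℝ} (h : EqOn f g Ω.closed) {x : E3} (hx : x ∈ Ω.closed) (i : Fin 3) :
    sp Ω i f x = sp Ω i g x := by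
  simp only [sp]
  rw [fderivWithin_congr h (h hx)]

theorem sp_congr_nhds {f g : E3 → ℝ} {x : E3} (h : f =ᶠ[𝓝 x] g) (i : Fin 3) :
    sp Ω i f x = sp Ω i g x := by
  simp only [sp]
  rw [Filter.EventuallyEq.fderivWithin_eq (h.filter_mono nhdsWithin_le_nhds) h.self_of_nhds]

theorem sp_congr_region {f g : E3 → ℝ} (h : EqOn f g Ω.region) {x : E3} (hx : x ∈ Ω.region)
    (i : Fin 3) : sp Ω i f x = sp Ω i g x :=
  sp_congr_nhds (h.eventuallyEq_of_mem (Ω.region_isOpen.mem_nhds hx)) i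

theorem sp_eq_fderiv (f : E3 → ℝ) {x : E3} (hx : x ∈ Ω.region) (i : Fin 3) :
    sp Ω i f x = fderiv ℝ f x (EuclideanSpace.single i (1 : ℝ)) := by
  simp only [sp]
  rw [fderivWithin_of_mem_nhds (Ω.closed_mem_nhds hx)]

theorem sp_comm {f : E3 → ℝ} (hf : Ω.IsC 2 f) {x : E3} (hx : x ∈ Ω.region) (i j : Fin 3) :
    sp Ω i (sp Ω j f) x = sp Ω j (sp Ω i f) x := by
  have hc : ContDiffAt ℝ 2 f x := by exact_mod_cast hf.contDiffAt (Ω.closed_mem_nhds hx)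
  have hd : DifferentiableAt ℝ (fderiv ℝ f) x :=
    (hc.fderiv_right (m := 1) (by norm_num)).differentiableAt one_ne_zero
  have key : ∀ i j, sp Ω i (sp Ω j f) x = fderiv ℝ (fderiv ℝ f) x (EuclideanSpace.single i (1 : ℝ))
      (EuclideanSpace.single j (1 : ℝ)) := by
    intro i j
    have h1 : sp Ω j f =ᶠ[𝓝 x] fun y => fderiv ℝ f y (EuclideanSpace.single j (1 : ℝ)) := by
      filter_upwards [Ω.region_isOpen.mem_nhds hx] with y hy using sp_eq_fderiv f hy j
    rw [sp_congr_nhds h1, sp_eq_fderiv _ hx, fderiv_clm_apply hd (differentiableAt_const _)]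
    simp
  rw [key, key]
  exact (hc.isSymmSndFDerivAt (by simp)) _ _

theorem Body.IsC.isGreen {f : E3 → ℝ} (hf : Ω.IsC 1 f) : Ω.IsGreen f := by
  have hf' : ContDiffOn ℝ 1 f Ω.closed := by exact_mod_cast hf
  refine ⟨hf'.continuousOn, hf'.mono Ω.region_subset_closed, ?_⟩
  obtain ⟨C, hC⟩ := Ω.isCompact_closed.exists_bound_of_continuousOn
    (hf'.continuousOn_fderivWithin Ω.uniqueDiffOn_closed le_rfl)
  refine ⟨C, fun x hx => ?_⟩
  rw [← fderivWithin_of_mem_nhds (Ω.closed_mem_nhds hx)]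
  exact hC x (Ω.region_subset_closed hx)

theorem inner_single_eq (v : E3) (i : Fin 3) :
    inner ℝ v (EuclideanSpace.single i (1 : ℝ)) = v i := by
  simp [EuclideanSpace.inner_single_right]

theorem Body.continuousOn_normal (Ω : Body) (i : Fin 3) : ContinuousOn (Ω.normal i) Ω.bdry := by
  have := Ω.continuousOn_nvec.inner (𝕜 := ℝ)
    (continuousOn_const (c := EuclideanSpace.single i (1 : ℝ)))
  simp only [inner_single_eq] at this
  exact this

/-- The divergence theorem for a vector field. -/
theorem integral_div {F : Fin 3 → E3 → ℝ} (hF : ∀ i, Ω.IsC 1 (F i)) :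
    ∫ x in Ω.region, ∑ i, sp Ω i (F i) x = ∫ x in Ω.bdry, ∑ i, F i x * Ω.normal i x ∂μHE[2] := by
  have h1 : ∀ i, ∫ x in Ω.region, sp Ω i (F i) x = ∫ x in Ω.bdry, F i x * Ω.normal i x ∂μHE[2] := by
    intro i
    rw [setIntegral_congr_fun Ω.region_isOpen.measurableSet fun x hx => sp_eq_fderiv (F i) hx i,
      Ω.greenIdentity (hF i).isGreen]
    simp only [inner_single_eq]
    rfl
  rw [integral_finsetSum, integral_finsetSum]
  · exact Finset.sum_congr rfl fun i _ => h1 i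
  · intro i _
    exact Ω.integrableOn_bdry
      (((hF i).continuousOn.mono Ω.bdry_subset_closed).mul (Ω.continuousOn_normal i))
  · intro i _
    exact ((hF i).isGreen.integrableOn _).congr_fun (fun x hx => (sp_eq_fderiv (F i) hx i).symm)
      Ω.region_isOpen.measurableSet

/-! ### Surface divergence theorem and second-order integration by parts. -/

/-- The surface gradient for functions of the place. -/
def sd (Ω : Body) (i : Fin 3) (f : E3 → ℝ) : E3 → ℝ := fun x =>
  ∑ j, ((if i = j then 1 else 0) - Ω.normal i x * Ω.normal j x) * sp Ω j f x

theorem divNormal_eq (x : E3) : divNormal Ω x = ∑ l, sd Ω l (Ω.normal l) x := rfl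

theorem sum_normal_sq {x : E3} (hx : gradient Ω.ψ x ≠ 0) : ∑ k, Ω.normal k x ^ 2 = 1 := by
  have h := Ω.norm_nvec hx
  have h2 := EuclideanSpace.real_norm_sq_eq (Ω.nvec x)
  rw [h, one_pow] at h2
  exact h2.symm

/-- The extended normal has unit length in a full neighbourhood of each boundary point, so `N · N =
1` may be differentiated in every direction, not only tangentially. -/
theorem sum_normal_mul_sp {N : Fin 3 → E3 → ℝ} (hN : ∀ i, ContDiff ℝ ∞ (N i))
    (hNn : ∀ x ∈ Ω.bdry, ∀ i, N i =ᶠ[𝓝 x] Ω.normal i) {x : E3} (hx : x ∈ Ω.bdry) (j : Fin 3) :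
    ∑ k, N k x * sp Ω j (N k) x = 0 := by
  have hx' := Ω.bdry_subset_closed hx
  have hNd : ∀ k, DifferentiableWithinAt ℝ (N k) Ω.closed x := fun k =>
    ((hN k).differentiable (by simp)).differentiableAt.differentiableWithinAt
  have h1 : (fun y => ∑ k, N k y * N k y) =ᶠ[𝓝 x] fun _ => (1 : ℝ) := by
    have hg : ∀ᶠ y in 𝓝 x, gradient Ω.ψ y ≠ 0 :=
      Ω.contDiff_gradient.continuous.continuousAt.eventually_ne (Ω.gradient_ne hx)
    filter_upwards [hg, eventually_all.2 fun i => hNn x hx i] with y hy hNy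
    rw [← sum_normal_sq hy]
    exact Finset.sum_congr rfl fun k _ => by rw [hNy, sq]
  have h2 := sp_congr_nhds (Ω := Ω) h1 j
  rw [sp_const, sp_sum hx' fun k _ => (hNd k).fun_mul (hNd k)] at h2
  have h3 : ∀ k, sp Ω j (fun y => N k y * N k y) x = 2 * (N k x * sp Ω j (N k) x) := fun k => by
    rw [sp_mul hx' (hNd k) (hNd k)]; ring
  simp only [h3, ← Finset.mul_sum] at h2
  linarith

theorem Body.continuousOn_divNormal (Ω : Body) : ContinuousOn (divNormal Ω) Ω.bdry := by
  obtain ⟨N, hN, hNn⟩ := Ω.exists_smooth_normal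
  have hNC : ∀ k, Ω.IsC 1 (N k) := fun k =>
    (ContDiff.of_le (hN k) (by exact_mod_cast le_top)).contDiffOn
  refine continuousOn_finsetSum _ fun l _ => continuousOn_finsetSum _ fun j _ =>
    ContinuousOn.mul (continuousOn_const.sub
      ((Ω.continuousOn_normal l).mul (Ω.continuousOn_normal j))) ?_
  have : ContinuousOn (sp Ω j (N l)) Ω.bdry :=
    ((hNC l).sp j).continuousOn.mono Ω.bdry_subset_closed
  exact this.congr fun x hx => sp_congr_nhds (hNn x hx l).symm j

/-- With `a k j` for `n_{k,j}` and `D j k` for `F_{j,k}`, this is a polynomial identity modulo `n ·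
n = 1` and `n_k n_{k,j} = 0`. The right side is the normal component of the row divergence of `n_k
F_j - n_j F_k`. -/
theorem surface_div_algebra (n F : Fin 3 → ℝ) (a D : Fin 3 → Fin 3 → ℝ)
    (hsq : ∑ k, n k ^ 2 = 1) (ho : ∀ j, ∑ k, n k * a k j = 0) :
    (∑ j, ∑ k, ((if j = k then 1 else 0) - n j * n k) * D j k)
      - (∑ l, ∑ j, ((if l = j then 1 else 0) - n l * n j) * a l j) * ∑ j, n j * F j
      = ∑ k, (∑ j, (a k j * F j + n k * D j j - (a j j * F k + n j * D k j))) * n k := by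
  have o0 := ho 0
  have o1 := ho 1
  have o2 := ho 2
  simp only [Fin.sum_univ_three] at hsq o0 o1 o2 ⊢
  simp
  linear_combination (-(D 0 0 + D 1 1 + D 2 2)) * hsq
    + ((n 0 * F 0 + n 1 * F 1 + n 2 * F 2) * n 0 - F 0) * o0
    + ((n 0 * F 0 + n 1 * F 1 + n 2 * F 2) * n 1 - F 1) * o1
    + ((n 0 * F 0 + n 1 * F 1 + n 2 * F 2) * n 2 - F 2) * o2

/-- The **surface divergence theorem** on the boundary. -/
theorem integral_surface_div {F : Fin 3 → E3 → ℝ} (hF : ∀ i, Ω.IsC 2 (F i)) :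
    ∫ x in Ω.bdry, ((∑ j, sd Ω j (F j) x) - divNormal Ω x * ∑ j, Ω.normal j x * F j x) ∂μHE[2]
      = 0 := by
  obtain ⟨N, hN, hNn⟩ := Ω.exists_smooth_normal
  have hNC : ∀ (n : ℕ) k, Ω.IsC n (N k) := fun n k =>
    (ContDiff.of_le (hN k) (by exact_mod_cast le_top)).contDiffOn
  -- Skewness of `G` and the symmetry of second derivatives make the row divergence of `G` a
  -- divergence-free field, so its flux through the boundary is zero.
  set G : Fin 3 → Fin 3 → E3 → ℝ := fun k j y => N k y * F j y - N j y * F k y with hG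
  have hGC : ∀ k j, Ω.IsC 2 (G k j) := fun k j =>
    ((hNC 2 k).mul (hF j)).sub ((hNC 2 j).mul (hF k))
  have hW : ∀ k, Ω.IsC 1 fun x => ∑ j, sp Ω j (G k j) x := fun k =>
    ContDiffOn.sum fun j _ => (hGC k j).sp j
  have h0 : ∫ x in Ω.region, ∑ k, sp Ω k (fun x => ∑ j, sp Ω j (G k j) x) x = 0 := by
    refine setIntegral_eq_zero_of_forall_eq_zero fun x hx => ?_
    have hx' := Ω.region_subset_closed hx
    have e1 : ∀ k, sp Ω k (fun x => ∑ j, sp Ω j (G k j) x) x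
        = ∑ j, sp Ω k (sp Ω j (G k j)) x := fun k =>
      sp_sum hx' (fun j _ => ((hGC k j).sp j).differentiableWithinAt hx') k
    have e2 : ∀ k j, sp Ω k (sp Ω j (G k j)) x = -sp Ω j (sp Ω k (G j k)) x := by
      intro k j
      have : G k j = fun y => -G j k y := by
        funext y
        simp only [hG]
        ring
      rw [sp_comm (hGC k j) hx, this]
      rw [sp_congr_region (g := fun y => -sp Ω k (G j k) y)
        (fun y hy => sp_neg (Ω.region_subset_closed hy) k) hx, sp_neg hx']
    simp only [e1]
    have e3 : ∑ k, ∑ j, sp Ω k (sp Ω j (G k j)) x = -∑ k, ∑ j, sp Ω k (sp Ω j (G k j)) x := by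
      conv_lhs =>
        enter [2, k, 2, j]
        rw [e2]
      simp only [Finset.sum_neg_distrib]
      rw [Finset.sum_comm]
    linarith
  rw [integral_div hW] at h0
  rw [← h0]
  refine setIntegral_congr_fun Ω.isCompact_bdry.measurableSet fun x hx => ?_
  have hx' := Ω.bdry_subset_closed hx
  have hNx : ∀ k, Ω.normal k x = N k x := fun k => (hNn x hx k).self_of_nhds.symm
  have hNs : ∀ k j, sp Ω j (Ω.normal k) x = sp Ω j (N k) x := fun k j =>
    sp_congr_nhds (hNn x hx k).symm j
  have hsq := sum_normal_sq (Ω := Ω) (Ω.gradient_ne hx)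
  have ho := sum_normal_mul_sp hN hNn hx
  have hGs : ∀ k j, sp Ω j (G k j) x = sp Ω j (N k) x * F j x + N k x * sp Ω j (F j) x
      - (sp Ω j (N j) x * F k x + N j x * sp Ω j (F k) x) := by
    intro k j
    have hd := fun k => (hNC 1 k).differentiableWithinAt hx'
    have hd' := fun k => ((hF k).of_le (m := 1) (by norm_num)).differentiableWithinAt hx'
    simp only [hG]
    rw [sp_sub hx' ((hd k).fun_mul (hd' j)) ((hd j).fun_mul (hd' k)), sp_mul hx' (hd k) (hd' j),
      sp_mul hx' (hd j) (hd' k)]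
  simp only [divNormal_eq, sd, hNx, hNs, hGs] at hsq ⊢
  exact surface_div_algebra (fun k => N k x) (fun k => F k x) (fun k j => sp Ω j (N k) x)
    (fun j k => sp Ω k (F j) x) hsq ho

/-- Integration by parts of a first and a second order stress against a function: the boundary
terms are the traction and the hypertraction. -/
theorem integral_second_order {T : Fin 3 → E3 → ℝ} {m : Fin 3 → Fin 3 → E3 → ℝ} {w : E3 → ℝ}
    (hT : ∀ j, Ω.IsC 1 (T j)) (hm : ∀ k j, Ω.IsC 2 (m k j)) (hw : Ω.IsC 2 w) :
    ∫ x in Ω.bdry, (((∑ j, (T j x - ∑ k, sp Ω k (m k j) x) * Ω.normal j x)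
        - (∑ j, ∑ k, sd Ω j (fun y => m k j y * Ω.normal k y) x)
        + divNormal Ω x * ∑ k, ∑ j, m k j x * Ω.normal k x * Ω.normal j x) * w x
        + (∑ k, ∑ j, m k j x * Ω.normal k x * Ω.normal j x)
          * ∑ i, Ω.normal i x * sp Ω i w x) ∂μHE[2]
      = ∫ x in Ω.region, ((∑ j, T j x * sp Ω j w x) + (∑ k, ∑ j, m k j x * sp Ω j (sp Ω k w) x)
        + ((∑ j, sp Ω j (T j) x) - ∑ k, ∑ j, sp Ω j (sp Ω k (m k j)) x) * w x) := by
  obtain ⟨N, hN, hNn⟩ := Ω.exists_smooth_normal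
  have hNC : ∀ (n : ℕ) k, Ω.IsC n (N k) := fun n k =>
    (ContDiff.of_le (hN k) (by exact_mod_cast le_top)).contDiffOn
  have hw1 : Ω.IsC 1 w := hw.of_le (by norm_num)
  have hm1 : ∀ k j, Ω.IsC 1 (m k j) := fun k j => (hm k j).of_le (by norm_num)
  have hws : ∀ k, Ω.IsC 1 (sp Ω k w) := fun k => hw.sp k
  have hms : ∀ k j i, Ω.IsC 1 (sp Ω i (m k j)) := fun k j i => (hm k j).sp i
  -- The divergence of this field is the volume integrand: the first derivatives of `m` against
  -- those of `w` cancel between the last two terms.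
  have hW : ∀ j, Ω.IsC 1 fun y => T j y * w y + (∑ k, m j k y * sp Ω k w y)
      - (∑ k, sp Ω k (m k j) y) * w y := fun j =>
    (((hT j).mul hw1).add (ContDiffOn.sum fun k _ => (hm1 j k).mul (hws k))).sub
      ((ContDiffOn.sum fun k _ => hms k j k).mul hw1)
  -- The flux of the previous field contains `m_{kj} n_k w_{,j}`. Its normal part is the
  -- hypertraction term; its tangential part is integrated by parts on the surface by applying the
  -- surface divergence theorem to this field.
  have hF : ∀ j, Ω.IsC 2 fun y => (∑ k, m k j y * N k y) * w y := fun j =>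
    (ContDiffOn.sum fun k _ => (hm k j).mul (hNC 2 k)).mul hw
  have hcongr : ∫ x in Ω.region, ((∑ j, T j x * sp Ω j w x)
        + (∑ k, ∑ j, m k j x * sp Ω j (sp Ω k w) x)
        + ((∑ j, sp Ω j (T j) x) - ∑ k, ∑ j, sp Ω j (sp Ω k (m k j)) x) * w x)
      = ∫ x in Ω.region, ∑ j, sp Ω j (fun y => T j y * w y + (∑ k, m j k y * sp Ω k w y)
      - (∑ k, sp Ω k (m k j) y) * w y) x := by
    refine setIntegral_congr_fun Ω.region_isOpen.measurableSet fun x hx => ?_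
    have hx' := Ω.region_subset_closed hx
    have dT := fun j => (hT j).differentiableWithinAt hx'
    have dw := hw1.differentiableWithinAt hx'
    have dm := fun k j => (hm1 k j).differentiableWithinAt hx'
    have dws := fun k => (hws k).differentiableWithinAt hx'
    have dms := fun k j i => (hms k j i).differentiableWithinAt hx'
    have dsum1 := fun j => DifferentiableWithinAt.fun_sum (u := Finset.univ)
      fun k _ => (dm j k).fun_mul (dws k)
    have dsum2 := fun j => DifferentiableWithinAt.fun_sum (u := Finset.univ) fun k _ => dms k j k
    have e : ∀ j, sp Ω j (fun y => T j y * w y + (∑ k, m j k y * sp Ω k w y)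
        - (∑ k, sp Ω k (m k j) y) * w y) x
        = sp Ω j (T j) x * w x + T j x * sp Ω j w x
          + (∑ k, (sp Ω j (m j k) x * sp Ω k w x + m j k x * sp Ω k (sp Ω j w) x))
          - ((∑ k, sp Ω j (sp Ω k (m k j)) x) * w x
            + (∑ k, sp Ω k (m k j) x) * sp Ω j w x) := by
      intro j
      rw [sp_sub hx' (((dT j).fun_mul dw).fun_add (dsum1 j)) ((dsum2 j).fun_mul dw),
        sp_add hx' ((dT j).fun_mul dw) (dsum1 j), sp_mul hx' (dT j) dw, sp_mul hx' (dsum2 j) dw,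
        sp_sum hx' (fun k _ => (dm j k).fun_mul (dws k)), sp_sum hx' fun k _ => dms k j k]
      congr 2
      refine Finset.sum_congr rfl fun k _ => ?_
      rw [sp_mul hx' (dm j k) (dws k), sp_comm hw hx]
    simp only [e]
    simp only [Fin.sum_univ_three]
    ring
  rw [hcongr, integral_div hW]
  have hsurf := integral_surface_div hF
  have hi1 : IntegrableOn (fun x => ∑ j, (T j x * w x + (∑ k, m j k x * sp Ω k w x)
      - (∑ k, sp Ω k (m k j) x) * w x) * Ω.normal j x) Ω.bdry μHE[2] := by
    refine Ω.integrableOn_bdry (continuousOn_finsetSum _ fun j _ => ?_)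
    exact ((hW j).continuousOn.mono Ω.bdry_subset_closed).mul (Ω.continuousOn_normal j)
  have hpt : ∀ x ∈ Ω.bdry, ((∑ j, (T j x - ∑ k, sp Ω k (m k j) x) * Ω.normal j x)
        - (∑ j, ∑ k, sd Ω j (fun y => m k j y * Ω.normal k y) x)
        + divNormal Ω x * ∑ k, ∑ j, m k j x * Ω.normal k x * Ω.normal j x) * w x
        + (∑ k, ∑ j, m k j x * Ω.normal k x * Ω.normal j x)
          * ∑ i, Ω.normal i x * sp Ω i w x
      = (∑ j, (T j x * w x + (∑ k, m j k x * sp Ω k w x)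
      - (∑ k, sp Ω k (m k j) x) * w x) * Ω.normal j x)
      - ((∑ j, sd Ω j (fun y => (∑ k, m k j y * N k y) * w y) x)
        - divNormal Ω x * ∑ j, Ω.normal j x * ((∑ k, m k j x * N k x) * w x)) := by
    intro x hx
    have hx' := Ω.bdry_subset_closed hx
    have hNx : ∀ k, Ω.normal k x = N k x := fun k => (hNn x hx k).self_of_nhds.symm
    have dw := hw1.differentiableWithinAt hx'
    have dm := fun k j => (hm1 k j).differentiableWithinAt hx'
    have dN := fun k => (hNC 1 k).differentiableWithinAt hx'
    have hs1 : ∀ j k i, sp Ω i (fun y => m k j y * Ω.normal k y) x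
        = sp Ω i (fun y => m k j y * N k y) x := by
      intro j k i
      refine sp_congr_nhds ?_ i
      filter_upwards [hNn x hx k] with y hy
      rw [hy]
    have hs2 : ∀ j i, sp Ω i (fun y => (∑ k, m k j y * N k y) * w y) x
        = (∑ k, sp Ω i (fun y => m k j y * N k y) x) * w x
          + (∑ k, m k j x * N k x) * sp Ω i w x := by
      intro j i
      rw [sp_mul hx' (DifferentiableWithinAt.fun_sum fun k _ => (dm k j).fun_mul (dN k)) dw,
        sp_sum hx' fun k _ => (dm k j).fun_mul (dN k)]
    simp only [sd, hs1, hs2, hNx]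
    simp only [Fin.sum_univ_three]
    simp
    ring
  rw [setIntegral_congr_fun Ω.isCompact_bdry.measurableSet hpt]
  have hi2 : IntegrableOn (fun x => (∑ j, sd Ω j (fun y => (∑ k, m k j y * N k y) * w y) x)
        - divNormal Ω x * ∑ j, Ω.normal j x * ((∑ k, m k j x * N k x) * w x)) Ω.bdry μHE[2] := by
    refine Ω.integrableOn_bdry ?_
    refine ContinuousOn.sub (continuousOn_finsetSum _ fun j _ => ?_) (ContinuousOn.mul ?_ ?_)
    · refine continuousOn_finsetSum _ fun i _ => ContinuousOn.mul (continuousOn_const.sub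
        ((Ω.continuousOn_normal j).mul (Ω.continuousOn_normal i))) ?_
      exact ((hF j).sp i).continuousOn.mono Ω.bdry_subset_closed
    · exact Ω.continuousOn_divNormal
    · refine continuousOn_finsetSum _ fun j _ => (Ω.continuousOn_normal j).mul ?_
      exact (hF j).continuousOn.mono Ω.bdry_subset_closed
  rw [integral_sub hi1 hi2, hsurf, sub_zero]

end

/-! ### The convolution ring of continuous functions of the time -/

theorem conv_comm (f g : ℝ → ℝ) (t : ℝ) : conv f g t = conv g f t := by
  unfold conv
  have := intervalIntegral.integral_comp_sub_left (fun s => g s * f (t - s)) t (a := 0) (b := t)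
  rw [sub_self, sub_zero] at this
  rw [← this]
  refine intervalIntegral.integral_congr fun s _ => ?_
  simp only [sub_sub_cancel]
  ring

theorem conv_congr {f f' g g' : ℝ → ℝ} (hf : EqOn f f' (Ici 0)) (hg : EqOn g g' (Ici 0)) :
    EqOn (conv f g) (conv f' g') (Ici 0) := by
  intro t ht
  refine intervalIntegral.integral_congr fun s hs => ?_
  rw [uIcc_of_le ht] at hs
  rw [hf hs.1, hg (sub_nonneg.2 hs.2)]

theorem continuous_conv {X : Type*} [TopologicalSpace X] {f g : X → ℝ → ℝ}
    (hf : Continuous f.uncurry) (hg : Continuous g.uncurry) :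
    Continuous fun p : X × ℝ => conv (f p.1) (g p.1) p.2 := by
  unfold conv
  refine intervalIntegral.continuous_parametric_intervalIntegral_of_continuous
    (f := fun (p : X × ℝ) τ => f p.1 τ * g p.1 (p.2 - τ)) ?_ continuous_snd
  exact (hf.comp (by fun_prop : Continuous fun q : (X × ℝ) × ℝ => (q.1.1, q.2))).mul
    (hg.comp (by fun_prop : Continuous fun q : (X × ℝ) × ℝ => (q.1.1, q.1.2 - q.2)))

/-- Both iterated integrals are integrals over the triangle `τ ≤ s` in the square `[0, t]²`; Fubini
for the integrand cut off to this triangle identifies them. -/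
theorem conv_assoc_of_continuous {f g k : ℝ → ℝ} (hf : Continuous f) (hg : Continuous g)
    (hk : Continuous k) {t : ℝ} (ht : 0 ≤ t) :
    conv (conv f g) k t = conv f (conv g k) t := by
  set F : ℝ → ℝ → ℝ := fun s τ => (Ici τ).indicator (fun s => f τ * g (s - τ) * k (t - s)) s with hF
  have hFi : IntegrableOn F.uncurry (uIoc 0 t ×ˢ uIoc 0 t) := by
    have hset : MeasurableSet {p : ℝ × ℝ | p.2 ≤ p.1} :=
      measurableSet_le measurable_snd measurable_fst
    have hFe : F.uncurry = {p : ℝ × ℝ | p.2 ≤ p.1}.indicator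
        fun p => f p.2 * g (p.1 - p.2) * k (t - p.1) := by
      funext ⟨s, τ⟩
      simp [hF, Function.uncurry, indicator]
    have hcont : Continuous fun p : ℝ × ℝ => f p.2 * g (p.1 - p.2) * k (t - p.1) := by fun_prop
    rw [hFe]
    refine Integrable.indicator ?_ hset
    rw [uIoc_of_le ht]
    refine (hcont.continuousOn.integrableOn_compact
      (isCompact_Icc.prod isCompact_Icc (s := Icc 0 t) (t := Icc 0 t))).mono_set ?_
    exact prod_mono Ioc_subset_Icc_self Ioc_subset_Icc_self
  have hswap := intervalIntegral_intervalIntegral_swap (F := F) (a := 0) (b := t) (c := 0) (d := t)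
    hFi
  have e1 : conv (conv f g) k t = ∫ s in (0 : ℝ)..t, ∫ τ in (0 : ℝ)..t, F s τ := by
    refine intervalIntegral.integral_congr fun s hs => ?_
    rw [uIcc_of_le ht] at hs
    have hFs : ∀ τ, F s τ = (Iic s).indicator (fun τ => f τ * g (s - τ) * k (t - s)) τ :=
      fun τ => by simp [hF, indicator]
    simp only [hFs, conv]
    change _ = ∫ τ in (0 : ℝ)..t, {τ | τ ≤ s}.indicator (fun τ => f τ * g (s - τ) * k (t - s)) τ
    rw [intervalIntegral.integral_indicator hs, intervalIntegral.integral_mul_const]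
  have e2 : conv f (conv g k) t = ∫ τ in (0 : ℝ)..t, ∫ s in (0 : ℝ)..t, F s τ := by
    refine intervalIntegral.integral_congr fun τ hτ => ?_
    rw [uIcc_of_le ht] at hτ
    have h1 : ∫ s in (0 : ℝ)..t, F s τ = ∫ s in τ..t, f τ * g (s - τ) * k (t - s) := by
      rw [intervalIntegral.integral_of_le ht, intervalIntegral.integral_of_le hτ.2,
        ← integral_Icc_eq_integral_Ioc, ← integral_Icc_eq_integral_Ioc]
      simp only [hF]
      rw [setIntegral_indicator measurableSet_Ici]
      congr 2
      ext s
      simp only [mem_inter_iff, mem_Icc, mem_Ici]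
      exact ⟨fun h => ⟨h.2, h.1.2⟩, fun h => ⟨⟨hτ.1.trans h.1, h.2⟩, h.1⟩⟩
    have h2 := intervalIntegral.integral_comp_sub_right
      (fun r => f τ * g r * k (t - τ - r)) τ (a := τ) (b := t)
    simp only [sub_self] at h2
    rw [h1]
    simp only [conv]
    rw [← intervalIntegral.integral_const_mul]
    simp only [← mul_assoc]
    rw [← h2]
    refine intervalIntegral.integral_congr fun s _ => ?_
    simp only [sub_sub_sub_cancel_right]
  rw [e1, e2, hswap]

/-- Continuous functions of the time, with the convolution as the product. -/
def TimeFun : Type := C(ℝ≥0, ℝ)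

instance : AddCommGroup TimeFun := inferInstanceAs (AddCommGroup C(ℝ≥0, ℝ))

instance : Module ℝ TimeFun := inferInstanceAs (Module ℝ C(ℝ≥0, ℝ))

/-- The extension of a function of the time to the whole line. -/
def TimeFun.ext (f : TimeFun) (t : ℝ) : ℝ := (show C(ℝ≥0, ℝ) from f) t.toNNReal

theorem TimeFun.continuous_ext (f : TimeFun) : Continuous f.ext :=
  (show C(ℝ≥0, ℝ) from f).continuous.comp continuous_real_toNNReal

/-- A function that is continuous on `[0, ∞)` as an element of the ring. -/
def TimeFun.of (f : ℝ → ℝ) (hf : ContinuousOn f (Ici 0)) : TimeFun :=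
  (⟨fun t : ℝ≥0 => f t, hf.comp_continuous NNReal.continuous_coe fun t => t.2⟩ : C(ℝ≥0, ℝ))

theorem TimeFun.ext_of (f : ℝ → ℝ) (hf : ContinuousOn f (Ici 0)) :
    EqOn (TimeFun.of f hf).ext f (Ici 0) := fun t ht => by
  change f (t.toNNReal : ℝ) = f t
  rw [Real.coe_toNNReal t ht]

theorem TimeFun.ext_inj {f g : TimeFun} (h : EqOn f.ext g.ext (Ici 0)) : f = g := by
  refine ContinuousMap.ext (f := f) (g := g) fun t => ?_
  have := h t.2
  simpa [TimeFun.ext] using this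

theorem TimeFun.ext_add (f g : TimeFun) : (f + g).ext = fun t => f.ext t + g.ext t := rfl

theorem TimeFun.ext_smul (c : ℝ) (f : TimeFun) : (c • f).ext = fun t => c * f.ext t := rfl

theorem TimeFun.continuous_conv (f g : TimeFun) : Continuous (conv f.ext g.ext) :=
  (ThermoPiezo.continuous_conv (X := Unit) (f := fun _ => f.ext) (g := fun _ => g.ext)
    (f.continuous_ext.comp continuous_snd) (g.continuous_ext.comp continuous_snd)).comp
    (by fun_prop : Continuous fun t : ℝ => ((), t))

instance : Mul TimeFun := ⟨fun f g => TimeFun.of (conv f.ext g.ext) (f.continuous_conv g).continuousOn⟩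

theorem TimeFun.ext_mul (f g : TimeFun) : EqOn (f * g).ext (conv f.ext g.ext) (Ici 0) :=
  TimeFun.ext_of _ _

theorem conv_add_of_continuous {f g k : ℝ → ℝ} (hf : Continuous f) (hg : Continuous g)
    (hk : Continuous k) (t : ℝ) : conv f (fun s => g s + k s) t = conv f g t + conv f k t := by
  unfold conv
  rw [← intervalIntegral.integral_add]
  · simp only [mul_add]
  all_goals exact Continuous.intervalIntegrable (by fun_prop) _ _

theorem conv_const_mul (c : ℝ) (f g : ℝ → ℝ) (t : ℝ) :
    conv (fun s => c * f s) g t = c * conv f g t := by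
  unfold conv
  rw [← intervalIntegral.integral_const_mul]
  simp only [mul_assoc]

theorem TimeFun.mul_comm' (f g : TimeFun) : f * g = g * f :=
  TimeFun.ext_inj fun t ht => by rw [ext_mul f g ht, ext_mul g f ht, conv_comm]

theorem TimeFun.mul_add' (f g k : TimeFun) : f * (g + k) = f * g + f * k :=
  TimeFun.ext_inj fun t ht => by
    rw [ext_mul f _ ht, ext_add, ext_add, conv_add_of_continuous f.continuous_ext g.continuous_ext
      k.continuous_ext]
    beta_reduce
    rw [ext_mul f g ht, ext_mul f k ht]

theorem TimeFun.smul_mul' (c : ℝ) (f g : TimeFun) : (c • f) * g = c • (f * g) :=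
  TimeFun.ext_inj fun t ht => by
    rw [ext_mul _ _ ht, ext_smul, ext_smul, conv_const_mul]
    beta_reduce
    rw [ext_mul f g ht]

theorem TimeFun.mul_assoc' (f g k : TimeFun) : f * g * k = f * (g * k) :=
  TimeFun.ext_inj fun t ht => by
    rw [ext_mul _ _ ht, ext_mul _ _ ht,
      conv_congr (ext_mul f g) (eqOn_refl k.ext _) ht, conv_congr (eqOn_refl f.ext _) (ext_mul g k) ht]
    exact conv_assoc_of_continuous f.continuous_ext g.continuous_ext k.continuous_ext ht

instance : NonUnitalCommRing TimeFun where
  __ := (inferInstance : AddCommGroup TimeFun)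
  mul := (· * ·)
  left_distrib := TimeFun.mul_add'
  right_distrib f g k := by
    rw [TimeFun.mul_comm', TimeFun.mul_add', TimeFun.mul_comm' k f, TimeFun.mul_comm' k g]
  zero_mul f := by
    have := TimeFun.smul_mul' 0 0 f
    simpa using this
  mul_zero f := by
    rw [TimeFun.mul_comm']
    have := TimeFun.smul_mul' 0 0 f
    simpa using this
  mul_assoc := TimeFun.mul_assoc'
  mul_comm := TimeFun.mul_comm'

instance : IsScalarTower ℝ TimeFun TimeFun := ⟨fun c f g => TimeFun.smul_mul' c f g⟩

instance : SMulCommClass ℝ TimeFun TimeFun := ⟨fun c f g => by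
  rw [smul_eq_mul, smul_eq_mul, mul_comm f (c • g), TimeFun.smul_mul', mul_comm f g]⟩

/-- The convolution ring of continuous functions of the time, with a unit adjoined. -/
abbrev ConvRing : Type := Unitization ℝ TimeFun

open Classical in
/-- A function that is continuous on `[0, ∞)` as an element of the convolution ring. -/
def tf (f : ℝ → ℝ) : ConvRing :=
  -- The default value lets `tf_congr` hold with no continuity assumption.
  if hf : ContinuousOn f (Ici 0) then (TimeFun.of f hf : ConvRing) else 0

theorem tf_of {f : ℝ → ℝ} (hf : ContinuousOn f (Ici 0)) : tf f = (TimeFun.of f hf : ConvRing) :=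
  dif_pos hf

/-- This is the way back from a ring identity to an equality of functions for all nonnegative times.
-/
theorem tf_inj {f g : ℝ → ℝ} (hf : ContinuousOn f (Ici 0)) (hg : ContinuousOn g (Ici 0))
    (h : tf f = tf g) : EqOn f g (Ici 0) := by
  rw [tf_of hf, tf_of hg] at h
  have := Unitization.inr_injective h
  intro t ht
  rw [← TimeFun.ext_of f hf ht, ← TimeFun.ext_of g hg ht, this]

theorem tf_congr {f g : ℝ → ℝ} (h : EqOn f g (Ici 0)) : tf f = tf g := by
  by_cases hf : ContinuousOn f (Ici 0)
  · have hg : ContinuousOn g (Ici 0) := hf.congr h.symm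
    rw [tf_of hf, tf_of hg]
    congr 1
    refine TimeFun.ext_inj fun t ht => ?_
    rw [TimeFun.ext_of f hf ht, TimeFun.ext_of g hg ht, h ht]
  · have hg : ¬ContinuousOn g (Ici 0) := fun hg => hf (hg.congr h)
    rw [tf, tf, dif_neg hf, dif_neg hg]

theorem tf_add {f g : ℝ → ℝ} (hf : ContinuousOn f (Ici 0)) (hg : ContinuousOn g (Ici 0)) :
    tf (fun t => f t + g t) = tf f + tf g := by
  rw [tf_of hf, tf_of hg, tf_of (f := fun t => f t + g t) (hf.add hg), ← Unitization.inr_add]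
  rfl

theorem tf_const_mul (c : ℝ) {f : ℝ → ℝ} (hf : ContinuousOn f (Ici 0)) :
    tf (fun t => c * f t) = algebraMap ℝ ConvRing c * tf f := by
  rw [← Algebra.smul_def, tf_of hf, tf_of (f := fun t => c * f t) (continuousOn_const.mul hf), ← Unitization.inr_smul]
  rfl

theorem continuousOn_conv {f g : ℝ → ℝ} (hf : ContinuousOn f (Ici 0))
    (hg : ContinuousOn g (Ici 0)) : ContinuousOn (conv f g) (Ici 0) :=
  ((TimeFun.of f hf).continuous_conv (TimeFun.of g hg)).continuousOn.congr
    (conv_congr (TimeFun.ext_of f hf) (TimeFun.ext_of g hg)).symm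

theorem tf_conv {f g : ℝ → ℝ} (hf : ContinuousOn f (Ici 0)) (hg : ContinuousOn g (Ici 0)) :
    tf (conv f g) = tf f * tf g := by
  rw [tf_of hf, tf_of hg, tf_of (continuousOn_conv hf hg), ← Unitization.inr_mul]
  congr 1
  refine TimeFun.ext_inj fun t ht => ?_
  rw [TimeFun.ext_of _ _ ht, TimeFun.ext_mul _ _ ht]
  exact (conv_congr (TimeFun.ext_of f hf) (TimeFun.ext_of g hg) ht).symm

theorem tf_neg {f : ℝ → ℝ} (hf : ContinuousOn f (Ici 0)) : tf (fun t => -f t) = -tf f := by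
  have := tf_const_mul (-1) hf
  simpa using this

theorem tf_sub {f g : ℝ → ℝ} (hf : ContinuousOn f (Ici 0)) (hg : ContinuousOn g (Ici 0)) :
    tf (fun t => f t - g t) = tf f - tf g := by
  have := tf_add (g := fun t => -g t) hf hg.neg
  simp only [sub_eq_add_neg]
  rw [← tf_neg hg, ← this]

theorem tf_zero : tf (fun _ => 0) = 0 := by
  have := tf_const_mul 0 (f := fun _ => 0) continuousOn_const
  simpa using this

theorem tf_sum {ι : Type*} (s : Finset ι) {f : ι → ℝ → ℝ}
    (hf : ∀ i ∈ s, ContinuousOn (f i) (Ici 0)) :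
    tf (fun t => ∑ i ∈ s, f i t) = ∑ i ∈ s, tf (f i) := by
  classical
  induction s using Finset.induction_on with
  | empty => simpa using tf_zero
  | insert a s ha ih =>
    simp only [Finset.sum_insert ha]
    rw [tf_add (hf a (Finset.mem_insert_self a s))
      (continuousOn_finsetSum _ fun i hi => hf i (Finset.mem_insert_of_mem hi)),
      ih fun i hi => hf i (Finset.mem_insert_of_mem hi)]

theorem conv_lOne (f : ℝ → ℝ) (t : ℝ) : conv lOne f t = ∫ s in (0 : ℝ)..t, f s := by
  rw [conv_comm]
  simp [conv, lOne]

theorem continuousOn_lOne : ContinuousOn lOne (Ici 0) := continuousOn_const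

theorem continuousOn_xi : ContinuousOn xi (Ici 0) := continuousOn_id

theorem tf_xi : tf xi = tf lOne * tf lOne := by
  rw [← tf_conv continuousOn_lOne continuousOn_lOne]
  refine tf_congr fun t _ => ?_
  rw [conv_lOne]
  simp [xi, lOne]

theorem tf_const (c : ℝ) : tf (fun _ => c) = algebraMap ℝ ConvRing c * tf lOne := by
  rw [← tf_const_mul c continuousOn_lOne]
  simp [lOne]

/-- The fundamental theorem of calculus in the convolution ring. -/
theorem tf_lOne_mul_derivWithin {f : ℝ → ℝ} (hf : DifferentiableOn ℝ f (Ici 0))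
    (hf' : ContinuousOn (derivWithin f (Ici 0)) (Ici 0)) :
    tf lOne * tf (derivWithin f (Ici 0)) = tf f - algebraMap ℝ ConvRing (f 0) * tf lOne := by
  rw [← tf_conv continuousOn_lOne hf', ← tf_const, ← tf_sub hf.continuousOn continuousOn_const]
  refine tf_congr fun t ht => ?_
  have ht : 0 ≤ t := ht
  rw [conv_lOne, intervalIntegral.integral_eq_sub_of_hasDeriv_right_of_le ht
    (hf.continuousOn.mono Icc_subset_Ici_self) (f' := derivWithin f (Ici 0))]
  · intro s hs
    exact (hf s hs.1.le).hasDerivWithinAt.mono (Ioi_subset_Ici hs.1.le)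
  · exact (hf'.mono (by rw [uIcc_of_le ht]; exact Icc_subset_Ici_self)).intervalIntegrable

/-! ### Continuous time-dependent fields -/

section

variable {X Y : Set E3} {f g : Field}

theorem ContOn.mono (hf : ContOn X f) (h : Y ⊆ X) : ContOn Y f :=
  ContinuousOn.mono hf (prod_mono_left h)

theorem ContOn.congr (hf : ContOn X f) (h : ∀ x ∈ X, ∀ t, 0 ≤ t → g x t = f x t) : ContOn X g :=
  ContinuousOn.congr hf fun p hp => h p.1 hp.1 p.2 hp.2

theorem ContOn.add (hf : ContOn X f) (hg : ContOn X g) : ContOn X fun x t => f x t + g x t :=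
  ContinuousOn.add hf hg

theorem ContOn.sub (hf : ContOn X f) (hg : ContOn X g) : ContOn X fun x t => f x t - g x t :=
  ContinuousOn.sub hf hg

theorem ContOn.neg (hf : ContOn X f) : ContOn X fun x t => -f x t :=
  ContinuousOn.neg hf

theorem ContOn.mul (hf : ContOn X f) (hg : ContOn X g) : ContOn X fun x t => f x t * g x t :=
  ContinuousOn.mul hf hg

theorem ContOn.const_mul (c : ℝ) (hf : ContOn X f) : ContOn X fun x t => c * f x t :=
  ContinuousOn.mul continuousOn_const hf

theorem ContOn.of_space {a : E3 → ℝ} (ha : ContinuousOn a X) : ContOn X fun x _ => a x :=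
  ContinuousOn.comp ha continuousOn_fst fun _ hp => hp.1

theorem ContOn.of_time {a : ℝ → ℝ} (ha : ContinuousOn a (Ici 0)) : ContOn X fun _ => a :=
  ContinuousOn.comp ha continuousOn_snd fun _ hp => hp.2

theorem ContOn.sum {ι : Type*} {s : Finset ι} {f : ι → Field} (hf : ∀ i ∈ s, ContOn X (f i)) :
    ContOn X fun x t => ∑ i ∈ s, f i x t :=
  continuousOn_finsetSum _ hf

theorem ContOn.time (hf : ContOn X f) {x : E3} (hx : x ∈ X) : ContinuousOn (f x) (Ici 0) :=
  ContinuousOn.comp (f := fun t : ℝ => (x, t)) hf (by fun_prop) fun _ ht => ⟨hx, ht⟩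

theorem ContOn.space (hf : ContOn X f) {t : ℝ} (ht : 0 ≤ t) : ContinuousOn (fun x => f x t) X :=
  ContinuousOn.comp (f := fun x : E3 => (x, t)) hf (by fun_prop) fun _ hx => ⟨hx, ht⟩

/-- Freezing a field at its initial value for negative times gives continuity on the whole line,
which the parametric integral behind `continuous_conv` needs. -/
theorem ContOn.continuous_max (hf : ContOn X f) :
    Continuous fun p : X × ℝ => f p.1 (max p.2 0) :=
  ContinuousOn.comp_continuous (f := fun p : X × ℝ => ((p.1 : E3), max p.2 0)) hf (by fun_prop)
    fun p => ⟨p.1.2, mem_Ici.2 (le_max_right _ _)⟩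

theorem ContOn.conv (hf : ContOn X f) (hg : ContOn X g) :
    ContOn X fun x => conv (f x) (g x) := by
  have h := continuous_conv (X := X) (f := fun x t => f x (max t 0)) (g := fun x t => g x (max t 0))
    hf.continuous_max hg.continuous_max
  rw [ContOn, continuousOn_iff_continuous_domRestrict]
  refine (h.comp (f := fun p : (X ×ˢ Ici (0 : ℝ) : Set (E3 × ℝ)) =>
    ((⟨p.1.1, p.2.1⟩, p.1.2) : X × ℝ)) (by fun_prop)).congr fun p => ?_
  exact conv_congr (f := fun t => f p.1.1 (max t 0)) (g := fun t => g p.1.1 (max t 0))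
    (fun t ht => by simp only [max_eq_left (mem_Ici.1 ht)])
    (fun t ht => by simp only [max_eq_left (mem_Ici.1 ht)]) p.2.2

theorem ContOn.continuousOn_conv_integrand (hf : ContOn X f) (hg : ContOn X g) (t : ℝ) :
    ContinuousOn (fun p : E3 × ℝ => f p.1 p.2 * g p.1 (t - p.2)) (X ×ˢ Icc 0 t) :=
  (ContinuousOn.mono hf (prod_mono_right Icc_subset_Ici_self)).mul
    (ContinuousOn.comp (f := fun p : E3 × ℝ => (p.1, t - p.2)) hg (by fun_prop)
      fun p hp => ⟨hp.1, sub_nonneg.2 hp.2.2⟩)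

end

/-! ### Integration of time-dependent fields over a compact set -/

section

variable {X : Set E3} {ν : Measure E3} [IsFiniteMeasure ν]

/-- The condition on `ν` says that it is concentrated on the compact set `X`, where continuity gives
integrability. It covers both surface area on the boundary and volume on the open region, with `X`
the closed region in the latter case. -/
theorem integral_intervalIntegral_comm (hX : IsCompact X) (hν : ν.restrict X = ν) {K : E3 × ℝ → ℝ}
    {t : ℝ} (ht : 0 ≤ t) (hK : ContinuousOn K (X ×ˢ Icc 0 t)) :
    ∫ x, (∫ τ in (0 : ℝ)..t, K (x, τ)) ∂ν = ∫ τ in (0 : ℝ)..t, ∫ x, K (x, τ) ∂ν := by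
  have h1 : IntegrableOn K (X ×ˢ Icc 0 t) (ν.prod volume) :=
    hK.integrableOn_compact (hX.prod isCompact_Icc)
  have h2 : Integrable K (ν.prod (volume.restrict (Icc 0 t))) := by
    rw [IntegrableOn, ← Measure.prod_restrict, hν] at h1
    exact h1
  simp only [intervalIntegral.integral_of_le ht, ← integral_Icc_eq_integral_Ioc]
  exact integral_integral_swap (f := fun x τ => K (x, τ)) h2

theorem integrable_of_continuousOn (hX : IsCompact X) (hν : ν.restrict X = ν) {f : E3 → ℝ}
    (hf : ContinuousOn f X) : Integrable f ν := by
  have := hf.integrableOn_compact (μ := ν) hX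
  rwa [IntegrableOn, hν] at this

theorem conv_integral (hX : IsCompact X) (hν : ν.restrict X = ν) {c : ℝ → ℝ} {k : Field}
    (hc : ContinuousOn c (Ici 0)) (hk : ContOn X k) {t : ℝ} (ht : 0 ≤ t) :
    conv c (fun s => ∫ x, k x s ∂ν) t = ∫ x, conv c (k x) t ∂ν := by
  unfold conv
  rw [integral_intervalIntegral_comm (K := fun p => c p.2 * k p.1 (t - p.2)) hX hν ht
    ((ContOn.of_time hc).continuousOn_conv_integrand hk t)]
  simp only [integral_const_mul]

/-- `G` is the integral of the continuous function `K` over the time interval `[0, t]`. -/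
def IsTimeIntegral (X : Set E3) (t : ℝ) (G : E3 → ℝ) (K : E3 → ℝ → ℝ) : Prop :=
  ContinuousOn (fun p : E3 × ℝ => K p.1 p.2) (X ×ˢ Icc 0 t) ∧
    ∀ x ∈ X, G x = ∫ τ in (0 : ℝ)..t, K x τ

theorem ContOn.isTimeIntegral_conv {f g : Field} (hf : ContOn X f) (hg : ContOn X g) (t : ℝ) :
    IsTimeIntegral X t (fun x => ThermoPiezo.conv (f x) (g x) t) fun x τ => f x τ * g x (t - τ) :=
  ⟨hf.continuousOn_conv_integrand hg t, fun _ _ => rfl⟩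

theorem IsTimeIntegral.sum {ι : Type*} {s : Finset ι} {G : ι → E3 → ℝ} {K : ι → E3 → ℝ → ℝ} {t : ℝ}
    (ht : 0 ≤ t) (h : ∀ i ∈ s, IsTimeIntegral X t (G i) (K i)) :
    IsTimeIntegral X t (fun x => ∑ i ∈ s, G i x) fun x τ => ∑ i ∈ s, K i x τ := by
  refine ⟨continuousOn_finsetSum _ fun i hi => (h i hi).1, fun x hx => ?_⟩
  rw [intervalIntegral.integral_finsetSum]
  · exact Finset.sum_congr rfl fun i hi => (h i hi).2 x hx
  · intro i hi
    refine ContinuousOn.intervalIntegrable ?_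
    rw [uIcc_of_le ht]
    exact ContinuousOn.comp (f := fun τ : ℝ => (x, τ)) (h i hi).1 (by fun_prop) fun τ hτ => ⟨hx, hτ⟩

theorem IsTimeIntegral.add {G G' : E3 → ℝ} {K K' : E3 → ℝ → ℝ} {t : ℝ} (ht : 0 ≤ t)
    (h : IsTimeIntegral X t G K) (h' : IsTimeIntegral X t G' K') :
    IsTimeIntegral X t (fun x => G x + G' x) fun x τ => K x τ + K' x τ := by
  have := IsTimeIntegral.sum (X := X) (s := Finset.univ) (G := ![G, G']) (K := ![K, K']) ht
    (by simp [Fin.forall_fin_two, h, h'])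
  simpa using this

/-- By Fubini, an identity between space integrals at fixed times `τ` and `t - τ` passes to
convolutions. All integrations by parts for convolutions are obtained this way. -/
theorem IsTimeIntegral.integral_eq {G : E3 → ℝ} {K : E3 → ℝ → ℝ} {t : ℝ} (hX : IsCompact X)
    (hν : ν.restrict X = ν) (ht : 0 ≤ t) (h : IsTimeIntegral X t G K) :
    ∫ x, G x ∂ν = ∫ τ in (0 : ℝ)..t, ∫ x, K x τ ∂ν := by
  have hae : ∀ᵐ x ∂ν, x ∈ X := by
    rw [← hν]
    exact ae_restrict_mem hX.isClosed.measurableSet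
  rw [← integral_intervalIntegral_comm (K := fun p => K p.1 p.2) hX hν ht h.1]
  exact integral_congr_ae (hae.mono h.2)

end

theorem Body.area_restrict (Ω : Body) :
    (μHE[2].restrict Ω.bdry : Measure E3).restrict Ω.bdry = μHE[2].restrict Ω.bdry := by
  rw [Measure.restrict_restrict Ω.isCompact_bdry.isClosed.measurableSet, inter_self]

theorem Body.volume_restrict (Ω : Body) :
    (volume.restrict Ω.region : Measure E3).restrict Ω.closed = volume.restrict Ω.region := by
  rw [Measure.restrict_restrict Ω.isCompact_closed.isClosed.measurableSet,
    inter_eq_self_of_subset_right Ω.region_subset_closed]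

/-! ### Function classes -/

section

variable {Ω : Body} {M N : ℕ} {f : Field}

theorem IsOfClass.isC (hf : IsOfClass Ω M N f) {n : ℕ} (hn : n ≤ N) {k : ℕ} {l : List (Fin 3)}
    (hl : l.length + k ≤ M) (hl' : l.length + k + n ≤ max M N) {t : ℝ} (ht : 0 ≤ t) :
    Ω.IsC k fun y => pdIter Ω l (dt^[n] f) y t := by
  induction k generalizing l with
  | zero =>
    exact contDiffOn_zero.2 (ContOn.space (hf.continuous n hn l hl hl') ht)
  | succ k ih =>
    refine Body.IsC.of_sp (hf.space_differentiable n hn l (by omega) (by omega) t ht) fun i => ?_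
    exact ih (l := i :: l) (by simp only [List.length_cons]; omega)
      (by simp only [List.length_cons]; omega)

theorem IsOfClass.contOn (hf : IsOfClass Ω M N f) {n : ℕ} (hn : n ≤ N) {l : List (Fin 3)}
    (hl : l.length ≤ M) (hl' : l.length + n ≤ max M N) : ContOn Ω.closed (pdIter Ω l (dt^[n] f)) :=
  hf.continuous n hn l hl hl'

theorem IsOfClass.tf_lOne_mul_dt (hf : IsOfClass Ω M N f) {n : ℕ} (hn : n < N) {x : E3}
    (hx : x ∈ Ω.closed) : tf lOne * tf (dt^[n + 1] f x)
      = tf (dt^[n] f x) - algebraMap ℝ ConvRing (dt^[n] f x 0) * tf lOne := by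
  have h := hf.contOn (n := n + 1) hn (l := []) (by simp) (by simp; omega)
  have h1 : dt^[n + 1] f = dt (dt^[n] f) := Function.iterate_succ_apply' dt n f
  have h2 : ContinuousOn (derivWithin (dt^[n] f x) (Ici 0)) (Ici 0) := by
    have h := h.time hx
    change ContinuousOn (dt^[n + 1] f x) _ at h
    rw [h1] at h
    exact h
  rw [h1]
  exact tf_lOne_mul_derivWithin (hf.time_differentiable n hn x hx) h2

theorem hasDerivAt_line {f : E3 → ℝ} (hf : Ω.IsC 1 f) {x : E3} (j : Fin 3) {h : ℝ}
    (hx : x + h • EuclideanSpace.single j (1 : ℝ) ∈ Ω.region) :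
    HasDerivAt (fun h : ℝ => f (x + h • EuclideanSpace.single j (1 : ℝ)))
      (sp Ω j f (x + h • EuclideanSpace.single j (1 : ℝ))) h := by
  have h1 : HasFDerivAt f (fderivWithin ℝ f Ω.closed (x + h • EuclideanSpace.single j (1 : ℝ)))
      (x + h • EuclideanSpace.single j (1 : ℝ)) :=
    (Body.IsC.differentiableWithinAt (n := 0) hf
      (Ω.region_subset_closed hx)).hasFDerivWithinAt.hasFDerivAt (Ω.closed_mem_nhds hx)
  have h2 : HasDerivAt (fun h : ℝ => x + h • (EuclideanSpace.single j (1 : ℝ) : E3))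
      (EuclideanSpace.single j (1 : ℝ)) h := by
    simpa using ((hasDerivAt_id h).smul_const (EuclideanSpace.single j (1 : ℝ) : E3)).const_add x
  exact h1.comp_hasDerivAt h h2

/-- The class provides space derivatives of time derivatives, not the reverse. Rather than commuting
them, one differentiates `f(t) - f(0) = ∫ ḟ` in space under the integral sign. -/
theorem IsOfClass.tf_lOne_mul_pd_dt (hf : IsOfClass Ω M N f) (hM : 1 ≤ M) (hN : 1 ≤ N)
    (hMN : 2 ≤ max M N) {x : E3} (hx : x ∈ Ω.region) (j : Fin 3) :
    tf lOne * tf (pd Ω j (dt f) x)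
      = tf (pd Ω j f x) - algebraMap ℝ ConvRing (pd Ω j f x 0) * tf lOne := by
  have hxc := Ω.region_subset_closed hx
  have cd : ContOn Ω.closed (dt f) := hf.contOn (n := 1) hN (l := []) (by simp) (by simp; omega)
  have cp : ContOn Ω.closed (pd Ω j f) :=
    hf.contOn (n := 0) (Nat.zero_le _) (l := [j]) (by simpa) (by simp; omega)
  have cpd : ContOn Ω.closed (pd Ω j (dt f)) :=
    hf.contOn (n := 1) hN (l := [j]) (by simpa) (by simp; omega)
  have sf : ∀ t, 0 ≤ t → Ω.IsC 1 fun y => f y t := fun t ht =>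
    hf.isC (n := 0) (Nat.zero_le _) (k := 1) (l := []) (by simpa) (by simp; omega) ht
  have sd : ∀ t, 0 ≤ t → Ω.IsC 1 fun y => dt f y t := fun t ht =>
    hf.isC (n := 1) hN (k := 1) (l := []) (by simpa) (by simp; omega) ht
  rw [← tf_conv continuousOn_lOne (cpd.time hxc), ← tf_const,
    ← tf_sub (cp.time hxc) continuousOn_const]
  refine tf_congr fun t ht => ?_
  have ht : 0 ≤ t := ht
  rw [conv_lOne]
  set γ : ℝ → E3 := fun h => x + h • EuclideanSpace.single j (1 : ℝ) with hγ
  have γ0 : γ 0 = x := by simp [hγ]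
  have hγc : Continuous γ := by fun_prop
  have hs : γ ⁻¹' Ω.region ∈ 𝓝 (0 : ℝ) :=
    hγc.continuousAt.preimage_mem_nhds (by rw [γ0]; exact Ω.region_isOpen.mem_nhds hx)
  obtain ⟨C, hC⟩ := (Ω.isCompact_closed.prod (isCompact_Icc (a := (0 : ℝ)) (b := t))).exists_bound_of_continuousOn
    (ContinuousOn.mono cpd (prod_mono_right Icc_subset_Ici_self))
  have hio : uIoc 0 t ⊆ Ici 0 := by
    rw [uIoc_of_le ht]
    exact Ioc_subset_Ioi_self.trans Ioi_subset_Ici_self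
  have hic : uIcc 0 t ⊆ Ici 0 := by
    rw [uIcc_of_le ht]
    exact Icc_subset_Ici_self
  -- The time integral is differentiated along the coordinate line through `x`. The dominating
  -- constant comes from continuity of the mixed derivative on the compact set `closure B × [0, t]`.
  have key := (intervalIntegral.hasDerivAt_integral_of_dominated_loc_of_deriv_le (μ := volume)
    (F := fun h s => dt f (γ h) s) (F' := fun h s => pd Ω j (dt f) (γ h) s) (x₀ := 0) (a := 0)
    (b := t) (bound := fun _ => C) hs
    (Filter.eventually_of_mem hs fun h hh => ((cd.time (Ω.region_subset_closed hh)).mono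
      hio).aestronglyMeasurable measurableSet_uIoc)
    ((cd.time (by rwa [γ0])).mono hic).intervalIntegrable
    (((cpd.time (by rwa [γ0])).mono hio).aestronglyMeasurable measurableSet_uIoc)
    (ae_of_all _ fun s hs' h hh => hC (γ h, s) ⟨Ω.region_subset_closed hh, by
      rw [uIoc_of_le ht] at hs'
      exact Ioc_subset_Icc_self hs'⟩)
    intervalIntegrable_const
    (ae_of_all _ fun s hs' h hh => hasDerivAt_line (sd s (hio hs')) j hh)).2
  have hd : ∀ s, 0 ≤ s → HasDerivAt (fun h => f (γ h) s) (pd Ω j f x s) 0 := fun s hs' => by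
    have := hasDerivAt_line (x := x) (sf s hs') j (h := 0) (by simpa using hx)
    have e : x + (0 : ℝ) • EuclideanSpace.single j (1 : ℝ) = x := γ0
    rw [e] at this
    exact this
  have key2 := (hd t ht).sub (hd 0 le_rfl)
  have heq : (fun h => ∫ s in (0 : ℝ)..t, dt f (γ h) s) =ᶠ[𝓝 0]
      (fun h => f (γ h) t) - fun h => f (γ h) 0 := by
    filter_upwards [hs] with h hh
    have hc := Ω.region_subset_closed hh
    have hdt := hf.time_differentiable 0 hN (γ h) hc
    change ∫ s in (0 : ℝ)..t, dt f (γ h) s = f (γ h) t - f (γ h) 0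
    refine intervalIntegral.integral_eq_sub_of_hasDeriv_right_of_le ht
      (hdt.continuousOn.mono Icc_subset_Ici_self) (fun s hs' => ?_)
      ((cd.time hc).mono hic).intervalIntegrable
    exact (hdt s hs'.1.le).hasDerivWithinAt.mono (Ioi_subset_Ici hs'.1.le)
  have := key.unique (key2.congr_of_eventuallyEq heq)
  rw [γ0] at this
  exact this

end

/-! ### Integration by parts for convolutions -/

/-- The traction of a stress `T` and a double stress `m`. -/
def tract (Ω : Body) (T : Fin 3 → Field) (m : Fin 3 → Fin 3 → Field) : Field := fun x t =>
  (∑ j, (T j x t - ∑ k, pd Ω k (m k j) x t) * Ω.normal j x)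
    - (∑ j, ∑ k, surfDeriv Ω j (fun y s => m k j y s * Ω.normal k y) x t)
    + divNormal Ω x * ∑ k, ∑ j, m k j x t * Ω.normal k x * Ω.normal j x

/-- The double traction of a double stress `m`. -/
def doubleTract (Ω : Body) (m : Fin 3 → Fin 3 → Field) : Field := fun x t =>
  ∑ k, ∑ j, m k j x t * Ω.normal k x * Ω.normal j x

/-- The internal force of a stress `T` and a double stress `m`. -/
def innerForce (Ω : Body) (T : Fin 3 → Field) (m : Fin 3 → Fin 3 → Field) : Field := fun x t =>
  (∑ j, pd Ω j (T j) x t) - ∑ k, ∑ j, pd Ω j (pd Ω k (m k j)) x t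

section

variable {Ω : Body} {M N : ℕ} {f : Field}

theorem IsOfClass.contOn_self (hf : IsOfClass Ω M N f) : ContOn Ω.closed f :=
  hf.contOn (n := 0) (Nat.zero_le _) (l := []) (by simp) (by simp)

theorem IsOfClass.contOn_pd (hf : IsOfClass Ω M N f) (hM : 1 ≤ M) (i : Fin 3) :
    ContOn Ω.closed (pd Ω i f) :=
  hf.contOn (n := 0) (Nat.zero_le _) (l := [i]) (by simpa) (by simp; omega)

theorem IsOfClass.contOn_pd_pd (hf : IsOfClass Ω M N f) (hM : 2 ≤ M) (i j : Fin 3) :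
    ContOn Ω.closed (pd Ω i (pd Ω j f)) :=
  hf.contOn (n := 0) (Nat.zero_le _) (l := [i, j]) (by simpa) (by simp; omega)

theorem IsOfClass.isC_self (hf : IsOfClass Ω M N f) {k : ℕ} (hk : k ≤ M) {t : ℝ} (ht : 0 ≤ t) :
    Ω.IsC k fun y => f y t :=
  hf.isC (n := 0) (Nat.zero_le _) (l := []) (by simpa) (by simp; omega) ht

theorem contOn_normal (k : Fin 3) : ContOn Ω.bdry fun x _ => Ω.normal k x :=
  ContOn.of_space (Ω.continuousOn_normal k)

theorem contOn_normalDeriv (hf : IsOfClass Ω M N f) (hM : 1 ≤ M) :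
    ContOn Ω.bdry (normalDeriv Ω f) :=
  ContOn.sum fun i _ => (contOn_normal i).mul ((hf.contOn_pd hM i).mono Ω.bdry_subset_closed)

/-- The normal may be singular inside the body. It is replaced by its smooth extension, which agrees
with it near each boundary point and so has the same derivatives there. -/
theorem contOn_surfDeriv_mul_normal (hf : IsOfClass Ω M N f) (hM : 1 ≤ M) (j k : Fin 3) :
    ContOn Ω.bdry (surfDeriv Ω j fun y s => f y s * Ω.normal k y) := by
  obtain ⟨N, hN, hNn⟩ := Ω.exists_smooth_normal
  have hNC : Ω.IsC 1 (N k) := (ContDiff.of_le (hN k) (by exact_mod_cast le_top)).contDiffOn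
  refine ContOn.sum fun l _ => ((ContOn.of_space (continuousOn_const (c := if j = l then (1 : ℝ) else 0))).sub
    ((contOn_normal j).mul (contOn_normal l))).mul ?_
  have h : ContOn Ω.bdry fun x t => pd Ω l f x t * N k x + f x t * sp Ω l (N k) x :=
    ContOn.mono (((hf.contOn_pd hM l).mul (ContOn.of_space hNC.continuousOn)).add
      (hf.contOn_self.mul (ContOn.of_space (hNC.sp l).continuousOn))) Ω.bdry_subset_closed
  refine h.congr fun x hx t ht => ?_
  have hxc := Ω.bdry_subset_closed hx
  refine Eq.trans ?_ (sp_mul hxc (Body.IsC.differentiableWithinAt (n := 0) (hf.isC_self hM ht) hxc)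
    (Body.IsC.differentiableWithinAt (n := 0) hNC hxc) l)
  exact sp_congr_nhds ((hNn x hx k).mono fun y hy => by simp only [hy]) l

variable {T : Fin 3 → Field} {m : Fin 3 → Fin 3 → Field} {w : Field}

theorem contOn_doubleTract (hm : ∀ k j, IsOfClass Ω 2 0 (m k j)) :
    ContOn Ω.bdry (doubleTract Ω m) :=
  ContOn.sum fun k _ => ContOn.sum fun j _ =>
    (((hm k j).contOn_self.mono Ω.bdry_subset_closed).mul (contOn_normal k)).mul (contOn_normal j)

theorem contOn_tract (hT : ∀ j, IsOfClass Ω 1 0 (T j)) (hm : ∀ k j, IsOfClass Ω 2 0 (m k j)) :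
    ContOn Ω.bdry (tract Ω T m) :=
  ((ContOn.sum fun j _ => (((hT j).contOn_self.mono Ω.bdry_subset_closed).sub
    (ContOn.sum fun k _ => ((hm k j).contOn_pd one_le_two k).mono Ω.bdry_subset_closed)).mul
      (contOn_normal j)).sub
    (ContOn.sum fun j _ => ContOn.sum fun k _ =>
      contOn_surfDeriv_mul_normal (hm k j) one_le_two j k)).add
    ((ContOn.of_space Ω.continuousOn_divNormal).mul (contOn_doubleTract hm))

theorem contOn_innerForce (hT : ∀ j, IsOfClass Ω 1 0 (T j)) (hm : ∀ k j, IsOfClass Ω 2 0 (m k j)) :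
    ContOn Ω.closed (innerForce Ω T m) :=
  (ContOn.sum fun j _ => (hT j).contOn_pd le_rfl j).sub
    (ContOn.sum fun k _ => ContOn.sum fun j _ => (hm k j).contOn_pd_pd le_rfl j k)

/-- The power of the tractions as a power of the stresses. -/
theorem integral_conv_tract (hT : ∀ j, IsOfClass Ω 1 0 (T j))
    (hm : ∀ k j, IsOfClass Ω 2 0 (m k j)) (hw : IsOfClass Ω M N w) (hM : 2 ≤ M) {t : ℝ}
    (ht : 0 ≤ t) :
    ∫ x in Ω.bdry, (conv (tract Ω T m x) (w x) t
        + conv (doubleTract Ω m x) (normalDeriv Ω w x) t) ∂μHE[2]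
      = ∫ x in Ω.region, ((∑ j, conv (T j x) (pd Ω j w x) t)
        + (∑ k, ∑ j, conv (m k j x) (pd Ω j (pd Ω k w) x) t)
        + conv (innerForce Ω T m x) (w x) t) := by
  have h1 := (((contOn_tract hT hm).isTimeIntegral_conv
    (hw.contOn_self.mono Ω.bdry_subset_closed) t).add ht
    ((contOn_doubleTract hm).isTimeIntegral_conv (contOn_normalDeriv hw (by omega)) t)).integral_eq
    Ω.isCompact_bdry Ω.area_restrict ht
  have h2 := (((IsTimeIntegral.sum (s := Finset.univ) ht fun j _ =>
      (hT j).contOn_self.isTimeIntegral_conv (hw.contOn_pd (by omega) j) t).add ht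
    (IsTimeIntegral.sum (s := Finset.univ) ht fun k _ =>
      IsTimeIntegral.sum (s := Finset.univ) ht fun j _ =>
      (hm k j).contOn_self.isTimeIntegral_conv (hw.contOn_pd_pd hM j k) t)).add ht
    ((contOn_innerForce hT hm).isTimeIntegral_conv hw.contOn_self t)).integral_eq
    Ω.isCompact_closed Ω.volume_restrict ht
  rw [h1, h2]
  refine intervalIntegral.integral_congr fun τ hτ => ?_
  rw [uIcc_of_le ht] at hτ
  exact integral_second_order (fun j => (hT j).isC_self le_rfl hτ.1)
    (fun k j => (hm k j).isC_self le_rfl hτ.1) (hw.isC_self hM (sub_nonneg.2 hτ.2))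

/-- The power of a flux through the boundary surface. -/
theorem integral_conv_flux {q : Fin 3 → Field} (hq : ∀ j, IsOfClass Ω 1 0 (q j)) {a : Field}
    (ha : ContOn Ω.closed a) (ha' : ∀ j, ContOn Ω.closed (pd Ω j a))
    (haC : ∀ t, 0 ≤ t → Ω.IsC 1 fun y => a y t) {t : ℝ} (ht : 0 ≤ t) :
    ∫ x in Ω.bdry, conv (fun s => ∑ i, q i x s * Ω.normal i x) (a x) t ∂μHE[2]
      = ∫ x in Ω.region, ∑ j, (conv (pd Ω j (q j) x) (a x) t + conv (q j x) (pd Ω j a x) t) := by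
  have cf : ContOn Ω.bdry fun x s => ∑ i, q i x s * Ω.normal i x :=
    ContOn.sum fun i _ => ((hq i).contOn_self.mono Ω.bdry_subset_closed).mul (contOn_normal i)
  have h1 := (cf.isTimeIntegral_conv (ha.mono Ω.bdry_subset_closed) t).integral_eq
    Ω.isCompact_bdry Ω.area_restrict ht
  have h2 := (IsTimeIntegral.sum (s := Finset.univ) ht fun j _ =>
    (((hq j).contOn_pd le_rfl j).isTimeIntegral_conv ha t).add ht
      ((hq j).contOn_self.isTimeIntegral_conv (ha' j) t)).integral_eq
    Ω.isCompact_closed Ω.volume_restrict ht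
  rw [h1, h2]
  refine intervalIntegral.integral_congr fun τ hτ => ?_
  rw [uIcc_of_le ht] at hτ
  have hs := sub_nonneg.2 hτ.2
  have hC : ∀ i, Ω.IsC 1 fun y => q i y τ * a y (t - τ) := fun i =>
    ((hq i).isC_self le_rfl hτ.1).mul (haC _ hs)
  have key := integral_div hC
  have e : ∀ x ∈ Ω.region, ∑ i, sp Ω i (fun y => q i y τ * a y (t - τ)) x
      = ∑ j, (pd Ω j (q j) x τ * a x (t - τ) + q j x τ * pd Ω j a x (t - τ)) := fun x hx =>
    Finset.sum_congr rfl fun i _ => sp_mul (Ω.region_subset_closed hx)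
      (Body.IsC.differentiableWithinAt (n := 0) ((hq i).isC_self le_rfl hτ.1)
        (Ω.region_subset_closed hx))
      (Body.IsC.differentiableWithinAt (n := 0) (haC _ hs) (Ω.region_subset_closed hx)) i
  rw [setIntegral_congr_fun Ω.region_isOpen.measurableSet e] at key
  rw [key]
  refine integral_congr_ae (ae_of_all _ fun x => ?_)
  simp only [Finset.sum_mul]
  exact Finset.sum_congr rfl fun i _ => by ring

end

/-! ### Passage to the convolution ring -/

/-- `f` is continuous on `[0, ∞)` and represents the element `r` of the convolution ring. -/
def Rep (f : ℝ → ℝ) (r : ConvRing) : Prop := ContinuousOn f (Ici 0) ∧ tf f = r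

/-- The embedding of the constants into the convolution ring. -/
abbrev cst : ℝ →+* ConvRing := algebraMap ℝ ConvRing

section

variable {f g : ℝ → ℝ} {r s : ConvRing}

theorem rep_tf (hf : ContinuousOn f (Ici 0)) : Rep f (tf f) := ⟨hf, rfl⟩

theorem Rep.add (hf : Rep f r) (hg : Rep g s) : Rep (fun t => f t + g t) (r + s) :=
  ⟨hf.1.add hg.1, by rw [tf_add hf.1 hg.1, hf.2, hg.2]⟩

theorem Rep.sub (hf : Rep f r) (hg : Rep g s) : Rep (fun t => f t - g t) (r - s) :=
  ⟨hf.1.sub hg.1, by rw [tf_sub hf.1 hg.1, hf.2, hg.2]⟩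

theorem Rep.neg (hf : Rep f r) : Rep (fun t => -f t) (-r) :=
  ⟨hf.1.neg, by rw [tf_neg hf.1, hf.2]⟩

theorem Rep.const_mul (c : ℝ) (hf : Rep f r) : Rep (fun t => c * f t) (cst c * r) :=
  ⟨continuousOn_const.mul hf.1, by rw [tf_const_mul c hf.1, hf.2]⟩

theorem Rep.conv (hf : Rep f r) (hg : Rep g s) : Rep (conv f g) (r * s) :=
  ⟨continuousOn_conv hf.1 hg.1, by rw [tf_conv hf.1 hg.1, hf.2, hg.2]⟩

theorem Rep.sum {ι : Type*} {S : Finset ι} {f : ι → ℝ → ℝ} {r : ι → ConvRing}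
    (h : ∀ i, Rep (f i) (r i)) : Rep (fun t => ∑ i ∈ S, f i t) (∑ i ∈ S, r i) :=
  ⟨continuousOn_finsetSum _ fun i _ => (h i).1, by
    rw [tf_sum S fun i _ => (h i).1]
    exact Finset.sum_congr rfl fun i _ => (h i).2⟩

theorem rep_const (c : ℝ) : Rep (fun _ => c) (cst c * tf lOne) :=
  ⟨continuousOn_const, tf_const c⟩

theorem rep_lOne : Rep lOne (tf lOne) := rep_tf continuousOn_lOne

theorem rep_xi : Rep xi (tf lOne * tf lOne) := ⟨continuousOn_xi, tf_xi⟩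

theorem Rep.eqOn (hf : Rep f r) (hg : Rep g s) (h : r = s) : EqOn f g (Ici 0) :=
  tf_inj hf.1 hg.1 (by rw [hf.2, hg.2, h])

theorem Rep.eq_of_eqOn (hf : Rep f r) (hg : Rep g s) (h : EqOn f g (Ici 0)) : r = s := by
  rw [← hf.2, ← hg.2, tf_congr h]

end

/-! ### Densities -/

/-- The flux divergence `q_{j,j}`. -/
def fluxDiv (Ω : Body) (π : ProcessFields) : Field := fun x t => ∑ j, pd Ω j (π.q j) x t

/-- The density of the power of the boundary tractions of `π₁` on the motion of `π₂`. -/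
def powerDensity (M : Material) (Ω : Body) (π₁ π₂ : ProcessFields) : Field := fun x t =>
  (∑ i, ((∑ j, conv (π₁.τ j i x) (pd Ω j (π₂.u i) x) t)
      + (∑ k, ∑ j, conv (π₁.μ k j i x) (pd Ω j (pd Ω k (π₂.u i)) x) t)
      + conv (innerForce Ω (fun j => π₁.τ j i) (fun k j => π₁.μ k j i) x) (π₂.u i x) t))
    + ((∑ j, conv (π₁.σ j x) (pd Ω j π₂.φ x) t)
      + (∑ k, ∑ j, conv (π₁.Q k j x) (pd Ω j (pd Ω k π₂.φ) x) t)
      + conv (innerForce Ω π₁.σ π₁.Q x) (π₂.φ x) t)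
    + 1 / M.T₀ * conv lOne (fun s => ∑ j, (conv (pd Ω j (π₁.q j) x) (M.A π₂.θ x) s
      + conv (π₁.q j x) (pd Ω j (M.A π₂.θ) x) s)) t

/-- The density of the part of the functional due to the body force and the charge. -/
def supplyDensity (M : Material) (Ω : Body) (π₁ π₂ : ProcessFields) : Field := fun x t =>
  (∑ i, conv (fun s => M.ρ * π₁.u i x s
      - conv xi (innerForce Ω (fun j => π₁.τ j i) (fun k j => π₁.μ k j i) x) s) (π₂.u i x) t)
    - conv (conv xi (innerForce Ω π₁.σ π₁.Q x)) (π₂.φ x) t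

/-- The density of the part of the functional due to the heat supply. -/
def heatDensity (M : Material) (Ω : Body) (π₁ π₂ : ProcessFields) : Field := fun x t =>
  -conv (fun s => -(1 / M.β * M.γ * π₁.θ x 0 * xi s)) (π₂.θ x) t
    - 1 / M.T₀ * conv (conv xi (fun s => M.ρ * M.T₀ * π₁.η x s + conv lOne (fluxDiv Ω π₁ x) s))
      (M.A π₂.θ x) t
    + ∑ j, conv (fun s => M.β * conv xi
        (fun r => (∑ i, M.k i j * pd Ω i π₁.θ x 0) * lOne r) s) (pd Ω j π₂.θ x) t

section

variable {M : Material} {Ω : Body} {θ : Field}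

theorem contOn_A (h : IsOfClass Ω 2 2 θ) : ContOn Ω.closed (M.A θ) :=
  h.contOn_self.add ((h.contOn (n := 1) one_le_two (l := []) (by simp) (by simp)).const_mul M.β)

theorem isC_dt (h : IsOfClass Ω 2 2 θ) {t : ℝ} (ht : 0 ≤ t) : Ω.IsC 1 fun y => dt θ y t :=
  h.isC (n := 1) one_le_two (k := 1) (l := []) (by simp) (by simp) ht

theorem isC_A (h : IsOfClass Ω 2 2 θ) {t : ℝ} (ht : 0 ≤ t) : Ω.IsC 1 fun y => M.A θ y t :=
  (h.isC_self one_le_two ht).add (contDiffOn_const.mul (isC_dt h ht))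

theorem pd_A (h : IsOfClass Ω 2 2 θ) {x : E3} (hx : x ∈ Ω.closed) {t : ℝ} (ht : 0 ≤ t)
    (j : Fin 3) : pd Ω j (M.A θ) x t = pd Ω j θ x t + M.β * pd Ω j (dt θ) x t := by
  have h1 := Body.IsC.differentiableWithinAt (n := 0) (h.isC_self one_le_two ht) hx
  have h2 := Body.IsC.differentiableWithinAt (n := 0) (isC_dt h ht) hx
  have h3 : sp Ω j (fun y => M.β * dt θ y t) x = M.β * sp Ω j (fun y => dt θ y t) x := by
    rw [sp_mul hx (differentiableWithinAt_const M.β) h2, sp_const, zero_mul, zero_add]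
  exact (sp_add hx h1 (h2.const_mul M.β) j).trans (congrArg _ h3)

theorem contOn_pd_A (h : IsOfClass Ω 2 2 θ) (j : Fin 3) : ContOn Ω.closed (pd Ω j (M.A θ)) :=
  ((h.contOn_pd one_le_two j).add ((h.contOn (n := 1) one_le_two (l := [j]) (by simp)
    (by simp)).const_mul M.β)).congr fun _ hx _ ht => pd_A h hx ht j

variable {π π₁ π₂ : ProcessFields}

theorem contOn_fluxDiv (h : π.IsAdmissible Ω) : ContOn Ω.closed (fluxDiv Ω π) :=
  ContOn.sum fun j _ => (h.q_class j).contOn_pd le_rfl j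

theorem contOn_xi (X : Set E3) : ContOn X fun _ => xi := ContOn.of_time continuousOn_xi

theorem contOn_lOne (X : Set E3) : ContOn X fun _ => lOne := ContOn.of_time continuousOn_lOne

theorem contOn_force (h : π.IsAdmissible Ω) (i : Fin 3) :
    ContOn Ω.closed (innerForce Ω (fun j => π.τ j i) (fun k j => π.μ k j i)) :=
  contOn_innerForce (fun j => h.τ_class j i) fun k j => h.μ_class k j i

theorem contOn_charge (h : π.IsAdmissible Ω) : ContOn Ω.closed (innerForce Ω π.σ π.Q) :=
  contOn_innerForce h.σ_class h.Q_class

theorem contOn_heatPower (h₁ : π₁.IsAdmissible Ω) (h₂ : π₂.IsAdmissible Ω) :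
    ContOn Ω.closed fun x s => ∑ j, (conv (pd Ω j (π₁.q j) x) (M.A π₂.θ x) s
      + conv (π₁.q j x) (pd Ω j (M.A π₂.θ) x) s) :=
  ContOn.sum fun j _ => (((h₁.q_class j).contOn_pd le_rfl j).conv (contOn_A h₂.θ_class)).add
    ((h₁.q_class j).contOn_self.conv (contOn_pd_A h₂.θ_class j))

theorem contOn_motionPower (h₁ : π₁.IsAdmissible Ω) (h₂ : π₂.IsAdmissible Ω) (i : Fin 3) :
    ContOn Ω.closed fun x t => (∑ j, conv (π₁.τ j i x) (pd Ω j (π₂.u i) x) t)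
      + (∑ k, ∑ j, conv (π₁.μ k j i x) (pd Ω j (pd Ω k (π₂.u i)) x) t)
      + conv (innerForce Ω (fun j => π₁.τ j i) (fun k j => π₁.μ k j i) x) (π₂.u i x) t :=
  ((ContOn.sum fun j _ => (h₁.τ_class j i).contOn_self.conv
    ((h₂.u_class i).contOn_pd (by norm_num) j)).add
    (ContOn.sum fun k _ => ContOn.sum fun j _ => (h₁.μ_class k j i).contOn_self.conv
      ((h₂.u_class i).contOn_pd_pd (by norm_num) j k))).add
    ((contOn_force h₁ i).conv (h₂.u_class i).contOn_self)

theorem contOn_electricPower (h₁ : π₁.IsAdmissible Ω) (h₂ : π₂.IsAdmissible Ω) :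
    ContOn Ω.closed fun x t => (∑ j, conv (π₁.σ j x) (pd Ω j π₂.φ x) t)
      + (∑ k, ∑ j, conv (π₁.Q k j x) (pd Ω j (pd Ω k π₂.φ) x) t)
      + conv (innerForce Ω π₁.σ π₁.Q x) (π₂.φ x) t :=
  ((ContOn.sum fun j _ => (h₁.σ_class j).contOn_self.conv
    (h₂.φ_class.contOn_pd (by norm_num) j)).add
    (ContOn.sum fun k _ => ContOn.sum fun j _ => (h₁.Q_class k j).contOn_self.conv
      (h₂.φ_class.contOn_pd_pd (by norm_num) j k))).add
    ((contOn_charge h₁).conv h₂.φ_class.contOn_self)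

theorem contOn_powerDensity (h₁ : π₁.IsAdmissible Ω) (h₂ : π₂.IsAdmissible Ω) :
    ContOn Ω.closed (powerDensity M Ω π₁ π₂) :=
  ((ContOn.sum fun i _ => contOn_motionPower h₁ h₂ i).add (contOn_electricPower h₁ h₂)).add
    (((contOn_lOne _).conv (contOn_heatPower h₁ h₂)).const_mul _)

theorem contOn_supplyDensity (h₁ : π₁.IsAdmissible Ω) (h₂ : π₂.IsAdmissible Ω) :
    ContOn Ω.closed (supplyDensity M Ω π₁ π₂) :=
  (ContOn.sum fun i _ => (((h₁.u_class i).contOn_self.const_mul M.ρ).sub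
    ((contOn_xi _).conv (contOn_force h₁ i))).conv (h₂.u_class i).contOn_self).sub
    (((contOn_xi _).conv (contOn_charge h₁)).conv h₂.φ_class.contOn_self)

theorem contOn_heatDensity (h₁ : π₁.IsAdmissible Ω) (h₂ : π₂.IsAdmissible Ω) :
    ContOn Ω.closed (heatDensity M Ω π₁ π₂) := by
  have c0 : ContinuousOn (fun x => π₁.θ x 0) Ω.closed := h₁.θ_class.contOn_self.space le_rfl
  have c1 : ∀ i, ContinuousOn (fun x => pd Ω i π₁.θ x 0) Ω.closed := fun i =>
    (h₁.θ_class.contOn_pd one_le_two i).space le_rfl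
  exact ((((((ContOn.of_space (continuousOn_const.mul c0)).mul (contOn_xi _)).neg).conv
    h₂.θ_class.contOn_self).neg).sub
    (((((contOn_xi _).conv ((h₁.η_class.contOn_self.const_mul (M.ρ * M.T₀)).add
      ((contOn_lOne _).conv (contOn_fluxDiv h₁)))).conv (contOn_A h₂.θ_class))).const_mul _)).add
    (ContOn.sum fun j _ => (((contOn_xi _).conv ((ContOn.of_space (continuousOn_finsetSum _
      fun i _ => continuousOn_const.mul (c1 i))).mul (contOn_lOne _))).const_mul M.β).conv
        (h₂.θ_class.contOn_pd one_le_two j))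

theorem contOn_flux (h : π.IsAdmissible Ω) : ContOn Ω.bdry (π.flux Ω) :=
  ContOn.sum fun i _ => ((h.q_class i).contOn_self.mono Ω.bdry_subset_closed).mul (contOn_normal i)

/-- Associativity isolates the factor `l`, which commutes with the space integrals; what remains is
the flux identity at each time. -/
theorem integral_heatPower (h₁ : π₁.IsAdmissible Ω) (h₂ : π₂.IsAdmissible Ω) {t : ℝ} (ht : 0 ≤ t) :
    ∫ x in Ω.bdry, conv (conv lOne (π₁.flux Ω x)) (M.A π₂.θ x) t ∂μHE[2]
      = ∫ x in Ω.region, conv lOne (fun s => ∑ j, (conv (pd Ω j (π₁.q j) x) (M.A π₂.θ x) s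
      + conv (π₁.q j x) (pd Ω j (M.A π₂.θ) x) s)) t := by
  have cA := (contOn_A (M := M) h₂.θ_class).mono Ω.bdry_subset_closed
  have cf := contOn_flux h₁
  have e : ∀ x ∈ Ω.bdry, conv (conv lOne (π₁.flux Ω x)) (M.A π₂.θ x) t
      = conv lOne (conv (π₁.flux Ω x) (M.A π₂.θ x)) t := fun x hx =>
    ((rep_lOne.conv (rep_tf (cf.time hx))).conv (rep_tf (cA.time hx))).eqOn
      (rep_lOne.conv ((rep_tf (cf.time hx)).conv (rep_tf (cA.time hx)))) (mul_assoc _ _ _) ht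
  rw [setIntegral_congr_fun Ω.isCompact_bdry.isClosed.measurableSet e,
    ← conv_integral Ω.isCompact_bdry Ω.area_restrict continuousOn_lOne (cf.conv cA) ht,
    ← conv_integral Ω.isCompact_closed Ω.volume_restrict continuousOn_lOne
      (contOn_heatPower h₁ h₂) ht]
  exact conv_congr (eqOn_refl _ _) (fun s hs => integral_conv_flux h₁.q_class
    (contOn_A h₂.θ_class) (contOn_pd_A h₂.θ_class) (fun r hr => isC_A h₂.θ_class hr) hs) ht

theorem integral_power (h₁ : π₁.IsAdmissible Ω) (h₂ : π₂.IsAdmissible Ω) {t : ℝ} (ht : 0 ≤ t) :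
    ∫ x in Ω.bdry,
      ((∑ i, (conv (π₁.P Ω i x) (π₂.u i x) t
          + conv (π₁.R Ω i x) (normalDeriv Ω (π₂.u i) x) t))
        + conv (π₁.Lam Ω x) (π₂.φ x) t
        + conv (π₁.H Ω x) (normalDeriv Ω π₂.φ x) t
        + 1 / M.T₀ * conv (conv lOne (π₁.flux Ω x)) (M.A π₂.θ x) t) ∂μHE[2]
      = ∫ x in Ω.region, powerDensity M Ω π₁ π₂ x t := by
  have ib : ∀ {f : Field}, ContOn Ω.bdry f →
      Integrable (fun x => f x t) (μHE[2].restrict Ω.bdry) := fun hf =>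
    integrable_of_continuousOn Ω.isCompact_bdry Ω.area_restrict (hf.space ht)
  have ir : ∀ {f : Field}, ContOn Ω.closed f →
      Integrable (fun x => f x t) (volume.restrict Ω.region) := fun hf =>
    integrable_of_continuousOn Ω.isCompact_closed Ω.volume_restrict (hf.space ht)
  have cu : ∀ i, ContOn Ω.bdry fun x t => conv (π₁.P Ω i x) (π₂.u i x) t
      + conv (π₁.R Ω i x) (normalDeriv Ω (π₂.u i) x) t := fun i =>
    ((contOn_tract (fun j => h₁.τ_class j i) fun k j => h₁.μ_class k j i).conv
      ((h₂.u_class i).contOn_self.mono Ω.bdry_subset_closed)).add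
      ((contOn_doubleTract fun k j => h₁.μ_class k j i).conv
        (contOn_normalDeriv (h₂.u_class i) (by norm_num)))
  have cφ : ContOn Ω.bdry fun x t => conv (π₁.Lam Ω x) (π₂.φ x) t
      + conv (π₁.H Ω x) (normalDeriv Ω π₂.φ x) t :=
    ((contOn_tract h₁.σ_class h₁.Q_class).conv
      (h₂.φ_class.contOn_self.mono Ω.bdry_subset_closed)).add
      ((contOn_doubleTract h₁.Q_class).conv (contOn_normalDeriv h₂.φ_class (by norm_num)))
  have cq : ContOn Ω.bdry fun x t => conv (conv lOne (π₁.flux Ω x)) (M.A π₂.θ x) t :=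
    ((contOn_lOne _).conv (contOn_flux h₁)).conv
      ((contOn_A h₂.θ_class).mono Ω.bdry_subset_closed)
  have cu' : ContOn Ω.bdry fun x t => ∑ i, (conv (π₁.P Ω i x) (π₂.u i x) t
      + conv (π₁.R Ω i x) (normalDeriv Ω (π₂.u i) x) t) := ContOn.sum fun i _ => cu i
  simp only [add_assoc (∑ i, _) (conv (π₁.Lam Ω _) _ _)]
  rw [integral_add (ib (cu'.add cφ)) ((ib cq).const_mul _), integral_add (ib cu') (ib cφ),
    integral_finsetSum _ fun i _ => ib (cu i), integral_const_mul]
  unfold powerDensity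
  rw [integral_add (ir ((ContOn.sum fun i _ => contOn_motionPower h₁ h₂ i).add
      (contOn_electricPower h₁ h₂)))
      ((ir ((contOn_lOne _).conv (contOn_heatPower h₁ h₂))).const_mul _),
    integral_add (ir (ContOn.sum fun i _ => contOn_motionPower h₁ h₂ i))
      (ir (contOn_electricPower h₁ h₂)),
    integral_finsetSum _ fun i _ => ir (contOn_motionPower h₁ h₂ i), integral_const_mul,
    integral_heatPower h₁ h₂ ht]
  congr 2
  · exact Finset.sum_congr rfl fun i _ => integral_conv_tract (fun j => h₁.τ_class j i)
      (fun k j => h₁.μ_class k j i) (h₂.u_class i) (by norm_num) ht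
  · exact integral_conv_tract h₁.σ_class h₁.Q_class h₂.φ_class (by norm_num) ht

end

/-! ### The functional as an integral over the region -/

section

variable {M : Material} {Ω : Body} {bp : BoundaryPartition Ω} {d : Data} {π π' : ProcessFields}

/-- Convolving the equation of motion twice with `l` replaces `ü` by `u - u⁰ l - v⁰ ξ`; solving for
the body force gives the claim. -/
theorem calF_eqOn (h : IsSolution M Ω bp d π) {x : E3} (hx : x ∈ Ω.region) (i : Fin 3) :
    EqOn (calF M d i x) (fun s => M.ρ * π.u i x s
      - conv xi (innerForce Ω (fun j => π.τ j i) (fun k j => π.μ k j i) x) s) (Ici 0) := by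
  have hxc := Ω.region_subset_closed hx
  have hc := h.admissible.u_class i
  have rf := rep_tf ((h.data_continuous.f i).time hx)
  have ru := rep_tf (hc.contOn_self.time hxc)
  have rS := rep_tf ((contOn_force h.admissible i).time hxc)
  have ra := rep_tf ((hc.contOn (n := 2) le_rfl (l := []) (by simp) (by simp)).time hxc)
  have e1 := hc.tf_lOne_mul_dt (n := 0) two_pos hxc
  have e2 := hc.tf_lOne_mul_dt (n := 1) one_lt_two hxc
  have e3 := (rS.add (rf.const_mul M.ρ)).eq_of_eqOn (ra.const_mul M.ρ)
    fun t ht => h.field.motion i x hx t ht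
  have i1 : dt^[0] (π.u i) x 0 = d.u0 i x := h.initial.u i x hxc
  have i2 : dt^[1] (π.u i) x 0 = d.v0 i x := h.initial.v i x hxc
  rw [i1] at e1
  rw [i2] at e2
  refine ((((rep_xi.conv rf).const_mul M.ρ).add (rep_xi.const_mul (M.ρ * d.v0 i x))).add
    (rep_const (M.ρ * d.u0 i x))).eqOn ((ru.const_mul M.ρ).sub (rep_xi.conv rS)) ?_
  simp only [map_mul]
  change _ = cst M.ρ * tf (dt^[0] (π.u i) x) - _
  change tf (innerForce Ω (fun j => π.τ j i) (fun k j => π.μ k j i) x) + _ = cst M.ρ * tf (dt^[2] (π.u i) x) at e3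
  linear_combination cst M.ρ * e1 + cst M.ρ * tf lOne * e2 + tf lOne * tf lOne * e3

/-- One convolution of the energy equation with `l` replaces `η̇` by `η - η⁰ l`. -/
theorem calH_eqOn (h : IsSolution M Ω bp d π) {x : E3} (hx : x ∈ Ω.region) :
    EqOn (calH M d x) (fun s => M.ρ * M.T₀ * π.η x s + conv lOne (fluxDiv Ω π x) s) (Ici 0) := by
  have hxc := Ω.region_subset_closed hx
  have hc := h.admissible.η_class
  have rh := rep_tf (h.data_continuous.h.time hx)
  have rη := rep_tf (hc.contOn_self.time hxc)
  have rq := rep_tf ((contOn_fluxDiv h.admissible).time hxc)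
  have ra := rep_tf ((hc.contOn (n := 1) le_rfl (l := []) (by simp) (by simp)).time hxc)
  have e1 := hc.tf_lOne_mul_dt (n := 0) one_pos hxc
  have e3 := (((ra.const_mul (M.ρ * M.T₀)).add rq).sub (rh.const_mul M.ρ)).eq_of_eqOn
    ⟨continuousOn_const, tf_zero⟩ fun t ht => h.field.energy x hx t ht
  have i1 : dt^[0] π.η x 0 = d.η0 x := h.initial.η x hxc
  rw [i1] at e1
  refine ((rep_const (M.ρ * M.T₀ * d.η0 x)).add (rep_lOne.conv (rh.const_mul M.ρ))).eqOn
    ((rη.const_mul (M.ρ * M.T₀)).add (rep_lOne.conv rq)) ?_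
  simp only [map_mul] at e3 ⊢
  change _ = cst M.ρ * cst M.T₀ * tf (dt^[0] π.η x) + _
  change cst M.ρ * cst M.T₀ * tf (dt^[1] π.η x) + _ - _ = _ at e3
  linear_combination cst M.ρ * cst M.T₀ * e1 - tf lOne * e3

theorem supply_integrand_eq (h : IsSolution M Ω bp d π) {x : E3} (hx : x ∈ Ω.region) {t : ℝ}
    (ht : 0 ≤ t) : (∑ i, conv (calF M d i x) (π'.u i x) t) - conv (conv xi (d.g x)) (π'.φ x) t
      = supplyDensity M Ω π π' x t := by
  unfold supplyDensity
  congr 1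
  · exact Finset.sum_congr rfl fun i _ => conv_congr (calF_eqOn h hx i) (eqOn_refl _ _) ht
  · exact conv_congr (conv_congr (eqOn_refl _ _)
      fun s hs => (h.field.electric x hx s hs).symm) (eqOn_refl _ _) ht

theorem heat_integrand_eq (h : IsSolution M Ω bp d π) {x : E3} (hx : x ∈ Ω.region) {t : ℝ}
    (ht : 0 ≤ t) : -conv (calL M d x) (π'.θ x) t
        - 1 / M.T₀ * conv (conv xi (calH M d x)) (M.A π'.θ x) t
        + ∑ j, conv (calLvec M Ω d j x) (pd Ω j π'.θ x) t
      = heatDensity M Ω π π' x t := by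
  have hxc := Ω.region_subset_closed hx
  -- The initial condition holds on the whole closed region, and derivatives within it depend only
  -- on values there.
  have e1 : ∀ i, pd Ω i (fun y _ => d.θ0 y) x 0 = pd Ω i π.θ x 0 := fun i =>
    sp_congr (fun y hy => (h.initial.θ y hy).symm) hxc i
  have e2 : conv (conv xi (calH M d x)) (M.A π'.θ x) t = conv (conv xi
      (fun s => M.ρ * M.T₀ * π.η x s + conv lOne (fluxDiv Ω π x) s)) (M.A π'.θ x) t :=
    conv_congr (conv_congr (eqOn_refl _ _) (calH_eqOn h hx)) (eqOn_refl _ _) ht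
  unfold heatDensity calLvec calL
  rw [e2, h.initial.θ x hxc]
  simp only [e1]

/-- The total density of the reciprocity functional. -/
def recipDensity (M : Material) (Ω : Body) (π₁ π₂ : ProcessFields) : Field := fun x t =>
  supplyDensity M Ω π₁ π₂ x t + conv xi (powerDensity M Ω π₁ π₂ x) t + heatDensity M Ω π₁ π₂ x t

theorem recipI_eq_integral (h : IsSolution M Ω bp d π) (h' : π'.IsAdmissible Ω) {t : ℝ}
    (ht : 0 ≤ t) : recipI M Ω d π π' t = ∫ x in Ω.region, recipDensity M Ω π π' x t := by
  have ir : ∀ {f : Field}, ContOn Ω.closed f →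
      Integrable (fun x => f x t) (volume.restrict Ω.region) := fun hf =>
    integrable_of_continuousOn Ω.isCompact_closed Ω.volume_restrict (hf.space ht)
  have c1 := contOn_supplyDensity (M := M) h.admissible h'
  have c2 := contOn_powerDensity (M := M) h.admissible h'
  have c3 := contOn_heatDensity (M := M) h.admissible h'
  have c2' := (contOn_xi _).conv c2
  unfold recipI recipDensity
  rw [integral_add (ir (c1.add c2')) (ir c3), integral_add (ir c1) (ir c2'),
    setIntegral_congr_fun Ω.region_isOpen.measurableSet fun x hx => supply_integrand_eq h hx ht,
    setIntegral_congr_fun Ω.region_isOpen.measurableSet fun x hx => heat_integrand_eq h hx ht,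
    ← conv_integral Ω.isCompact_closed Ω.volume_restrict continuousOn_xi c2 ht]
  congr 2
  exact conv_congr (eqOn_refl _ _) (fun s hs => integral_power h.admissible h' hs) ht

end

/-! ### Symmetric bilinear forms over a commutative ring -/

section

variable {R ι κ : Type*} [CommRing R] [Fintype ι] [Fintype κ]

theorem sum_bilin_transpose (a : ι → κ → R) (x : κ → R) (y : ι → R) :
    ∑ i, (∑ j, a i j * x j) * y i = ∑ j, (∑ i, a i j * y i) * x j := by
  simp only [Finset.sum_mul]
  rw [Finset.sum_comm]
  exact Finset.sum_congr rfl fun j _ => Finset.sum_congr rfl fun i _ => by ring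

theorem sum_bilin_symm {a : ι → ι → R} (ha : ∀ i j, a i j = a j i) (x y : ι → R) :
    ∑ i, (∑ j, a i j * x j) * y i = ∑ i, (∑ j, a i j * y j) * x i := by
  rw [sum_bilin_transpose]
  exact Finset.sum_congr rfl fun j _ => by simp only [ha j]

/-- Betti reciprocity for the stress, the electric quadrupole and the entropy. -/
theorem stress_reciprocity {a b d : ι → ι → R} {m n : ι → R} (ha : ∀ i j, a i j = a j i)
    (hd : ∀ i j, d i j = d j i) {T e V Q : Fin 2 → ι → R} {A B s : Fin 2 → R}
    (hT : ∀ α i, T α i = (∑ j, a i j * e α j) + (∑ j, b i j * V α j) + m i * A α)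
    (hQ : ∀ α i, -Q α i = (∑ j, b j i * e α j) + (∑ j, d i j * V α j) + n i * A α)
    (hs : ∀ α, -s α = (∑ i, m i * e α i) + (∑ i, n i * V α i) + B α) (α β : Fin 2) :
    (∑ i, T α i * e β i) - (∑ i, Q α i * V β i) - s α * A β - B α * A β
      = (∑ i, T β i * e α i) - (∑ i, Q β i * V α i) - s β * A α - B β * A α := by
  -- Inserting the laws gives symmetric forms in `e` and in `V`, while the cross terms occur in
  -- pairs exchanged by swapping `α` and `β`. Subtracting `B α * A β` removes the one product for
  -- which no symmetry is available here.
  have key : ∀ α β, (∑ i, T α i * e β i) - (∑ i, Q α i * V β i) - s α * A β - B α * A β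
      = (∑ i, (∑ j, a i j * e α j) * e β i) + (∑ i, (∑ j, b i j * V α j) * e β i)
        + (∑ i, m i * e β i) * A α + (∑ i, (∑ j, b j i * e α j) * V β i)
        + (∑ i, (∑ j, d i j * V α j) * V β i) + (∑ i, n i * V β i) * A α
        + (∑ i, m i * e α i) * A β + (∑ i, n i * V α i) * A β := by
    intro α β
    have h1 : ∑ i, T α i * e β i = (∑ i, (∑ j, a i j * e α j) * e β i)
        + (∑ i, (∑ j, b i j * V α j) * e β i) + (∑ i, m i * e β i) * A α := by
      rw [Finset.sum_mul, ← Finset.sum_add_distrib, ← Finset.sum_add_distrib]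
      exact Finset.sum_congr rfl fun i _ => by rw [hT]; ring
    have h2 : -∑ i, Q α i * V β i = (∑ i, (∑ j, b j i * e α j) * V β i)
        + (∑ i, (∑ j, d i j * V α j) * V β i) + (∑ i, n i * V β i) * A α := by
      rw [Finset.sum_mul, ← Finset.sum_add_distrib, ← Finset.sum_add_distrib,
        ← Finset.sum_neg_distrib]
      exact Finset.sum_congr rfl fun i _ => by rw [← neg_mul, hQ]; ring
    linear_combination h1 + h2 + A β * hs α
  rw [key, key, sum_bilin_symm ha (e β), sum_bilin_symm hd (V β), sum_bilin_transpose b (V α),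
    sum_bilin_transpose b (V β)]
  ring

/-- Betti reciprocity for the double stress and the electric dipole. -/
theorem doubleStress_reciprocity {a : ι → ι → R} {b : ι → κ → R} {d : κ → κ → R}
    (ha : ∀ i j, a i j = a j i) (hd : ∀ i j, d i j = d j i) {m k : Fin 2 → ι → R}
    {σ E : Fin 2 → κ → R} (hm : ∀ α i, m α i = (∑ j, a i j * k α j) + ∑ j, b i j * E α j)
    (hσ : ∀ α i, -σ α i = (∑ j, b j i * k α j) + ∑ j, d i j * E α j) (α β : Fin 2) :
    (∑ i, m α i * k β i) - ∑ i, σ α i * E β i = (∑ i, m β i * k α i) - ∑ i, σ β i * E α i := by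
  have key : ∀ α β, (∑ i, m α i * k β i) - ∑ i, σ α i * E β i
      = (∑ i, (∑ j, a i j * k α j) * k β i) + (∑ i, (∑ j, b i j * E α j) * k β i)
        + (∑ i, (∑ j, b j i * k α j) * E β i) + ∑ i, (∑ j, d i j * E α j) * E β i := by
    intro α β
    have h1 : ∑ i, m α i * k β i = (∑ i, (∑ j, a i j * k α j) * k β i)
        + ∑ i, (∑ j, b i j * E α j) * k β i := by
      rw [← Finset.sum_add_distrib]
      exact Finset.sum_congr rfl fun i _ => by rw [hm]; ring
    have h2 : -∑ i, σ α i * E β i = (∑ i, (∑ j, b j i * k α j) * E β i)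
        + ∑ i, (∑ j, d i j * E α j) * E β i := by
      rw [← Finset.sum_add_distrib, ← Finset.sum_neg_distrib]
      exact Finset.sum_congr rfl fun i _ => by rw [← neg_mul, hσ]; ring
    linear_combination h1 + h2
  rw [key, key, sum_bilin_symm ha (k β), sum_bilin_symm hd (E β), sum_bilin_transpose b (E α),
    sum_bilin_transpose b (E β)]
  ring

/-- Reciprocity for the heat flux `p`, where `y = x + b x'`, `l * x' = x - z * l`. -/
theorem flux_reciprocity {k : ι → ι → R} (hk : ∀ i j, k i j = k j i) {l b : R}
    {p x y z : Fin 2 → ι → R} (hp : ∀ α i, p α i = -∑ j, k i j * x α j)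
    (hy : ∀ α i, l * y α i = l * x α i + b * (x α i - z α i * l)) (α β : Fin 2) :
    l * (∑ i, p α i * y β i) + b * l * ∑ i, (∑ j, k i j * z α j) * x β i
      = l * (∑ i, p β i * y α i) + b * l * ∑ i, (∑ j, k i j * z β j) * x α i := by
  -- From `l y = (l + b) x - b l z` the flux term is a symmetric form in `x` plus `b l` times the
  -- form in `x α` and `z β`. The added initial-value term is the same form with the labels
  -- exchanged.
  have key : ∀ α β, l * ∑ i, p α i * y β i = -(l + b) * (∑ i, (∑ j, k i j * x α j) * x β i)
      + b * l * ∑ i, (∑ j, k i j * x α j) * z β i := by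
    intro α β
    rw [Finset.mul_sum, Finset.mul_sum, Finset.mul_sum, ← Finset.sum_add_distrib]
    exact Finset.sum_congr rfl fun i _ => by
      rw [hp]
      linear_combination (-∑ j, k i j * x α j) * hy β i
  rw [key, key, sum_bilin_symm hk (x β) (x α), sum_bilin_symm hk (z β), sum_bilin_symm hk (z α)]
  ring

end

/-! ### The laws of the material in the convolution ring -/

section

variable {M : Material} {Ω : Body} {bp : BoundaryPartition Ω} {d : Data} {π : ProcessFields}
  {x : E3}

/-- Pairs of indices are treated as one index, so that the constitutive law becomes a matrix
equation over the convolution ring and fits the reciprocity lemmas. -/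
theorem tf_τ (h : IsSolution M Ω bp d π) (hx : x ∈ Ω.region) (I : Fin 3 × Fin 3) :
    tf (π.τ I.1 I.2 x)
      = (∑ J : Fin 3 × Fin 3, cst (M.a11 I.1 I.2 J.1 J.2) * tf (π.e J.1 J.2 x))
        + (∑ J : Fin 3 × Fin 3, cst (M.a17 I.1 I.2 J.1 J.2) * tf (π.V J.1 J.2 x))
        + cst (M.a14 I.1 I.2) * tf (M.A π.θ x) := by
  have hxc := Ω.region_subset_closed hx
  have ha := h.admissible
  simp only [Fintype.sum_prod_type]
  exact (rep_tf ((ha.τ_class I.1 I.2).contOn_self.time hxc)).eq_of_eqOn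
    (((Rep.sum fun k => Rep.sum fun l =>
      (rep_tf ((ha.e_class k l).contOn_self.time hxc)).const_mul _).add
    (Rep.sum fun k => Rep.sum fun l =>
      (rep_tf ((ha.V_class k l).contOn_self.time hxc)).const_mul _)).add
    ((rep_tf ((contOn_A ha.θ_class).time hxc)).const_mul _))
    fun t ht => h.field.τ_eq I.1 I.2 x hx t ht

theorem tf_Q (h : IsSolution M Ω bp d π) (hx : x ∈ Ω.region) (I : Fin 3 × Fin 3) :
    -tf (π.Q I.1 I.2 x)
      = (∑ J : Fin 3 × Fin 3, cst (M.a17 J.1 J.2 I.1 I.2) * tf (π.e J.1 J.2 x))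
        + (∑ J : Fin 3 × Fin 3, cst (M.a77 I.1 I.2 J.1 J.2) * tf (π.V J.1 J.2 x))
        + cst (M.a47 I.1 I.2) * tf (M.A π.θ x) := by
  have hxc := Ω.region_subset_closed hx
  have ha := h.admissible
  simp only [Fintype.sum_prod_type]
  exact (rep_tf ((ha.Q_class I.1 I.2).contOn_self.time hxc)).neg.eq_of_eqOn
    (((Rep.sum fun k => Rep.sum fun l =>
      (rep_tf ((ha.e_class k l).contOn_self.time hxc)).const_mul _).add
    (Rep.sum fun k => Rep.sum fun l =>
      (rep_tf ((ha.V_class k l).contOn_self.time hxc)).const_mul _)).add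
    ((rep_tf ((contOn_A ha.θ_class).time hxc)).const_mul _))
    fun t ht => h.field.Q_eq I.1 I.2 x hx t ht

theorem contOn_dt_θ (h : π.IsAdmissible Ω) : ContOn Ω.closed (dt π.θ) :=
  h.θ_class.contOn (n := 1) one_le_two (l := []) (by simp) (by simp)

theorem tf_η (h : IsSolution M Ω bp d π) (hx : x ∈ Ω.region) :
    -(cst M.ρ * tf (π.η x)) = (∑ J : Fin 3 × Fin 3, cst (M.a14 J.1 J.2) * tf (π.e J.1 J.2 x))
        + (∑ J : Fin 3 × Fin 3, cst (M.a47 J.1 J.2) * tf (π.V J.1 J.2 x))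
        + cst M.c * (tf (π.θ x) + cst M.β' * tf (dt π.θ x)) := by
  have hxc := Ω.region_subset_closed hx
  have ha := h.admissible
  simp only [Fintype.sum_prod_type]
  exact ((rep_tf (ha.η_class.contOn_self.time hxc)).const_mul M.ρ).neg.eq_of_eqOn
    (((Rep.sum fun k => Rep.sum fun l =>
      (rep_tf ((ha.e_class k l).contOn_self.time hxc)).const_mul _).add
    (Rep.sum fun k => Rep.sum fun l =>
      (rep_tf ((ha.V_class k l).contOn_self.time hxc)).const_mul _)).add
    (((rep_tf (ha.θ_class.contOn_self.time hxc)).add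
      ((rep_tf ((contOn_dt_θ ha).time hxc)).const_mul M.β')).const_mul M.c))
    fun t ht => h.field.η_eq x hx t ht

theorem tf_μ (h : IsSolution M Ω bp d π) (hx : x ∈ Ω.region) (I : Fin 3 × Fin 3 × Fin 3) :
    tf (π.μ I.1 I.2.1 I.2.2 x)
      = (∑ J : Fin 3 × Fin 3 × Fin 3,
          cst (M.a22 I.1 I.2.1 I.2.2 J.1 J.2.1 J.2.2) * tf (π.κ J.1 J.2.1 J.2.2 x))
        + ∑ l, cst (M.a23 I.1 I.2.1 I.2.2 l) * tf (π.E l x) := by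
  have hxc := Ω.region_subset_closed hx
  have ha := h.admissible
  simp only [Fintype.sum_prod_type]
  exact (rep_tf ((ha.μ_class I.1 I.2.1 I.2.2).contOn_self.time hxc)).eq_of_eqOn
    ((Rep.sum fun k => Rep.sum fun l => Rep.sum fun m =>
      (rep_tf ((ha.κ_class k l m).contOn_self.time hxc)).const_mul _).add
    (Rep.sum fun k => (rep_tf ((ha.E_class k).contOn_self.time hxc)).const_mul _))
    fun t ht => h.field.μ_eq I.1 I.2.1 I.2.2 x hx t ht

theorem tf_σ (h : IsSolution M Ω bp d π) (hx : x ∈ Ω.region) (i : Fin 3) :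
    -tf (π.σ i x)
      = (∑ J : Fin 3 × Fin 3 × Fin 3,
          cst (M.a23 J.1 J.2.1 J.2.2 i) * tf (π.κ J.1 J.2.1 J.2.2 x))
        + ∑ l, cst (M.a33 i l) * tf (π.E l x) := by
  have hxc := Ω.region_subset_closed hx
  have ha := h.admissible
  simp only [Fintype.sum_prod_type]
  exact (rep_tf ((ha.σ_class i).contOn_self.time hxc)).neg.eq_of_eqOn
    ((Rep.sum fun k => Rep.sum fun l => Rep.sum fun m =>
      (rep_tf ((ha.κ_class k l m).contOn_self.time hxc)).const_mul _).add
    (Rep.sum fun k => (rep_tf ((ha.E_class k).contOn_self.time hxc)).const_mul _))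
    fun t ht => h.field.σ_eq i x hx t ht

theorem tf_q (h : IsSolution M Ω bp d π) (hx : x ∈ Ω.region) (i : Fin 3) :
    cst (1 / M.T₀) * tf (π.q i x) = -∑ j, cst (M.k i j) * tf (pd Ω j π.θ x) := by
  have hxc := Ω.region_subset_closed hx
  have ha := h.admissible
  refine ((rep_tf ((ha.q_class i).contOn_self.time hxc)).const_mul (1 / M.T₀)).eq_of_eqOn
    (Rep.neg (Rep.sum fun j =>
      (rep_tf ((ha.θ_class.contOn_pd one_le_two j).time hxc)).const_mul (M.k i j)))
    fun t ht => ?_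
  have h1 := h.field.q_eq i x hx t ht
  simp only [h.field.ϑ_eq _ x hx t ht] at h1
  beta_reduce
  rw [← h1]
  ring

theorem tf_pd_A (h : IsSolution M Ω bp d π) (hx : x ∈ Ω.region) (i : Fin 3) :
    tf lOne * tf (pd Ω i (M.A π.θ) x) = tf lOne * tf (pd Ω i π.θ x)
      + cst M.β * (tf (pd Ω i π.θ x) - cst (pd Ω i π.θ x 0) * tf lOne) := by
  have hxc := Ω.region_subset_closed hx
  have hc := h.admissible.θ_class
  have h1 : tf (pd Ω i (M.A π.θ) x) = tf (pd Ω i π.θ x) + cst M.β * tf (pd Ω i (dt π.θ) x) :=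
    (rep_tf ((contOn_pd_A hc i).time hxc)).eq_of_eqOn
      ((rep_tf ((hc.contOn_pd one_le_two i).time hxc)).add
        ((rep_tf ((hc.contOn (n := 1) one_le_two (l := [i]) (by simp) (by simp)).time
          hxc)).const_mul M.β)) fun t ht => pd_A hc hxc ht i
  have h2 := hc.tf_lOne_mul_pd_dt one_le_two one_le_two (by simp) hx i
  rw [h1]
  linear_combination cst M.β * h2

theorem tf_A (h : IsSolution M Ω bp d π) (hx : x ∈ Ω.region) :
    tf (M.A π.θ x) = tf (π.θ x) + cst M.β * tf (dt π.θ x) := by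
  have hxc := Ω.region_subset_closed hx
  have ha := h.admissible
  exact ((rep_tf (ha.θ_class.contOn_self.time hxc)).add
      ((rep_tf ((contOn_dt_θ ha).time hxc)).const_mul M.β)).2

/-- Symmetry of the stress kills the skew part of the displacement gradient. -/
theorem sum_tf_τ (h : IsSolution M Ω bp d π) (hx : x ∈ Ω.region) {π' : ProcessFields} {d' : Data}
    (h' : IsSolution M Ω bp d' π') :
    ∑ i, ∑ j, tf (π.τ j i x) * tf (pd Ω j (π'.u i) x)
      = ∑ I : Fin 3 × Fin 3, tf (π.τ I.1 I.2 x) * tf (π'.e I.1 I.2 x) := by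
  have hxc := Ω.region_subset_closed hx
  have hs : ∀ i j, tf (π.τ j i x) = tf (π.τ i j x) := fun i j =>
    tf_congr fun t ht => h.admissible.τ_symm i j x hxc t ht
  have he : ∀ i j, tf (π'.e i j x)
      = cst (1 / 2) * (tf (pd Ω j (π'.u i) x) + tf (pd Ω i (π'.u j) x)) := fun i j => by
    have hu := fun i j => rep_tf
      (((h'.admissible.u_class i).contOn_pd (by norm_num) j).time hxc)
    exact (rep_tf ((h'.admissible.e_class i j).contOn_self.time hxc)).eq_of_eqOn
      (((hu i j).add (hu j i)).const_mul (1 / 2)) fun t ht => h'.field.e_eq i j x hx t ht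
  have h2 : cst (1 / 2) + cst (1 / 2) = 1 := by
    rw [← map_add]
    norm_num
  have e1 : ∑ i, ∑ j, tf (π.τ i j x) * tf (pd Ω j (π'.u i) x)
      = ∑ i, ∑ j, tf (π.τ i j x) * tf (pd Ω i (π'.u j) x) := by
    rw [Finset.sum_comm]
    exact Finset.sum_congr rfl fun i _ => Finset.sum_congr rfl fun j _ => by rw [hs]
  have e2 : ∑ I : Fin 3 × Fin 3, tf (π.τ I.1 I.2 x) * tf (π'.e I.1 I.2 x)
      = cst (1 / 2) * (∑ i, ∑ j, tf (π.τ i j x) * tf (pd Ω j (π'.u i) x))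
        + cst (1 / 2) * ∑ i, ∑ j, tf (π.τ i j x) * tf (pd Ω i (π'.u j) x) := by
    rw [Fintype.sum_prod_type]
    simp only [Finset.mul_sum, ← Finset.sum_add_distrib, he]
    exact Finset.sum_congr rfl fun i _ => Finset.sum_congr rfl fun j _ => by ring
  rw [e2, ← e1, ← add_mul, h2, one_mul]
  exact Finset.sum_congr rfl fun i _ => Finset.sum_congr rfl fun j _ => by rw [hs]

theorem sum_tf_μ (hx : x ∈ Ω.region) {π' : ProcessFields} {d' : Data}
    (h' : IsSolution M Ω bp d' π') :
    ∑ i, ∑ k, ∑ j, tf (π.μ k j i x) * tf (pd Ω j (pd Ω k (π'.u i)) x)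
      = ∑ I : Fin 3 × Fin 3 × Fin 3,
        tf (π.μ I.1 I.2.1 I.2.2 x) * tf (π'.κ I.1 I.2.1 I.2.2 x) := by
  simp only [Fintype.sum_prod_type]
  rw [Finset.sum_comm]
  refine Finset.sum_congr rfl fun k _ => ?_
  rw [Finset.sum_comm]
  refine Finset.sum_congr rfl fun j _ => Finset.sum_congr rfl fun i _ => ?_
  rw [tf_congr fun t ht => h'.field.κ_eq k j i x hx t ht]

theorem sum_tf_σ (hx : x ∈ Ω.region) {π' : ProcessFields} {d' : Data}
    (h' : IsSolution M Ω bp d' π') :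
    ∑ j, tf (π.σ j x) * tf (pd Ω j π'.φ x) = -∑ j, tf (π.σ j x) * tf (π'.E j x) := by
  have hxc := Ω.region_subset_closed hx
  rw [← Finset.sum_neg_distrib]
  refine Finset.sum_congr rfl fun j _ => ?_
  have hp := rep_tf ((h'.admissible.φ_class.contOn_pd (by norm_num) j).time hxc)
  rw [tf_congr fun t ht => h'.field.E_eq j x hx t ht, hp.neg.2]
  ring

theorem sum_tf_Q (hx : x ∈ Ω.region) {π' : ProcessFields} {d' : Data}
    (h' : IsSolution M Ω bp d' π') :
    ∑ k, ∑ j, tf (π.Q k j x) * tf (pd Ω j (pd Ω k π'.φ) x)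
      = -∑ I : Fin 3 × Fin 3, tf (π.Q I.1 I.2 x) * tf (π'.V I.1 I.2 x) := by
  have hxc := Ω.region_subset_closed hx
  rw [Fintype.sum_prod_type]
  simp only [← Finset.sum_neg_distrib]
  refine Finset.sum_congr rfl fun k _ => Finset.sum_congr rfl fun j _ => ?_
  have hp := rep_tf ((h'.admissible.φ_class.contOn_pd_pd (by norm_num) j k).time hxc)
  rw [tf_congr fun t ht => h'.field.V_eq k j x hx t ht, hp.neg.2]
  ring

end

/-! ### Symmetry of the density -/

section

variable {M : Material} {Ω : Body} {bp : BoundaryPartition Ω} {d d' : Data} {π π' : ProcessFields}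
  {x : E3}

/-- The internal force and the charge enter the supply density with a sign opposite to that in `ξ *
power`, and so does `q_{j,j}` in the heat density. After these cancellations only pairings governed
by the constitutive laws, the product of displacements and the initial-value terms survive. -/
theorem rep_recipDensity (h : IsSolution M Ω bp d π) (h' : IsSolution M Ω bp d' π')
    (hx : x ∈ Ω.region) :
    Rep (recipDensity M Ω π π' x) (cst M.ρ * (∑ i, tf (π.u i x) * tf (π'.u i x))
      + tf lOne * tf lOne * ((∑ I : Fin 3 × Fin 3, tf (π.τ I.1 I.2 x) * tf (π'.e I.1 I.2 x))
        - (∑ I : Fin 3 × Fin 3, tf (π.Q I.1 I.2 x) * tf (π'.V I.1 I.2 x))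
        - cst M.ρ * tf (π.η x) * tf (M.A π'.θ x))
      + tf lOne * tf lOne * ((∑ I : Fin 3 × Fin 3 × Fin 3,
          tf (π.μ I.1 I.2.1 I.2.2 x) * tf (π'.κ I.1 I.2.1 I.2.2 x))
        - ∑ j, tf (π.σ j x) * tf (π'.E j x))
      + tf lOne * tf lOne * (tf lOne * (∑ i, cst (1 / M.T₀) * tf (π.q i x)
          * tf (pd Ω i (M.A π'.θ) x))
        + cst M.β * tf lOne * ∑ i, (∑ j, cst (M.k i j) * cst (pd Ω j π.θ x 0))
          * tf (pd Ω i π'.θ x))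
      + cst (M.γ / M.β) * cst (π.θ x 0) * (tf lOne * tf lOne) * tf (π'.θ x)) := by
  have hxc := Ω.region_subset_closed hx
  have ha := h.admissible
  have ha' := h'.admissible
  have of : ∀ {f : Field}, ContOn Ω.closed f → Rep (f x) (tf (f x)) := fun hf => rep_tf (hf.time hxc)
  have rS := fun i => of (contOn_force ha i)
  have rD := of (contOn_charge ha)
  have ru' := fun i => of (ha'.u_class i).contOn_self
  have rφ' := of ha'.φ_class.contOn_self
  have rA' := of (contOn_A (M := M) ha'.θ_class)
  have rqd := fun j => of ((ha.q_class j).contOn_pd le_rfl j)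
  have supply := (Rep.sum (S := Finset.univ) fun i =>
    (((of (ha.u_class i).contOn_self).const_mul M.ρ).sub (rep_xi.conv (rS i))).conv (ru' i)).sub
    ((rep_xi.conv rD).conv rφ')
  have power := ((Rep.sum (S := Finset.univ) fun i =>
      ((Rep.sum (S := Finset.univ) fun j => (of (ha.τ_class j i).contOn_self).conv
        (of ((ha'.u_class i).contOn_pd (by norm_num) j))).add
      (Rep.sum (S := Finset.univ) fun k => Rep.sum (S := Finset.univ) fun j =>
        (of (ha.μ_class k j i).contOn_self).conv
        (of ((ha'.u_class i).contOn_pd_pd (by norm_num) j k)))).add ((rS i).conv (ru' i))).add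
    (((Rep.sum (S := Finset.univ) fun j => (of (ha.σ_class j).contOn_self).conv
        (of (ha'.φ_class.contOn_pd (by norm_num) j))).add
      (Rep.sum (S := Finset.univ) fun k => Rep.sum (S := Finset.univ) fun j =>
        (of (ha.Q_class k j).contOn_self).conv
        (of (ha'.φ_class.contOn_pd_pd (by norm_num) j k)))).add (rD.conv rφ'))).add
    ((rep_lOne.conv (Rep.sum (S := Finset.univ) fun j => ((rqd j).conv rA').add
      ((of (ha.q_class j).contOn_self).conv
        (of (contOn_pd_A (M := M) ha'.θ_class j))))).const_mul (1 / M.T₀))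
  have heat := ((((rep_xi.const_mul (1 / M.β * M.γ * π.θ x 0)).neg.conv
      (of ha'.θ_class.contOn_self)).neg).sub
    (((rep_xi.conv (((of ha.η_class.contOn_self).const_mul (M.ρ * M.T₀)).add
      (rep_lOne.conv (Rep.sum (S := Finset.univ) rqd)))).conv rA').const_mul (1 / M.T₀))).add
    (Rep.sum (S := Finset.univ) fun j => ((rep_xi.conv (rep_lOne.const_mul
      (∑ i, M.k i j * pd Ω i π.θ x 0))).const_mul M.β).conv
      (of (ha'.θ_class.contOn_pd one_le_two j)))
  -- The representing ring element is left to unification; from here on the proof is ring algebra.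
  have key : Rep (recipDensity M Ω π π' x) _ := (supply.add (rep_xi.conv power)).add heat
  refine ⟨key.1, key.2.trans ?_⟩
  have s1 := sum_tf_τ h hx h'
  have s2 := sum_tf_μ (π := π) hx h'
  have s3 := sum_tf_σ (π := π) hx h'
  have s4 := sum_tf_Q (π := π) hx h'
  have c1 : cst (1 / M.T₀) * cst (M.ρ * M.T₀) = cst M.ρ := by
    rw [← map_mul]
    congr 1
    field_simp [M.T₀_pos.ne']
  have c2 : cst (1 / M.β * M.γ * π.θ x 0) = cst (M.γ / M.β) * cst (π.θ x 0) := by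
    rw [← map_mul]
    congr 1
    ring
  have t1 : ∑ i, (cst M.ρ * tf (π.u i x) - tf lOne * tf lOne
        * tf (innerForce Ω (fun j => π.τ j i) (fun k j => π.μ k j i) x)) * tf (π'.u i x)
      = cst M.ρ * (∑ i, tf (π.u i x) * tf (π'.u i x)) - tf lOne * tf lOne
        * ∑ i, tf (innerForce Ω (fun j => π.τ j i) (fun k j => π.μ k j i) x) * tf (π'.u i x) := by
    rw [Finset.mul_sum, Finset.mul_sum, ← Finset.sum_sub_distrib]
    exact Finset.sum_congr rfl fun i _ => by ring
  have t2 : ∑ i, cst (1 / M.T₀) * tf (π.q i x) * tf (pd Ω i (M.A π'.θ) x)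
      = cst (1 / M.T₀) * ∑ i, tf (π.q i x) * tf (pd Ω i (M.A π'.θ) x) := by
    rw [Finset.mul_sum]
    exact Finset.sum_congr rfl fun i _ => by ring
  have t3 : ∑ j, cst M.β * (tf lOne * tf lOne * (cst (∑ i, M.k i j * pd Ω i π.θ x 0) * tf lOne))
        * tf (pd Ω j π'.θ x)
      = tf lOne * tf lOne * (cst M.β * tf lOne
        * ∑ i, (∑ j, cst (M.k i j) * cst (pd Ω j π.θ x 0)) * tf (pd Ω i π'.θ x)) := by
    rw [Finset.mul_sum, Finset.mul_sum]
    refine Finset.sum_congr rfl fun j _ => ?_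
    simp only [M.k_symm j, map_sum, map_mul]
    ring
  rw [t1, t2, t3, c2]
  simp only [Finset.sum_add_distrib]
  rw [s1, s2, s3, s4, ← Finset.sum_mul]
  linear_combination (-(tf lOne * tf lOne) * tf (π.η x) * tf (M.A π'.θ x)) * c1

theorem recipDensity_comm {d : Fin 2 → Data} {π : Fin 2 → ProcessFields}
    (h : ∀ α, IsSolution M Ω bp (d α) (π α)) (hx : x ∈ Ω.region) {t : ℝ} (ht : 0 ≤ t)
    (α β : Fin 2) : recipDensity M Ω (π α) (π β) x t = recipDensity M Ω (π β) (π α) x t := by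
  have hxc := Ω.region_subset_closed hx
  refine (rep_recipDensity (h α) (h β) hx).eqOn (rep_recipDensity (h β) (h α) hx) ?_ ht
  have e0 : ∑ i, tf ((π α).u i x) * tf ((π β).u i x) = ∑ i, tf ((π β).u i x) * tf ((π α).u i x) :=
    Finset.sum_congr rfl fun i _ => mul_comm _ _
  have e1 := stress_reciprocity
    (a := fun I J : Fin 3 × Fin 3 => cst (M.a11 I.1 I.2 J.1 J.2))
    (b := fun I J : Fin 3 × Fin 3 => cst (M.a17 I.1 I.2 J.1 J.2))
    (d := fun I J : Fin 3 × Fin 3 => cst (M.a77 I.1 I.2 J.1 J.2))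
    (fun I J => by rw [(M.a11_symm I.1 I.2 J.1 J.2).2])
    (fun I J => by rw [(M.a77_symm I.1 I.2 J.1 J.2).2])
    (fun α => tf_τ (h α) hx) (fun α => tf_Q (h α) hx) (fun α => tf_η (h α) hx) α β
  have e2 := doubleStress_reciprocity
    (a := fun I J : Fin 3 × Fin 3 × Fin 3 => cst (M.a22 I.1 I.2.1 I.2.2 J.1 J.2.1 J.2.2))
    (b := fun (I : Fin 3 × Fin 3 × Fin 3) j => cst (M.a23 I.1 I.2.1 I.2.2 j))
    (d := fun i j => cst (M.a33 i j))
    (fun I J => by rw [(M.a22_symm I.1 I.2.1 I.2.2 J.1 J.2.1 J.2.2).2])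
    (fun i j => by rw [M.a33_symm i j])
    (fun α => tf_μ (h α) hx) (fun α => tf_σ (h α) hx) α β
  have e3 := flux_reciprocity (k := fun i j => cst (M.k i j)) (fun i j => by rw [M.k_symm i j])
    (fun α => tf_q (h α) hx) (fun α => tf_pd_A (h α) hx) α β
  have eA := fun α => tf_A (h α) hx
  have eθ : ∀ α, tf lOne * tf (dt (π α).θ x)
      = tf ((π α).θ x) - cst ((π α).θ x 0) * tf lOne := fun α =>
    (h α).admissible.θ_class.tf_lOne_mul_dt (n := 0) two_pos hxc
  -- This is where the definition of `β'` enters: the excess of `c β'` over `c β` is `γ / β`, the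
  -- constant in `ℒ`.
  have c3 : cst M.c * cst M.β' = cst M.c * cst M.β + cst (M.γ / M.β) := by
    rw [← map_mul, ← map_mul, ← map_add]
    congr 1
    unfold Material.β'
    field_simp [M.c_ne, M.β_ne]
  -- The part of the entropy pairing left out of `e1`. Its antisymmetric part is `γ/β` times `θ̇_α *
  -- θ_β - θ̇_β * θ_α`. One of the two factors `l` integrates `θ̇`; the products of temperatures
  -- cancel and initial values remain, balanced by the `ℒ` terms.
  have e4 : tf lOne * tf lOne * (cst M.c * (tf ((π α).θ x) + cst M.β' * tf (dt (π α).θ x))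
        * tf (M.A (π β).θ x) - cst M.c * (tf ((π β).θ x) + cst M.β' * tf (dt (π β).θ x))
        * tf (M.A (π α).θ x))
      = cst (M.γ / M.β) * (tf lOne * tf lOne) * (cst ((π β).θ x 0) * tf ((π α).θ x)
        - cst ((π α).θ x 0) * tf ((π β).θ x)) := by
    rw [eA, eA]
    linear_combination tf lOne * tf lOne * (tf (dt (π α).θ x) * tf ((π β).θ x)
        - tf (dt (π β).θ x) * tf ((π α).θ x)) * c3
      + cst (M.γ / M.β) * tf lOne * (tf ((π β).θ x) * eθ α - tf ((π α).θ x) * eθ β)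
  linear_combination cst M.ρ * e0 + tf lOne * tf lOne * e1 + tf lOne * tf lOne * e2
    + tf lOne * tf lOne * e3 + e4

end

end

end ThermoPiezo


theorem mainTheorem2 (M : ThermoPiezo.Material) (Ω : ThermoPiezo.Body)
    (bp : ThermoPiezo.BoundaryPartition Ω)
    (d : Fin 2 → ThermoPiezo.Data) (π : Fin 2 → ThermoPiezo.ProcessFields)
    (hπ : ∀ α, ThermoPiezo.IsSolution M Ω bp (d α) (π α)) :
    ∀ t : ℝ, 0 ≤ t → ∀ α β : Fin 2,
      ThermoPiezo.recipI M Ω (d α) (π α) (π β) t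
        = ThermoPiezo.recipI M Ω (d β) (π β) (π α) t := by
  intro t ht α β
  rw [ThermoPiezo.recipI_eq_integral (hπ α) (hπ β).admissible ht,
    ThermoPiezo.recipI_eq_integral (hπ β) (hπ α).admissible ht]
  exact MeasureTheory.setIntegral_congr_fun Ω.region_isOpen.measurableSet
    fun x hx => ThermoPiezo.recipDensity_comm hπ hx ht α β
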